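/- **Theorem (discrete maximal parabolic regularity in general norms).** Let $d\in\{2,3\}$, let $\Omega\subset\mathbb R^d$ be a bounded Lipschitz domain, $T>0$, $I=(0,T)$, and let integers $q\ge 0$, $r\ge 1$, constants $c,\beta,\kappa>0$, an angle $\gamma\in(0,\frac{\pi}{2})$ and an exponent $1\le s\le\infty$ be given. Then there is a constant $C>0$, depending only on these data, such that the following holds. *Time mesh.* Let $0=t_0<t_1<\dots<t_M=T$, $I_m=(t_{m-1},t_m]$, $k_m=t_m-t_{m-1}$, $k=\max_m k_m$, $k_{\min}=\min_m k_m$, and suppose that $k_{\min}\ge c\,k^\beta$, that $\kappa^{-1}\le k_m/k_{m+1}\le\kappa$ for $1\le m\le M-1$, and that $k\le T/4$. *Space mesh.* Let $\mathcal T$ be any finite partition of $\Omega$ into cells (triangles, tetrahedra, quadrilaterals or hexahedra, not necessarily quasi-uniform), and let $V_h$ be the space of all (complex-valued) functions in $H^1_0(\Omega)$ which on each cell belong to $P_r$ or $Q_r$ (in the coordinates $x$ or in those of the reference cell). Let $P_h\colon L^2(\Omega)\to V_h$ be the $L^2$-orthogonal projection, and $\Delta_h\colon V_h\to V_h$ the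 discrete Laplacian, $(-\Delta_h v,\chi)_\Omega=(\nabla v,\nabla\chi)_\Omega$ for all $v,\chi\in V_h$. *Norm.* Let $|\!|\!|\cdot|\!|\!|$ be a norm on $V_h$ and $M_h$ a constant such that $$|\!|\!|(z+\Delta_h)^{-1}\chi|\!|\!|\le\frac{M_h}{|z|}|\!|\!|\chi|\!|\!|\qquad\text{for all }\chi\in V_h\text{ and all }z\in\mathbb C\text{ with }|\arg z|>\gamma .$$ *Discrete solution.* Let $f\in L^1(I;L^2(\Omega))$, and let $u_{kh}$ be a dG($q$)cG($r$) solution of the heat equation with right-hand side $f$, homogeneous Dirichlet boundary conditions and $u_0=0$. That is, with $X_{kh}$ the space of all $v$ such that $v|_{I_m}$ is a polynomial in $t$ of degree at most $q$ with coefficients in $V_h$ for $m=1,\dots,M$, and with $v_m^\pm=\lim_{\varepsilon\to0^+}v(t_m\pm\varepsilon)$, $[v]_m=v_m^+-v_m^-$ for $1\le m\le M-1$ and $[v]_0=v_0^+$, we have $u_{kh}\in X_{kh}$ and $$\sum_{m=1}^M(\partial_tu_{kh},\varphi)_{I_m\times\Omega}+(\nabla u_{kh},\nabla\varphi)_{I\times\Omega}+\sum_{m=2}^M([u_{kh}]_{m-1},\varphi_{m-1}^+)_\Omega+(u_{kh,0}^+,\varphi_0^+)_\Omega=(f,\varphi)_{I\times\Omega}\qquad\text{for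 all }\varphi\in X_{kh}.$$ *Conclusion.* Then $$\Bigl(\sum_{m=1}^M\int_{I_m}|\!|\!|\partial_tu_{kh}(t)|\!|\!|^s\,dt\Bigr)^{\frac1s}+\Bigl(\sum_{m=1}^M\int_{I_m}|\!|\!|\Delta_hu_{kh}(t)|\!|\!|^s\,dt\Bigr)^{\frac1s}+\Bigl(\sum_{m=1}^Mk_m|\!|\!|k_m^{-1}[u_{kh}]_{m-1}|\!|\!|^s\Bigr)^{\frac1s}\le C\,M_h\ln\frac Tk\,\Bigl(\int_I|\!|\!|P_hf(t)|\!|\!|^s\,dt\Bigr)^{\frac1s}.$$ For $s=\infty$ the integral expressions are replaced by the essential suprema of $|\!|\!|\partial_tu_{kh}(t)|\!|\!|$, $|\!|\!|\Delta_hu_{kh}(t)|\!|\!|$ and $|\!|\!|P_hf(t)|\!|\!|$ over $I$, and the sum over the jumps by $\max_m|\!|\!|k_m^{-1}[u_{kh}]_{m-1}|\!|\!|$. (The right-hand side may be $+\infty$.) In particular, $C$ is independent of the time mesh, of the space mesh, of the norm, of $M_h$, and of $f$. -/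

import Mathlib

open MeasureTheory Filter Topology
open scoped ENNReal ContDiff

noncomputable section

namespace DGCG

/-! ### Domains, test functions, weak derivatives, `H¹₀` -/

/-- Euclidean space `ℝ^d`. -/
abbrev Eu (d : ℕ) : Type := EuclideanSpace ℝ (Fin d)

/-- A (bounded) Lipschitz domain: a bounded, connected, nonempty open set which near each of its
boundary points is the region above the graph of a Lipschitz function, in some orthonormal frame.
Here `n` is the last direction of the frame, and `g` is evaluated at the component of `x`
orthogonal to `n`. -/
structure IsLipschitzDomain {d : ℕ} (Ω : TopologicalSpace.Opens (Eu d)) : Prop where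
  connected : IsConnected (Ω : Set (Eu d))
  bounded : Bornology.IsBounded (Ω : Set (Eu d))
  lipschitz : ∀ x₀ ∈ frontier (Ω : Set (Eu d)), ∃ (n : Eu d) (K : NNReal) (g : Eu d → ℝ),
    ‖n‖ = 1 ∧ LipschitzWith K g ∧
      ∀ᶠ x in 𝓝 x₀, x ∈ Ω ↔ g (x - (inner ℝ n x : ℝ) • n) < inner ℝ n x

/-- The complex Hilbert space `L²(Ω)`. -/
abbrev L2 {d : ℕ} (Ω : TopologicalSpace.Opens (Eu d)) : Type :=
  Lp ℂ 2 ((volume : Measure (Eu d)).restrict (Ω : Set (Eu d)))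

/-- `φ ∈ C_c^∞(Ω)`. -/
structure IsTest {d : ℕ} (Ω : TopologicalSpace.Opens (Eu d)) (φ : Eu d → ℂ) : Prop where
  smooth : ContDiff ℝ ∞ φ
  compact : HasCompactSupport φ
  support : tsupport φ ⊆ (Ω : Set (Eu d))

/-- The classical partial derivative `∂_i φ`. -/
def partialD {d : ℕ} (i : Fin d) (φ : Eu d → ℂ) (x : Eu d) : ℂ :=
  fderiv ℝ φ x (EuclideanSpace.single i (1 : ℝ))

/-- `g ∈ L²(Ω)` is the weak `i`-th partial derivative of `v ∈ L²(Ω)`. -/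
def IsWeakPartial {d : ℕ} {Ω : TopologicalSpace.Opens (Eu d)} (i : Fin d) (v g : L2 Ω) : Prop :=
  ∀ φ : Eu d → ℂ, IsTest Ω φ →
    ∫ x in (Ω : Set (Eu d)), v x * partialD i φ x = - ∫ x in (Ω : Set (Eu d)), g x * φ x

/-- `v ∈ H¹₀(Ω)`: `v` has a weak gradient in `L²(Ω)` and is a limit in the `H¹`-norm of functions
in `C_c^∞(Ω)`. -/
def MemH10 {d : ℕ} {Ω : TopologicalSpace.Opens (Eu d)} (v : L2 Ω) : Prop :=
  ∃ g : Fin d → L2 Ω, (∀ i, IsWeakPartial i v (g i)) ∧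
    ∀ ε : ℝ≥0∞, 0 < ε → ∃ φ : Eu d → ℂ, IsTest Ω φ ∧
      eLpNorm (fun x => v x - φ x) 2 (volume.restrict (Ω : Set (Eu d))) ≤ ε ∧
      ∀ i, eLpNorm (fun x => g i x - partialD i φ x) 2 (volume.restrict (Ω : Set (Eu d))) ≤ ε

section basic

variable {d : ℕ} {Ω : TopologicalSpace.Opens (Eu d)}

theorem IsTest.zero : IsTest Ω (fun _ => (0 : ℂ)) where
  smooth := contDiff_const
  compact := HasCompactSupport.zero
  support := by
    have : tsupport (fun _ : Eu d => (0 : ℂ)) = ∅ := by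
      rw [tsupport_eq_empty_iff]; rfl
    simp [this]

theorem IsTest.add {φ ψ : Eu d → ℂ} (hφ : IsTest Ω φ) (hψ : IsTest Ω ψ) :
    IsTest Ω (fun x => φ x + ψ x) where
  smooth := hφ.smooth.add hψ.smooth
  compact := hφ.compact.add hψ.compact
  support := (tsupport_add φ ψ).trans (Set.union_subset hφ.support hψ.support)

theorem IsTest.const_mul {φ : Eu d → ℂ} (c : ℂ) (hφ : IsTest Ω φ) :
    IsTest Ω (fun x => c * φ x) where
  smooth := contDiff_const.mul hφ.smooth
  compact := hφ.compact.mul_left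
  support := (tsupport_mul_subset_right (f := fun _ => c) (g := φ)).trans hφ.support

theorem partialD_add {φ ψ : Eu d → ℂ} (hφ : IsTest Ω φ) (hψ : IsTest Ω ψ) (i : Fin d) (x : Eu d) :
    partialD i (fun x => φ x + ψ x) x = partialD i φ x + partialD i ψ x := by
  have h1 : DifferentiableAt ℝ φ x := (hφ.smooth.differentiable (by simp)) x
  have h2 : DifferentiableAt ℝ ψ x := (hψ.smooth.differentiable (by simp)) x
  simp [partialD, fderiv_fun_add h1 h2]

theorem partialD_const_mul {φ : Eu d → ℂ} (c : ℂ) (hφ : IsTest Ω φ) (i : Fin d) (x : Eu d) :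
    partialD i (fun x => c * φ x) x = c * partialD i φ x := by
  have h1 : DifferentiableAt ℝ φ x := (hφ.smooth.differentiable (by simp)) x
  simp [partialD, fderiv_const_mul h1 c]

theorem IsTest.continuous_partialD {φ : Eu d → ℂ} (hφ : IsTest Ω φ) (i : Fin d) :
    Continuous (partialD i φ) := by
  have h := hφ.smooth.continuous_fderiv (by simp)
  exact h.clm_apply continuous_const

theorem IsTest.memLp {φ : Eu d → ℂ} (hφ : IsTest Ω φ) :
    MemLp φ 2 (volume.restrict (Ω : Set (Eu d))) :=
  (hφ.smooth.continuous.memLp_of_hasCompactSupport hφ.compact).restrict _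

theorem IsTest.memLp_partialD {φ : Eu d → ℂ} (hφ : IsTest Ω φ) (i : Fin d) :
    MemLp (partialD i φ) 2 (volume.restrict (Ω : Set (Eu d))) :=
  ((hφ.continuous_partialD i).memLp_of_hasCompactSupport
    ((hφ.compact.fderiv ℝ).comp_left
      (g := fun L : Eu d →L[ℝ] ℂ => L (EuclideanSpace.single i (1 : ℝ))) (by simp))).restrict _

theorem integrable_mul_of_memLp (v : L2 Ω) {φ : Eu d → ℂ}
    (hφ : MemLp φ 2 (volume.restrict (Ω : Set (Eu d)))) :
    IntegrableOn (fun x => v x * φ x) (Ω : Set (Eu d)) :=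
  MemLp.integrable_mul (Lp.memLp v) hφ

theorem IsWeakPartial.add {i : Fin d} {v w g k : L2 Ω} (hv : IsWeakPartial i v g)
    (hw : IsWeakPartial i w k) : IsWeakPartial i (v + w) (g + k) := by
  intro φ hφ
  have e1 : ∫ x in (Ω : Set (Eu d)), (v + w : L2 Ω) x * partialD i φ x
      = ∫ x in (Ω : Set (Eu d)), (v x * partialD i φ x + w x * partialD i φ x) := by
    refine integral_congr_ae ?_
    filter_upwards [Lp.coeFn_add v w] with x hx
    rw [hx]; simp [add_mul]
  have e2 : ∫ x in (Ω : Set (Eu d)), (g + k : L2 Ω) x * φ x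
      = ∫ x in (Ω : Set (Eu d)), (g x * φ x + k x * φ x) := by
    refine integral_congr_ae ?_
    filter_upwards [Lp.coeFn_add g k] with x hx
    rw [hx]; simp [add_mul]
  rw [e1, e2, integral_add (integrable_mul_of_memLp v (hφ.memLp_partialD i))
    (integrable_mul_of_memLp w (hφ.memLp_partialD i)),
    integral_add (integrable_mul_of_memLp g hφ.memLp) (integrable_mul_of_memLp k hφ.memLp),
    hv φ hφ, hw φ hφ]
  ring

theorem IsWeakPartial.smul {i : Fin d} {v g : L2 Ω} (c : ℂ) (hv : IsWeakPartial i v g) :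
    IsWeakPartial i (c • v) (c • g) := by
  intro φ hφ
  have e1 : ∫ x in (Ω : Set (Eu d)), (c • v : L2 Ω) x * partialD i φ x
      = ∫ x in (Ω : Set (Eu d)), c * (v x * partialD i φ x) := by
    refine integral_congr_ae ?_
    filter_upwards [Lp.coeFn_smul c v] with x hx
    rw [hx]; simp [mul_assoc]
  have e2 : ∫ x in (Ω : Set (Eu d)), (c • g : L2 Ω) x * φ x
      = ∫ x in (Ω : Set (Eu d)), c * (g x * φ x) := by
    refine integral_congr_ae ?_
    filter_upwards [Lp.coeFn_smul c g] with x hx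
    rw [hx]; simp [mul_assoc]
  rw [e1, e2, integral_const_mul, integral_const_mul, hv φ hφ]
  ring

/-- Weak derivatives are unique. -/
theorem IsWeakPartial.unique {i : Fin d} {v g k : L2 Ω} (hg : IsWeakPartial i v g)
    (hk : IsWeakPartial i v k) : g = k := by
  have h0 : IsWeakPartial i (v + (-1 : ℂ) • v) (g + (-1 : ℂ) • k) := hg.add (hk.smul (-1))
  have hv0 : v + (-1 : ℂ) • v = 0 := by simp
  have hgk : g + (-1 : ℂ) • k = g - k := by simp [sub_eq_add_neg]
  rw [hv0, hgk] at h0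
  have hloc : LocallyIntegrableOn (fun x => (g - k : L2 Ω) x) (Ω : Set (Eu d)) volume := by
    have h1 : LocallyIntegrable (fun x => (g - k : L2 Ω) x)
        ((volume : Measure (Eu d)).restrict (Ω : Set (Eu d))) :=
      (Lp.memLp (g - k)).locallyIntegrable (by norm_num)
    intro x hx
    obtain ⟨t, ht, hti⟩ := h1 x
    refine ⟨t ∩ (Ω : Set (Eu d)), inter_mem (mem_nhdsWithin_of_mem_nhds ht) self_mem_nhdsWithin, ?_⟩
    have h2 : IntegrableOn (fun x => (g - k : L2 Ω) x) t
        ((volume : Measure (Eu d)).restrict (Ω : Set (Eu d))) := hti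
    rw [IntegrableOn, Measure.restrict_restrict' Ω.isOpen.measurableSet] at h2
    exact h2
  have hz : ∀ᵐ x ∂(volume : Measure (Eu d)), x ∈ (Ω : Set (Eu d)) → (g - k : L2 Ω) x = 0 := by
    refine Ω.isOpen.ae_eq_zero_of_integral_contDiff_smul_eq_zero hloc ?_
    intro φ h1 h2 h3
    have ht : IsTest Ω (fun x => (φ x : ℂ)) :=
      { smooth := Complex.ofRealCLM.contDiff.comp h1
        compact := h2.comp_left (g := fun y : ℝ => (y : ℂ)) (by simp)
        support := by
          refine (closure_mono ?_).trans h3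
          intro x hx
          simpa using hx }
    have h4 := h0 _ ht
    have h5 : ∫ x in (Ω : Set (Eu d)), (0 : L2 Ω) x * partialD i (fun x => (φ x : ℂ)) x = 0 := by
      rw [← integral_zero (Eu d) ℂ (μ := volume.restrict (Ω : Set (Eu d)))]
      refine integral_congr_ae ?_
      filter_upwards [Lp.coeFn_zero ℂ 2 ((volume : Measure (Eu d)).restrict (Ω : Set (Eu d)))]
        with x hx
      rw [hx]; simp
    rw [h5] at h4
    have h6 : ∫ x in (Ω : Set (Eu d)), (g - k : L2 Ω) x * (φ x : ℂ) = 0 := by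
      simpa using h4.symm
    rw [← h6, ← setIntegral_eq_integral_of_forall_compl_eq_zero (s := (Ω : Set (Eu d)))]
    · refine integral_congr_ae (Eventually.of_forall fun x => ?_)
      simp [mul_comm]
    · intro x hx
      have : φ x = 0 := by
        by_contra hne
        exact hx (h3 (subset_tsupport _ hne))
      simp [this]
  have : (g - k : L2 Ω) = 0 := by
    refine Lp.ext ?_
    filter_upwards [(ae_restrict_iff' Ω.isOpen.measurableSet).2 hz,
      Lp.coeFn_zero ℂ 2 ((volume : Measure (Eu d)).restrict (Ω : Set (Eu d)))] with x hx hx0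
    rw [hx, hx0]; rfl
  exact sub_eq_zero.1 this

theorem MemH10.zero : MemH10 (0 : L2 Ω) := by
  have hc := Lp.coeFn_zero ℂ 2 ((volume : Measure (Eu d)).restrict (Ω : Set (Eu d)))
  refine ⟨fun _ => 0, ?_, ?_⟩
  · intro i φ hφ
    have e : ∀ ψ : Eu d → ℂ, ∫ x in (Ω : Set (Eu d)), (0 : L2 Ω) x * ψ x = 0 := by
      intro ψ
      rw [← integral_zero (Eu d) ℂ (μ := volume.restrict (Ω : Set (Eu d)))]
      refine integral_congr_ae ?_
      filter_upwards [hc] with x hx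
      rw [hx]; simp
    rw [e, e]; simp
  · intro ε _
    refine ⟨fun _ => 0, IsTest.zero, ?_, ?_⟩
    · rw [eLpNorm_congr_ae (g := fun _ => (0 : ℂ))]
      · simp
      · filter_upwards [hc] with x hx
        rw [hx]; simp
    · intro i
      rw [eLpNorm_congr_ae (g := fun _ => (0 : ℂ))]
      · simp
      · filter_upwards [hc] with x hx
        rw [hx]; simp [partialD]

theorem MemH10.add {v w : L2 Ω} (hv : MemH10 v) (hw : MemH10 w) : MemH10 (v + w) := by
  obtain ⟨g, hg, hga⟩ := hv
  obtain ⟨k, hk, hka⟩ := hw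
  refine ⟨fun i => g i + k i, fun i => (hg i).add (hk i), fun ε hε => ?_⟩
  obtain ⟨φ, hφ, hφ1, hφ2⟩ := hga (ε / 2) (ENNReal.half_pos hε.ne')
  obtain ⟨ψ, hψ, hψ1, hψ2⟩ := hka (ε / 2) (ENNReal.half_pos hε.ne')
  refine ⟨_, hφ.add hψ, ?_, fun i => ?_⟩
  · calc _ = eLpNorm ((fun x => v x - φ x) + fun x => w x - ψ x) 2
          (volume.restrict (Ω : Set (Eu d))) := by
            refine eLpNorm_congr_ae ?_
            filter_upwards [Lp.coeFn_add v w] with x hx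
            rw [hx]; simp only [Pi.add_apply]; ring
      _ ≤ _ := eLpNorm_add_le ((Lp.aestronglyMeasurable v).sub hφ.memLp.1)
            ((Lp.aestronglyMeasurable w).sub hψ.memLp.1) (by norm_num)
      _ ≤ ε / 2 + ε / 2 := add_le_add hφ1 hψ1
      _ = ε := ENNReal.add_halves ε
  · calc _ = eLpNorm ((fun x => g i x - partialD i φ x) + fun x => k i x - partialD i ψ x) 2
          (volume.restrict (Ω : Set (Eu d))) := by
            refine eLpNorm_congr_ae ?_
            filter_upwards [Lp.coeFn_add (g i) (k i)] with x hx
            rw [hx, partialD_add hφ hψ]; simp only [Pi.add_apply]; ring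
      _ ≤ _ := eLpNorm_add_le ((Lp.aestronglyMeasurable _).sub (hφ.memLp_partialD i).1)
            ((Lp.aestronglyMeasurable _).sub (hψ.memLp_partialD i).1) (by norm_num)
      _ ≤ ε / 2 + ε / 2 := add_le_add (hφ2 i) (hψ2 i)
      _ = ε := ENNReal.add_halves ε

theorem MemH10.smul {v : L2 Ω} (c : ℂ) (hv : MemH10 v) : MemH10 (c • v) := by
  by_cases hc : c = 0
  · subst hc; rw [zero_smul]; exact MemH10.zero
  have hc' : ‖c‖ₑ ≠ 0 := by simpa using hc
  obtain ⟨g, hg, hga⟩ := hv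
  refine ⟨fun i => c • g i, fun i => (hg i).smul c, fun ε hε => ?_⟩
  obtain ⟨φ, hφ, hφ1, hφ2⟩ := hga (ε / ‖c‖ₑ) (ENNReal.div_pos hε.ne' (by simp))
  refine ⟨_, hφ.const_mul c, ?_, fun i => ?_⟩
  · calc _ = eLpNorm (c • fun x => v x - φ x) 2 (volume.restrict (Ω : Set (Eu d))) := by
            refine eLpNorm_congr_ae ?_
            filter_upwards [Lp.coeFn_smul c v] with x hx
            rw [hx]; simp only [Pi.smul_apply, smul_eq_mul]; ring
      _ = ‖c‖ₑ * _ := eLpNorm_const_smul _ _ _ _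
      _ ≤ ‖c‖ₑ * (ε / ‖c‖ₑ) := by gcongr
      _ = ε := ENNReal.mul_div_cancel hc' (by simp)
  · calc _ = eLpNorm (c • fun x => g i x - partialD i φ x) 2
            (volume.restrict (Ω : Set (Eu d))) := by
            refine eLpNorm_congr_ae ?_
            filter_upwards [Lp.coeFn_smul c (g i)] with x hx
            rw [hx, partialD_const_mul c hφ]; simp only [Pi.smul_apply, smul_eq_mul]; ring
      _ = ‖c‖ₑ * _ := eLpNorm_const_smul _ _ _ _
      _ ≤ ‖c‖ₑ * (ε / ‖c‖ₑ) := by gcongr; exact hφ2 i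
      _ = ε := ENNReal.mul_div_cancel hc' (by simp)

end basic

/-- The space `H¹₀(Ω)`, as a subspace of `L²(Ω)`. -/
def H10 {d : ℕ} (Ω : TopologicalSpace.Opens (Eu d)) : Submodule ℂ (L2 Ω) where
  carrier := {v | MemH10 v}
  zero_mem' := MemH10.zero
  add_mem' := MemH10.add
  smul_mem' c _ hv := MemH10.smul c hv

theorem H10.exists_weakPartial {d : ℕ} {Ω : TopologicalSpace.Opens (Eu d)} (i : Fin d)
    (v : H10 Ω) : ∃ g : L2 Ω, IsWeakPartial i (v : L2 Ω) g := by
  obtain ⟨g, hg, _⟩ := v.2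
  exact ⟨g i, hg i⟩

/-- The weak partial derivative `∂_i : H¹₀(Ω) → L²(Ω)`. -/
def weakD {d : ℕ} (Ω : TopologicalSpace.Opens (Eu d)) (i : Fin d) : H10 Ω →ₗ[ℂ] L2 Ω where
  toFun v := Classical.choose (H10.exists_weakPartial i v)
  map_add' v w := (Classical.choose_spec (H10.exists_weakPartial i (v + w))).unique
    ((Classical.choose_spec (H10.exists_weakPartial i v)).add
      (Classical.choose_spec (H10.exists_weakPartial i w)))
  map_smul' c v := (Classical.choose_spec (H10.exists_weakPartial i (c • v))).unique
    ((Classical.choose_spec (H10.exists_weakPartial i v)).smul c)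

theorem weakD_spec {d : ℕ} {Ω : TopologicalSpace.Opens (Eu d)} (i : Fin d) (v : H10 Ω) :
    IsWeakPartial i (v : L2 Ω) (weakD Ω i v) :=
  Classical.choose_spec (H10.exists_weakPartial i v)

/-! ### Meshes and finite element spaces -/

/-- The unit cube `[0,1]^d`. -/
def unitCube (d : ℕ) : Set (Fin d → ℝ) := {y | ∀ i, 0 ≤ y i ∧ y i ≤ 1}

/-- The standard `d`-simplex. -/
def unitSimplex (d : ℕ) : Set (Fin d → ℝ) := {y | (∀ i, 0 ≤ y i) ∧ ∑ i, y i ≤ 1}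

/-- The map, affine in every variable (bilinear for `d = 2`, trilinear for `d = 3`), which sends
the corner of the unit cube with coordinates `1` at `{i | a i = true}` and `0` elsewhere
to `v a`. -/
def multilinearMap {d : ℕ} (v : (Fin d → Bool) → Eu d) (y : Fin d → ℝ) : Eu d :=
  ∑ a : Fin d → Bool, (∏ i, if a i then y i else 1 - y i) • v a

/-- A mesh cell: a nondegenerate simplex (triangle, tetrahedron) with given vertices, or a
quadrilateral / hexahedron with given vertices, that is, an injective image of the unit cube under
the bilinear / trilinear map determined by the vertices. -/
inductive Cell (d : ℕ) : Type
  | simplex (v : Fin (d + 1) → Eu d) (hv : AffineIndependent ℝ v) : Cell d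
  | tensor (v : (Fin d → Bool) → Eu d) (hv : Set.InjOn (multilinearMap v) (unitCube d)) : Cell d

namespace Cell

variable {d : ℕ}

/-- The reference cell. -/
def ref : Cell d → Set (Fin d → ℝ)
  | simplex _ _ => unitSimplex d
  | tensor _ _ => unitCube d

/-- The map from the reference cell onto the cell. -/
def refMap : Cell d → (Fin d → ℝ) → Eu d
  | simplex v _ => fun y => v 0 + ∑ i : Fin d, y i • (v i.succ - v 0)
  | tensor v _ => multilinearMap v

/-- The closed cell, as a subset of `ℝ^d`. -/
def carrier (K : Cell d) : Set (Eu d) := K.refMap '' K.ref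

end Cell

/-- The polynomial space used on a cell: `P_r`, or `Q_r`, in the variable `x`; or (`mapped`) the
functions that become a polynomial in `P_r` (for simplices), `Q_r` (for quadrilaterals and
hexahedra) in the coordinates of the reference cell. -/
inductive ElementKind : Type
  | P | Q | mapped

/-- The space of polynomials in `d` variables which goes with a cell and an element kind. -/
def polySpace {d : ℕ} (r : ℕ) (K : Cell d) : ElementKind → Submodule ℂ (MvPolynomial (Fin d) ℂ)
  | .P => MvPolynomial.restrictTotalDegree (Fin d) ℂ r
  | .Q => MvPolynomial.restrictDegree (Fin d) ℂ r
  | .mapped => match K with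
    | .simplex _ _ => MvPolynomial.restrictTotalDegree (Fin d) ℂ r
    | .tensor _ _ => MvPolynomial.restrictDegree (Fin d) ℂ r

/-- The function on the cell `K` that is given by the polynomial `p` takes the value `y` at `x`
(nothing is required if `x` lies outside `K`). -/
def HasValue {d : ℕ} (K : Cell d) (p : MvPolynomial (Fin d) ℂ) : ElementKind → Eu d → ℂ → Prop
  | .P => fun x y => x ∈ K.carrier → y = MvPolynomial.eval (fun i => (x i : ℂ)) p
  | .Q => fun x y => x ∈ K.carrier → y = MvPolynomial.eval (fun i => (x i : ℂ)) p
  | .mapped => fun x y => ∀ ξ ∈ K.ref, K.refMap ξ = x →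
      y = MvPolynomial.eval (fun i => (ξ i : ℂ)) p

/-- An arbitrary finite partition of `Ω` into cells with disjoint interiors (no conformity, shape
regularity or quasi-uniformity is required), with a choice of a local polynomial space on each
cell. -/
structure Mesh {d : ℕ} (Ω : TopologicalSpace.Opens (Eu d)) : Type where
  n : ℕ
  cell : Fin n → Cell d
  kind : Fin n → ElementKind
  cover : ⋃ j, (cell j).carrier = closure (Ω : Set (Eu d))
  disjoint : Pairwise fun j l =>
    Disjoint (interior (cell j).carrier) (interior (cell l).carrier)

section feSpace

variable {d : ℕ} {Ω : TopologicalSpace.Opens (Eu d)}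

/-- `v` is given by the polynomial `p` on the `j`-th cell. -/
def IsLocally (𝒯 : Mesh Ω) (j : Fin 𝒯.n) (p : MvPolynomial (Fin d) ℂ) (v : L2 Ω) : Prop :=
  ∀ᵐ x ∂((volume : Measure (Eu d)).restrict (Ω : Set (Eu d))),
    HasValue (𝒯.cell j) p (𝒯.kind j) x (v x)

theorem HasValue.zero (K : Cell d) (k : ElementKind) (x : Eu d) : HasValue K 0 k x 0 := by
  cases k <;> simp [HasValue]

theorem HasValue.add {K : Cell d} {k : ElementKind} {p p' : MvPolynomial (Fin d) ℂ} {x : Eu d}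
    {y y' : ℂ} (h : HasValue K p k x y) (h' : HasValue K p' k x y') :
    HasValue K (p + p') k x (y + y') := by
  cases k
  · intro hx; simp [← h hx, ← h' hx]
  · intro hx; simp [← h hx, ← h' hx]
  · intro ξ hξ hx; simp [← h ξ hξ hx, ← h' ξ hξ hx]

theorem HasValue.smul {K : Cell d} {k : ElementKind} {p : MvPolynomial (Fin d) ℂ} {x : Eu d}
    {y : ℂ} (c : ℂ) (h : HasValue K p k x y) : HasValue K (c • p) k x (c • y) := by
  cases k
  · intro hx; simp [← h hx, MvPolynomial.smul_eval]
  · intro hx; simp [← h hx, MvPolynomial.smul_eval]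
  · intro ξ hξ hx; simp [← h ξ hξ hx, MvPolynomial.smul_eval]

theorem HasValue.eq {K : Cell d} {k : ElementKind} {p : MvPolynomial (Fin d) ℂ} {x : Eu d}
    {y y' : ℂ} (hx : x ∈ K.carrier) (h : HasValue K p k x y) (h' : HasValue K p k x y') :
    y = y' := by
  cases k
  · exact (h hx).trans (h' hx).symm
  · exact (h hx).trans (h' hx).symm
  · obtain ⟨ξ, hξ, rfl⟩ := hx
    exact (h ξ hξ rfl).trans (h' ξ hξ rfl).symm

theorem IsLocally.zero (𝒯 : Mesh Ω) (j : Fin 𝒯.n) : IsLocally 𝒯 j 0 0 := by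
  filter_upwards [Lp.coeFn_zero ℂ 2 ((volume : Measure (Eu d)).restrict (Ω : Set (Eu d)))]
    with x hx
  rw [hx]; exact HasValue.zero _ _ _

theorem IsLocally.add {𝒯 : Mesh Ω} {j : Fin 𝒯.n} {p p' : MvPolynomial (Fin d) ℂ} {v v' : L2 Ω}
    (h : IsLocally 𝒯 j p v) (h' : IsLocally 𝒯 j p' v') : IsLocally 𝒯 j (p + p') (v + v') := by
  filter_upwards [Lp.coeFn_add v v', h, h'] with x hx h1 h2
  rw [hx]; exact h1.add h2

theorem IsLocally.smul {𝒯 : Mesh Ω} {j : Fin 𝒯.n} {p : MvPolynomial (Fin d) ℂ} {v : L2 Ω}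
    (c : ℂ) (h : IsLocally 𝒯 j p v) : IsLocally 𝒯 j (c • p) (c • v) := by
  filter_upwards [Lp.coeFn_smul c v, h] with x hx h1
  rw [hx]; exact h1.smul c

/-- The finite element space `V_h`: all functions in `H¹₀(Ω)` which belong to the chosen
polynomial space of degree `r` on each cell. -/
def feSpace (𝒯 : Mesh Ω) (r : ℕ) : Submodule ℂ (L2 Ω) where
  carrier := {v | v ∈ H10 Ω ∧ ∀ j, ∃ p ∈ polySpace r (𝒯.cell j) (𝒯.kind j), IsLocally 𝒯 j p v}
  zero_mem' := ⟨Submodule.zero_mem _, fun j => ⟨0, Submodule.zero_mem _, IsLocally.zero 𝒯 j⟩⟩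
  add_mem' := by
    rintro v w ⟨hv, hv'⟩ ⟨hw, hw'⟩
    refine ⟨Submodule.add_mem _ hv hw, fun j => ?_⟩
    obtain ⟨p, hp, hpv⟩ := hv' j
    obtain ⟨p', hp', hpv'⟩ := hw' j
    exact ⟨p + p', Submodule.add_mem _ hp hp', hpv.add hpv'⟩
  smul_mem' := by
    rintro c v ⟨hv, hv'⟩
    refine ⟨Submodule.smul_mem _ c hv, fun j => ?_⟩
    obtain ⟨p, hp, hpv⟩ := hv' j
    exact ⟨c • p, Submodule.smul_mem _ c hp, hpv.smul c⟩

theorem feSpace_le_H10 (𝒯 : Mesh Ω) (r : ℕ) : feSpace 𝒯 r ≤ H10 Ω := fun _ hv => hv.1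

theorem polySpace_le (r : ℕ) (K : Cell d) (k : ElementKind) :
    polySpace r K k ≤ MvPolynomial.restrictDegree (Fin d) ℂ r := by
  have h := MvPolynomial.restrictTotalDegree_le_restrictDegree (σ := Fin d) ℂ r
  cases k
  · exact h
  · exact le_rfl
  · cases K
    · exact h
    · exact le_rfl

theorem finite_restrictDegree (d r : ℕ) :
    FiniteDimensional ℂ (MvPolynomial.restrictDegree (Fin d) ℂ r) := by
  have hfin : {n : Fin d →₀ ℕ | ∀ i, n i ≤ r}.Finite := by
    refine Set.Finite.subset
      (Set.finite_Iic (Finsupp.equivFunOnFinite.symm (fun _ : Fin d => r))) ?_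
    intro n hn i
    exact hn i
  have := hfin.to_subtype
  exact Module.Finite.of_basis
    (MvPolynomial.basisRestrictSupport ℂ {n : Fin d →₀ ℕ | ∀ i, n i ≤ r})

instance instFiniteDimensionalFeSpace (𝒯 : Mesh Ω) (r : ℕ) :
    FiniteDimensional ℂ (feSpace 𝒯 r) := by
  have := finite_restrictDegree d r
  let W := Fin 𝒯.n → MvPolynomial.restrictDegree (Fin d) ℂ r
  let S : Submodule ℂ (W × feSpace 𝒯 r) :=
    { carrier := {z | ∀ j, IsLocally 𝒯 j (z.1 j : MvPolynomial (Fin d) ℂ) (z.2 : L2 Ω)}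
      zero_mem' := fun j => IsLocally.zero 𝒯 j
      add_mem' := fun {a b} ha hb j => (ha j).add (hb j)
      smul_mem' := fun c {a} ha j => (ha j).smul c }
  let f : S →ₗ[ℂ] W := (LinearMap.fst ℂ W (feSpace 𝒯 r)).comp S.subtype
  let g : S →ₗ[ℂ] feSpace 𝒯 r := (LinearMap.snd ℂ W (feSpace 𝒯 r)).comp S.subtype
  have hf : Function.Injective f := by
    rintro ⟨⟨p, v⟩, h⟩ ⟨⟨p', v'⟩, h'⟩ hpp
    have hp : p = p' := hpp
    subst hp
    have hv : (v : L2 Ω) = v' := by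
      refine Lp.ext ?_
      have h1 := ae_all_iff.2 h
      have h2 := ae_all_iff.2 h'
      filter_upwards [h1, h2, ae_restrict_mem Ω.isOpen.measurableSet] with x hx hx' hxΩ
      have : x ∈ ⋃ j, (𝒯.cell j).carrier := by
        rw [𝒯.cover]; exact subset_closure hxΩ
      obtain ⟨j, hj⟩ := Set.mem_iUnion.1 this
      exact HasValue.eq hj (hx j) (hx' j)
    have hv' : v = v' := Subtype.ext hv
    subst hv'
    rfl
  have hg : Function.Surjective g := by
    intro v
    choose p hp hpv using v.2.2
    exact ⟨⟨⟨fun j => ⟨p j, polySpace_le _ _ _ (hp j)⟩, v⟩, fun j => hpv j⟩, rfl⟩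
  have : FiniteDimensional ℂ S := FiniteDimensional.of_injective f hf
  exact Module.Finite.of_surjective g hg

/-- `∂_i : V_h → L²(Ω)`. -/
def gradV (𝒯 : Mesh Ω) (r : ℕ) (i : Fin d) : feSpace 𝒯 r →ₗ[ℂ] L2 Ω :=
  (weakD Ω i).comp (Submodule.inclusion (feSpace_le_H10 𝒯 r))

/-- The Dirichlet form `(∇v, ∇χ)_Ω = ∑_i ∫_Ω ∂_i v · conj (∂_i χ)` on `V_h`. -/
def dirichlet (𝒯 : Mesh Ω) (r : ℕ) (v χ : feSpace 𝒯 r) : ℂ :=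
  ∑ i, inner ℂ (gradV 𝒯 r i χ) (gradV 𝒯 r i v)

/-- The `L²` inner product `(v, w)_Ω = ∫_Ω v · conj w`. -/
def l2 (v w : L2 Ω) : ℂ := inner ℂ w v

/-- The discrete Laplacian `Δ_h : V_h → V_h`. -/
def discreteLaplacian (𝒯 : Mesh Ω) (r : ℕ) : Module.End ℂ (feSpace 𝒯 r) :=
  -∑ i, ((ContinuousLinearMap.adjoint (LinearMap.toContinuousLinearMap (gradV 𝒯 r i))).toLinearMap
    ∘ₗ gradV 𝒯 r i)

/-- The identity `(-Δ_h v, χ)_Ω = (∇v, ∇χ)_Ω`, which determines `Δ_h`. -/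
theorem discreteLaplacian_spec (𝒯 : Mesh Ω) (r : ℕ) (v χ : feSpace 𝒯 r) :
    l2 ((-discreteLaplacian 𝒯 r v : feSpace 𝒯 r) : L2 Ω) (χ : L2 Ω) = dirichlet 𝒯 r v χ := by
  have h : l2 ((-discreteLaplacian 𝒯 r v : feSpace 𝒯 r) : L2 Ω) (χ : L2 Ω)
      = inner ℂ χ (-discreteLaplacian 𝒯 r v) := rfl
  rw [h]
  simp [discreteLaplacian, dirichlet, ContinuousLinearMap.adjoint_inner_right]

/-- The orthogonal `L²` projection `P_h : L²(Ω) → V_h`. -/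
def l2Projection (𝒯 : Mesh Ω) (r : ℕ) : L2 Ω →L[ℂ] feSpace 𝒯 r :=
  (feSpace 𝒯 r).orthogonalProjectionOnto

/-- The identity `(P_h v, χ)_Ω = (v, χ)_Ω`, which determines `P_h`. -/
theorem l2Projection_spec (𝒯 : Mesh Ω) (r : ℕ) (v : L2 Ω) (χ : feSpace 𝒯 r) :
    l2 (l2Projection 𝒯 r v : L2 Ω) (χ : L2 Ω) = l2 v (χ : L2 Ω) := by
  exact Submodule.inner_orthogonalProjectionOnto_eq_of_mem_left χ v

/-- The resolvent estimate `⦀(z + Δ_h)⁻¹ χ⦀ ≤ (M_h / |z|) ⦀χ⦀` for all `χ ∈ V_h` and all complex `z`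
outside of the sector `Σ_γ = {z : |arg z| ≤ γ}`. Note that `resolvent (-Δ_h) z = (z + Δ_h)⁻¹`. -/
def ResolventEstimate (𝒯 : Mesh Ω) (r : ℕ) (N : Seminorm ℂ (feSpace 𝒯 r)) (γ Mh : ℝ) : Prop :=
  ∀ z : ℂ, ¬ |z.arg| ≤ γ → ∀ χ : feSpace 𝒯 r,
    N (resolvent (-discreteLaplacian 𝒯 r) z χ) ≤ Mh / ‖z‖ * N χ

/-- `z + Δ_h` is invertible unless `z` is a nonnegative real number, so that the inverse in the
resolvent estimate is a genuine one. -/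
theorem isUnit_add_discreteLaplacian (𝒯 : Mesh Ω) (r : ℕ) (z : ℂ) (hz : z.arg ≠ 0) :
    IsUnit (algebraMap ℂ (Module.End ℂ (feSpace 𝒯 r)) z - (-discreteLaplacian 𝒯 r)) := by
  rw [LinearMap.isUnit_iff_ker_eq_bot, LinearMap.ker_eq_bot']
  intro v hv
  have h1 : z • v = -discreteLaplacian 𝒯 r v := sub_eq_zero.1 hv
  have h2 := discreteLaplacian_spec 𝒯 r v v
  rw [← h1] at h2
  have h3 : l2 ((z • v : feSpace 𝒯 r) : L2 Ω) (v : L2 Ω) = z * ((‖(v : L2 Ω)‖ ^ 2 : ℝ) : ℂ) := by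
    have e : ((z • v : feSpace 𝒯 r) : L2 Ω) = z • (v : L2 Ω) := rfl
    rw [l2, e, _root_.inner_smul_right, _root_.inner_self_eq_norm_sq_to_K]
    push_cast
    rfl
  obtain ⟨a, ha, h4⟩ : ∃ a : ℝ, 0 ≤ a ∧ dirichlet 𝒯 r v v = (a : ℂ) := by
    refine ⟨∑ i, ‖gradV 𝒯 r i v‖ ^ 2, Finset.sum_nonneg fun i _ => sq_nonneg _, ?_⟩
    rw [dirichlet, Complex.ofReal_sum]
    refine Finset.sum_congr rfl fun i _ => ?_
    rw [_root_.inner_self_eq_norm_sq_to_K]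
    push_cast
    rfl
  rw [h3, h4] at h2
  by_contra hne
  have hv0 : (v : L2 Ω) ≠ 0 := fun h => hne (Subtype.ext h)
  have hpos : 0 < ‖(v : L2 Ω)‖ ^ 2 := pow_pos (norm_pos_iff.2 hv0) 2
  generalize ‖(v : L2 Ω)‖ ^ 2 = b at h2 hpos
  have h5 : z = ((a / b : ℝ) : ℂ) := by
    rw [Complex.ofReal_div, eq_div_iff (by exact_mod_cast hpos.ne')]
    exact h2
  apply hz
  rw [h5]
  exact Complex.arg_ofReal_of_nonneg (div_nonneg ha hpos.le)

end feSpace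

/-! ### Time partitions -/

/-- A partition `0 = t_0 < t_1 < … < t_M = T`. The subintervals are numbered from `0`: the `m`-th
one, `0 ≤ m < M`, is `(t_m, t_{m+1}]`. -/
structure TimePartition (T : ℝ) : Type where
  M : ℕ
  t : ℕ → ℝ
  t_zero : t 0 = 0
  t_last : t M = T
  t_lt : ∀ m < M, t m < t (m + 1)

namespace TimePartition

variable {T : ℝ} (P : TimePartition T)

/-- The `m`-th subinterval. -/
def interval (m : ℕ) : Set ℝ := Set.Ioc (P.t m) (P.t (m + 1))

/-- The `m`-th time step (the length of the `m`-th subinterval). -/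
def step (m : ℕ) : ℝ := P.t (m + 1) - P.t m

/-- The maximal time step `k`. -/
def kmax : ℝ := ⨆ m : Fin P.M, P.step m

/-- The minimal time step. -/
def kmin : ℝ := ⨅ m : Fin P.M, P.step m

/-- The conditions on the time mesh: (i) `k_min ≥ c k^β`; (ii) the quotient of two consecutive time
steps lies between `κ⁻¹` and `κ`; (iii) `k ≤ T / 4`. -/
structure Admissible (c β κ : ℝ) : Prop where
  min_step : c * P.kmax ^ β ≤ P.kmin
  ratio : ∀ m, m + 1 < P.M → κ⁻¹ ≤ P.step m / P.step (m + 1) ∧ P.step m / P.step (m + 1) ≤ κ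
  max_step : P.kmax ≤ T / 4

end TimePartition

/-! ### The dG(q)cG(r) method -/

section method

variable {d : ℕ} {Ω : TopologicalSpace.Opens (Eu d)} {T : ℝ}

/-- `u` belongs to the space-time finite element space `X`: on each subinterval it is a polynomial
of degree at most `q` in time, with coefficients in `V_h`. -/
def MemX (𝒯 : Mesh Ω) (r q : ℕ) (P : TimePartition T) (u : ℝ → feSpace 𝒯 r) : Prop :=
  ∀ m < P.M, ∃ a : Fin (q + 1) → feSpace 𝒯 r, ∀ t ∈ P.interval m,
    u t = ∑ j : Fin (q + 1), ((t : ℂ) ^ (j : ℕ)) • a j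

/-- The jump `[u]_m = u_m^+ - u_m^-` at the node `t_m`, with `[u]_0 = u_0^+`. -/
def jump (𝒯 : Mesh Ω) (r : ℕ) (P : TimePartition T) (u : ℝ → feSpace 𝒯 r) (m : ℕ) :
    feSpace 𝒯 r :=
  if m = 0 then Function.rightLim u (P.t 0)
  else Function.rightLim u (P.t m) - Function.leftLim u (P.t m)

/-- The bilinear (over `ℂ`: sesquilinear) form
`B(u,φ) = ∑_m (∂_t u, φ)_{I_m × Ω} + (∇u, ∇φ)_{I × Ω} + ∑_m ([u]_m, φ_m^+)_Ω`,
in which the jump term at `t_0 = 0` is `(u_0^+, φ_0^+)_Ω`. -/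
def formB (𝒯 : Mesh Ω) (r : ℕ) (P : TimePartition T) (u φ : ℝ → feSpace 𝒯 r) : ℂ :=
  (∑ m ∈ Finset.range P.M, ∫ t in P.interval m, l2 ((deriv u t : feSpace 𝒯 r) : L2 Ω) (φ t : L2 Ω))
    + (∫ t in Set.Ioc 0 T, dirichlet 𝒯 r (u t) (φ t))
    + ∑ m ∈ Finset.range P.M,
        l2 (jump 𝒯 r P u m : L2 Ω) ((Function.rightLim φ (P.t m) : feSpace 𝒯 r) : L2 Ω)

/-- `u` is a dG(q)cG(r) solution of the heat equation with right-hand side `f` and initial value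
`u_0 = 0`: `u ∈ X` and `B(u,φ) = (f,φ)_{I × Ω}` for all `φ ∈ X`. -/
def IsDGSolution (𝒯 : Mesh Ω) (r q : ℕ) (P : TimePartition T) (f : ℝ → L2 Ω)
    (u : ℝ → feSpace 𝒯 r) : Prop :=
  MemX 𝒯 r q P u ∧ ∀ φ : ℝ → feSpace 𝒯 r, MemX 𝒯 r q P φ →
    formB 𝒯 r P u φ = ∫ t in Set.Ioc 0 T, l2 (f t) (φ t : L2 Ω)

/-- The norm `(∫_I ⦀w(t)⦀^s dt)^{1/s} = (∑_m ∫_{I_m} ⦀w(t)⦀^s dt)^{1/s}`, and the essential supremum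
of `⦀w(t)⦀` over `I` for `s = ∞`; with values in `[0,∞]`. -/
def timeNorm (T : ℝ) {V : Type*} [AddCommGroup V] [Module ℂ V] (N : Seminorm ℂ V) (s : ℝ≥0∞)
    (w : ℝ → V) : ℝ≥0∞ :=
  eLpNorm (fun t => N (w t)) s (volume.restrict (Set.Ioc 0 T))

/-- The jump norm `(∑_m k_m ⦀k_m⁻¹ [u]_m⦀^s)^{1/s}`, and `max_m ⦀k_m⁻¹ [u]_m⦀` for `s = ∞`; here the
jump at the left end point of a subinterval goes with the length of that subinterval. -/
def jumpNorm (𝒯 : Mesh Ω) (r : ℕ) (P : TimePartition T) (N : Seminorm ℂ (feSpace 𝒯 r)) (s : ℝ≥0∞)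
    (u : ℝ → feSpace 𝒯 r) : ℝ≥0∞ :=
  if s = ⊤ then
    ⨆ m ∈ Finset.range P.M,
      ENNReal.ofReal (N ((((P.step m)⁻¹ : ℝ) : ℂ) • jump 𝒯 r P u m))
  else
    (∑ m ∈ Finset.range P.M, ENNReal.ofReal (P.step m) *
      ENNReal.ofReal (N ((((P.step m)⁻¹ : ℝ) : ℂ) • jump 𝒯 r P u m)) ^ s.toReal) ^ (1 / s.toReal)

end method

end DGCG

end

open DGCG

/-! The operator A = -Δ_h is symmetric and nonnegative on the finite-dimensional space V_h, so it
has an eigenbasis with real eigenvalues ≥ 0, and a function g(A) can be defined through the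
eigenvalues (`opFun`). In the local coordinate of each subinterval the method becomes, for an
eigenvalue μ, a linear system with matrix D + k_m μ G, where D (`dgMat`) carries the time derivative
with the jump and G (`massMat`) is the mass matrix. Solving step by step gives a discrete Duhamel
formula: A U_m is the sum over earlier intervals l of k_l times A ker_{l,m}(A) applied to the
moments of P_h f, plus a local term from the interval m itself (`StepEquations.apply_eq`).

In the given norm only the resolvent estimate is available, and it is used through a Dunford
integral over the two boundary rays of a sector whose angle lies strictly between γ and π/2. If g is
holomorphic there with |g(z)| ≤ K / (1 + (a|z|)²), then A g(A) is bounded by M K / (2a): the factor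
z cancels the 1/|z| of the resolvent, and the arc length integral is elementary (`cauchy_sector`,
`opFun_bound`).

The required decay comes from the energy identity of the method. It yields |R(w)| ≤ 1 / (1 + c|w|)
for the stability function (`exists_stabFun_bound`) and decay of order 1/|w| for the solution
matrix. A kernel with l < m is thus controlled by a product of at least two factors 1 / (1 + k_n
c|z|). Comparability of neighbouring steps makes the product of the denominators grow quadratically
in τ|z|, where τ is the total length of the intervals l to m (`prod_one_add_ge`). Hence A
ker_{l,m}(A) has norm at most C M / τ. The local symbol kz·sol(kz) does not decay at infinity; its
limit is split off as a multiple of kz / (1 + kz), which is handled by a single resolvent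
(`exists_opFun_solMat_bound`).

What remains is a discrete convolution with weights k_l / (t_{m+1} - t_l). Its row and column sums
are both logarithmic, by comparison with differences of logarithms, and Schur's test treats all
exponents s at once (`TimePartition.stepNorm_kernel_le`). The lower bound on k_min replaces the
logarithm of T/k_m by that of T/k. Jumps and time derivatives need no further analysis: D is
invertible, so the equations express them through A U and the data (`exists_jumpCoeff_bound`). -/

namespace DGCG

/-! ### Sectors in exponential polar coordinates. -/

/-- The closed sector of opening angle `2 θ` around the positive real axis, without its vertex. -/
def sector (θ : ℝ) : Set ℂ := {z | 0 < ‖z‖ ∧ Real.cos θ * ‖z‖ ≤ z.re}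

/-- The point with modulus `exp x` and argument `y`. -/
noncomputable def polarPt (x y : ℝ) : ℂ := Complex.exp (x + y * Complex.I)

theorem norm_polarPt (x y : ℝ) : ‖polarPt x y‖ = Real.exp x := by
  simp [polarPt, Complex.norm_exp]

theorem polarPt_re (x y : ℝ) : (polarPt x y).re = Real.exp x * Real.cos y := by
  simp [polarPt, Complex.exp_re]

theorem polarPt_im (x y : ℝ) : (polarPt x y).im = Real.exp x * Real.sin y := by
  simp [polarPt, Complex.exp_im]

theorem polarPt_ne_zero (x y : ℝ) : polarPt x y ≠ 0 := Complex.exp_ne_zero _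

theorem arg_polarPt (x : ℝ) {y : ℝ} (hy : |y| < Real.pi) : (polarPt x y).arg = y := by
  rw [abs_lt] at hy
  have h : polarPt x y = (Real.exp x : ℝ) * (Complex.cos y + Complex.sin y * Complex.I) := by
    rw [polarPt, Complex.exp_add, Complex.exp_mul_I, Complex.ofReal_exp]
  rw [h]
  exact Complex.arg_mul_cos_add_sin_mul_I (Real.exp_pos x) ⟨hy.1, hy.2.le⟩

theorem polarPt_mem_sector {θ : ℝ} (hθ : θ < Real.pi / 2) (x : ℝ) {y : ℝ} (hy : |y| ≤ θ) :
    polarPt x y ∈ sector θ := by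
  refine ⟨by rw [norm_polarPt]; positivity, ?_⟩
  rw [norm_polarPt, polarPt_re, mul_comm]
  have : Real.cos θ ≤ Real.cos y := by
    rw [← Real.cos_abs y]
    exact Real.cos_le_cos_of_nonneg_of_le_pi (abs_nonneg y) (by linarith [Real.pi_pos]) hy
  gcongr

theorem hasDerivAt_polarPt (x y : ℝ) :
    HasDerivAt (fun x : ℝ => polarPt x y) (polarPt x y) x := by
  have h : HasDerivAt (fun z : ℂ => Complex.exp (z + y * Complex.I))
      (Complex.exp (x + y * Complex.I) * 1) (x : ℂ) :=
    ((hasDerivAt_id (x : ℂ)).add_const _).cexp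
  simpa [polarPt] using h.comp_ofReal

theorem continuous_polarPt (y : ℝ) : Continuous fun x : ℝ => polarPt x y := by
  unfold polarPt; fun_prop

/-! ### The weight `exp x / (1 + a² exp (2 x))` -/

theorem integrable_exp_div {a : ℝ} (ha : 0 < a) :
    Integrable fun x : ℝ => Real.exp x / (1 + (a * Real.exp x) ^ 2) := by
  have hcont : Continuous fun x : ℝ => Real.exp x / (1 + (a * Real.exp x) ^ 2) := by
    refine Continuous.div (by fun_prop) (by fun_prop) fun x => by positivity
  rw [← integrableOn_univ, ← Set.Iic_union_Ioi (a := (0 : ℝ))]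
  refine IntegrableOn.union ?_ ?_
  · refine Integrable.mono' (integrableOn_exp_Iic 0) hcont.aestronglyMeasurable
      (Eventually.of_forall fun x => ?_)
    rw [Real.norm_of_nonneg (by positivity)]
    exact div_le_self (Real.exp_pos x).le (by nlinarith [sq_nonneg (a * Real.exp x)])
  · refine Integrable.mono' ((integrableOn_exp_neg_Ioi 0).const_mul (1 / a ^ 2))
      hcont.aestronglyMeasurable (Eventually.of_forall fun x => ?_)
    rw [Real.norm_of_nonneg (by positivity), Real.exp_neg, div_le_iff₀ (by positivity)]
    have := Real.exp_pos x
    field_simp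
    nlinarith [sq_nonneg (a * Real.exp x)]

/-- With r = exp x this is the integral of dr / (1 + (a r)²) over the half line. Each ray of the
Dunford contour contributes one such integral, which is where the factor 1/(2a) in `opFun_bound`
comes from. -/
theorem integral_exp_div {a : ℝ} (ha : 0 < a) :
    ∫ x : ℝ, Real.exp x / (1 + (a * Real.exp x) ^ 2) = Real.pi / (2 * a) := by
  have h1 : ∀ x : ℝ, HasDerivAt (fun x => Real.arctan (a * Real.exp x) / a)
      (Real.exp x / (1 + (a * Real.exp x) ^ 2)) x := by
    intro x
    have h := (((Real.hasDerivAt_exp x).const_mul a).arctan).div_const a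
    refine h.congr_deriv ?_
    field_simp
  have hbot : Tendsto (fun x => Real.arctan (a * Real.exp x) / a) atBot (𝓝 0) := by
    have h := ((Real.continuous_arctan.tendsto _).comp
      (Real.tendsto_exp_atBot.const_mul a)).div_const a
    simpa using h
  have htop : Tendsto (fun x => Real.arctan (a * Real.exp x) / a) atTop
      (𝓝 (Real.pi / 2 / a)) := by
    have h := ((tendsto_nhds_of_tendsto_nhdsWithin Real.tendsto_arctan_atTop).comp
      (Real.tendsto_exp_atTop.const_mul_atTop ha)).div_const a
    exact h
  rw [integral_of_hasDerivAt_of_tendsto h1 (integrable_exp_div ha) hbot htop]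
  field_simp
  ring

/-! ### Cauchy's theorem and formula for a sector -/

/-- Cauchy's theorem on the rectangles [-L, L] × [-θ, θ]: the majorant is at most K exp(-|x|), so
the vertical sides vanish as L → ∞ and the horizontal ones converge. Strips are used because the
exponential maps them to sectors and their edges to rays. -/
theorem integral_strip_eq {f : ℂ → ℂ} {θ K : ℝ} (hθ : 0 ≤ θ) {w₀ : ℂ}
    (hc : ∀ w : ℂ, |w.im| ≤ θ → ContinuousAt f w)
    (hd : ∀ w : ℂ, |w.im| ≤ θ → w ≠ w₀ → DifferentiableAt ℂ f w)
    (hb : ∀ w : ℂ, |w.im| ≤ θ → ‖f w‖ ≤ K * (Real.exp w.re / (1 + (1 * Real.exp w.re) ^ 2))) :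
    ∫ x : ℝ, f (x + (-θ : ℝ) * Complex.I) = ∫ x : ℝ, f (x + θ * Complex.I) := by
  have hint : ∀ y : ℝ, |y| ≤ θ → Integrable fun x : ℝ => f (x + y * Complex.I) := by
    intro y hy
    refine Integrable.mono' ((integrable_exp_div one_pos).const_mul K) ?_
      (Eventually.of_forall fun x => ?_)
    · refine Continuous.aestronglyMeasurable (continuous_iff_continuousAt.2 fun x => ?_)
      refine ContinuousAt.comp (f := fun x : ℝ => (x : ℂ) + y * Complex.I) (hc _ (by simpa)) ?_
      fun_prop
    · simpa using hb (x + y * Complex.I) (by simpa)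
  have hθ' : |-θ| ≤ θ := by rw [abs_neg, abs_of_nonneg hθ]
  have hθ'' : |θ| ≤ θ := by rw [abs_of_nonneg hθ]
  have h1 := intervalIntegral_tendsto_integral (hint (-θ) hθ') tendsto_neg_atTop_atBot tendsto_id
  have h2 := intervalIntegral_tendsto_integral (hint θ hθ'') tendsto_neg_atTop_atBot tendsto_id
  have hK : 0 ≤ K := by
    have := (norm_nonneg _).trans (hb 0 (by simpa))
    by_contra hK
    have h3 : 0 < Real.exp (0 : ℂ).re / (1 + (1 * Real.exp (0 : ℂ).re) ^ 2) := by positivity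
    nlinarith
  have hside : ∀ σ : ℝ, |σ| = 1 → Tendsto (fun L : ℝ => ∫ y : ℝ in -θ..θ,
      f ((σ * L : ℝ) + y * Complex.I)) atTop (𝓝 0) := by
    intro σ hσ
    have h0 : Tendsto (fun L : ℝ => K * Real.exp (-L) * |θ - -θ|) atTop (𝓝 0) := by
      have := (Real.tendsto_exp_neg_atTop_nhds_zero.const_mul K).mul_const |θ - -θ|
      simpa using this
    refine squeeze_zero_norm' ?_ h0
    filter_upwards [eventually_ge_atTop 0] with L hL
    refine intervalIntegral.norm_integral_le_of_norm_le_const fun y hy => ?_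
    rw [Set.uIoc_of_le (by linarith)] at hy
    refine (hb _ (by simpa [abs_le] using ⟨hy.1.le, hy.2⟩)).trans ?_
    refine mul_le_mul_of_nonneg_left ?_ hK
    simp only [Complex.add_re, Complex.ofReal_re, Complex.mul_re, Complex.I_re, mul_zero,
      Complex.ofReal_im, Complex.I_im, mul_one, sub_self, add_zero, one_mul]
    rw [div_le_iff₀ (by positivity)]
    rcases (abs_eq one_pos.le).1 hσ with rfl | rfl
    · have : Real.exp (-L) * Real.exp (1 * L) = 1 := by rw [← Real.exp_add]; simp
      have h3 := Real.exp_pos (-L)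
      nlinarith
    · have h3 := Real.exp_pos (-L)
      rw [neg_one_mul]
      nlinarith [sq_nonneg (Real.exp (-L))]
  have hrect : ∀ L : ℝ, (∫ x : ℝ in -L..L, f (x + (-θ : ℝ) * Complex.I))
      - (∫ x : ℝ in -L..L, f (x + θ * Complex.I))
      = - (Complex.I • (∫ y : ℝ in -θ..θ, f ((1 * L : ℝ) + y * Complex.I)))
        + Complex.I • (∫ y : ℝ in -θ..θ, f ((-1 * L : ℝ) + y * Complex.I)) := by
    intro L
    have hmem : ∀ w : ℂ, w.im ∈ Set.uIcc (-θ) θ → |w.im| ≤ θ := fun w hw => by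
      rw [Set.uIcc_of_le (by linarith)] at hw
      exact abs_le.2 hw
    -- Continuity suffices at the exceptional point; there the function will be a divided difference
    -- at its base point.
    have h := Complex.integral_boundary_rect_eq_zero_of_differentiable_on_off_countable f
      ⟨-L, -θ⟩ ⟨L, θ⟩ {w₀} (Set.countable_singleton _)
      (fun w hw => (hc w (hmem w hw.2)).continuousWithinAt)
      (fun w hw => hd w (hmem w (by
        have h2 : w.im ∈ Set.Ioo (min (-θ) θ) (max (-θ) θ) := hw.1.2
        rw [min_eq_left (by linarith), max_eq_right (by linarith)] at h2
        rw [Set.uIcc_of_le (by linarith)]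
        exact ⟨h2.1.le, h2.2.le⟩)) (by simpa using hw.2))
    simp only [one_mul, neg_mul] at h ⊢
    linear_combination h
  have h3 := ((hside 1 (by simp)).const_smul Complex.I).neg.add
    ((hside (-1) (by simp)).const_smul Complex.I)
  have h4 := (h1.sub h2).congr hrect
  have h5 := tendsto_nhds_unique h4 h3
  simp only [smul_zero, neg_zero, add_zero] at h5
  exact sub_eq_zero.1 h5

end DGCG

namespace DGCG

theorem exp_mem_sector {θ : ℝ} (hθ : θ < Real.pi / 2) {w : ℂ} (hw : |w.im| ≤ θ) :
    Complex.exp w ∈ sector θ := by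
  have := polarPt_mem_sector hθ w.re hw
  rwa [polarPt, Complex.re_add_im] at this

/-- A function on a sector, bounded near the vertex and at infinity, has the same integral along
both boundary rays. -/
theorem integral_rays_eq {h : ℂ → ℂ} {θ K : ℝ} (hθ : 0 ≤ θ) (hθ' : θ < Real.pi / 2) {z₀ : ℂ}
    (hc : ∀ z ∈ sector θ, ContinuousAt h z)
    (hd : ∀ z ∈ sector θ, z ≠ z₀ → DifferentiableAt ℂ h z)
    (hb : ∀ z ∈ sector θ, ‖h z‖ ≤ K / (1 + ‖z‖ ^ 2)) :
    ∫ x : ℝ, h (polarPt x (-θ)) * polarPt x (-θ) = ∫ x : ℝ, h (polarPt x θ) * polarPt x θ := by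
  refine integral_strip_eq (f := fun w => h (Complex.exp w) * Complex.exp w) (K := K) hθ
    (w₀ := Complex.log z₀) ?_ ?_ ?_
  · intro w hw
    exact (ContinuousAt.comp (f := Complex.exp) (hc _ (exp_mem_sector hθ' hw))
      Complex.continuous_exp.continuousAt).mul Complex.continuous_exp.continuousAt
  · intro w hw hne
    refine DifferentiableAt.mul (DifferentiableAt.comp (f := Complex.exp) w
      (hd _ (exp_mem_sector hθ' hw) ?_) Complex.differentiable_exp.differentiableAt)
      Complex.differentiable_exp.differentiableAt
    rintro rfl
    have := abs_le.1 hw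
    exact hne (Complex.log_exp (by linarith [Real.pi_pos]) (by linarith [Real.pi_pos])).symm
  · intro w hw
    have := hb _ (exp_mem_sector hθ' hw)
    rw [norm_mul, Complex.norm_exp] at *
    calc _ ≤ K / (1 + Real.exp w.re ^ 2) * Real.exp w.re := by gcongr
      _ = _ := by rw [one_mul]; ring

/-- The hypothesis says |Im z| = |sin θ| |z|, and |Im z| is the distance from z to the real axis. -/
theorem norm_sub_ge_of_re_le {z : ℂ} {θ μ : ℝ} (hθ : Real.sin θ ^ 2 * ‖z‖ ^ 2 = z.im ^ 2) :
    Real.sin θ ^ 2 * ‖z‖ ^ 2 ≤ ‖z - (μ : ℂ)‖ ^ 2 := by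
  rw [hθ, ← Complex.normSq_eq_norm_sq (z - μ), Complex.normSq_apply]
  simp only [Complex.sub_re, Complex.sub_im, Complex.ofReal_re, Complex.ofReal_im, sub_zero]
  nlinarith [sq_nonneg (z.re - μ)]

theorem norm_polarPt_sub_ge {θ : ℝ} (x : ℝ) {y : ℝ} (hy : |y| = θ) (μ : ℝ) :
    Real.sin θ * Real.exp x ≤ ‖polarPt x y - (μ : ℂ)‖ := by
  have hs : Real.sin θ ^ 2 = Real.sin y ^ 2 := by
    rw [← hy]; rcases abs_choice y with h | h <;> simp [h]
  have h := norm_sub_ge_of_re_le (z := polarPt x y) (θ := θ) (μ := μ)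
    (by rw [norm_polarPt, polarPt_im, hs]; ring)
  rw [norm_polarPt, ← mul_pow] at h
  exact le_of_sq_le_sq h (norm_nonneg _)

/-- The integral of `2 μ / (z² - μ²)` along a ray. -/
theorem integral_ray_pole {μ θ : ℝ} (hμ : 0 < μ) (hθ : 0 < θ) (hθ' : θ < Real.pi / 2) {σ : ℝ}
    (hσ : σ = 1 ∨ σ = -1) :
    Integrable (fun x : ℝ => 2 * μ / ((polarPt x (σ * θ) + μ) * (polarPt x (σ * θ) - μ))
      * polarPt x (σ * θ)) ∧
    ∫ x : ℝ, 2 * μ / ((polarPt x (σ * θ) + μ) * (polarPt x (σ * θ) - μ)) * polarPt x (σ * θ)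
      = -σ * Real.pi * Complex.I := by
  have hsin : 0 < Real.sin θ := Real.sin_pos_of_pos_of_lt_pi hθ (by linarith [Real.pi_pos])
  have habs : |σ * θ| = θ := by
    rcases hσ with rfl | rfl <;> simp [abs_of_pos hθ]
  have hsub : ∀ x : ℝ, polarPt x (σ * θ) - μ ≠ 0 := fun x h => by
    have := norm_polarPt_sub_ge x habs μ
    rw [h, norm_zero] at this
    have := mul_pos hsin (Real.exp_pos x)
    linarith
  have hadd_re : ∀ x : ℝ, μ ≤ (polarPt x (σ * θ) + μ).re := fun x => by
    have h := (polarPt_mem_sector hθ' x habs.le).2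
    have hc : 0 ≤ Real.cos θ := Real.cos_nonneg_of_mem_Icc ⟨by linarith, hθ'.le⟩
    have := mul_nonneg hc (norm_nonneg (polarPt x (σ * θ)))
    simp only [Complex.add_re, Complex.ofReal_re]
    linarith
  have hadd : ∀ x : ℝ, polarPt x (σ * θ) + μ ≠ 0 := fun x h => by
    have := hadd_re x
    rw [h] at this
    simp at this; linarith
  have hadd_norm : ∀ x : ℝ, Real.exp x ≤ ‖polarPt x (σ * θ) + μ‖ ∧ μ ≤ ‖polarPt x (σ * θ) + μ‖ := by
    intro x
    refine ⟨?_, (hadd_re x).trans (Complex.re_le_norm _)⟩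
    have hre : 0 ≤ (polarPt x (σ * θ)).re := by
      have h := hadd_re x
      simpa using h
    rw [← norm_polarPt x (σ * θ)]
    refine le_of_sq_le_sq ?_ (norm_nonneg _)
    rw [← Complex.normSq_eq_norm_sq, ← Complex.normSq_eq_norm_sq, Complex.normSq_apply,
      Complex.normSq_apply]
    simp only [Complex.add_re, Complex.add_im, Complex.ofReal_re, Complex.ofReal_im, add_zero]
    nlinarith [mul_nonneg hre hμ.le]
  have hint : Integrable (fun x : ℝ => 2 * μ / ((polarPt x (σ * θ) + μ) *
      (polarPt x (σ * θ) - μ)) * polarPt x (σ * θ)) := by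
    have ha : 0 < μ⁻¹ := inv_pos.2 hμ
    refine Integrable.mono' ((integrable_exp_div ha).const_mul
      (8 / (Real.sin θ * μ))) ?_ (Eventually.of_forall fun x => ?_)
    · refine Continuous.aestronglyMeasurable ?_
      have := continuous_polarPt (σ * θ)
      exact (continuous_const.div ((this.add continuous_const).mul (this.sub continuous_const))
        fun x => mul_ne_zero (hadd x) (hsub x)).mul this
    · have h1 := norm_polarPt_sub_ge x habs μ
      obtain ⟨h2, h3⟩ := hadd_norm x
      have he := Real.exp_pos x
      have hpos : 0 < ‖polarPt x (σ * θ) - μ‖ := norm_pos_iff.2 (hsub x)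
      have hpos' : 0 < ‖polarPt x (σ * θ) + μ‖ := norm_pos_iff.2 (hadd x)
      have h5 : μ ≤ ‖polarPt x (σ * θ) - μ‖ + Real.exp x := by
        have h := norm_sub_le (polarPt x (σ * θ)) (polarPt x (σ * θ) - μ)
        rw [sub_sub_cancel, norm_polarPt, Complex.norm_real, Real.norm_of_nonneg hμ.le] at h
        linarith
      have hs1 : Real.sin θ ≤ 1 := Real.sin_le_one θ
      have h6 : Real.sin θ * μ ≤ 2 * ‖polarPt x (σ * θ) - μ‖ := by nlinarith
      -- |z + μ| dominates both |z| and μ, while |z - μ| dominates sin θ times |z| and sin θ times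
      -- μ/2. Multiplying matching bounds and adding gives 3, rounded up to 4; the constant 8 above
      -- is 2·4.
      have h4 : Real.sin θ * (μ ^ 2 + Real.exp x ^ 2)
          ≤ 4 * (‖polarPt x (σ * θ) + μ‖ * ‖polarPt x (σ * θ) - μ‖) := by
        have e1 := mul_le_mul h3 h6 (by positivity) hpos'.le
        have e2 := mul_le_mul h2 h1 (by positivity) hpos'.le
        nlinarith [mul_pos hpos hpos']
      rw [norm_mul, norm_div, norm_mul, norm_mul, norm_polarPt, Complex.norm_real,
        Real.norm_of_nonneg hμ.le, RCLike.norm_ofNat]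
      have e : 8 / (Real.sin θ * μ) * (Real.exp x / (1 + (μ⁻¹ * Real.exp x) ^ 2))
          = 2 * μ / (Real.sin θ * (μ ^ 2 + Real.exp x ^ 2) / 4) * Real.exp x := by
        field_simp
        ring
      rw [e]
      gcongr
      linarith
  refine ⟨hint, ?_⟩
  have him : ∀ x : ℝ, ((μ - polarPt x (σ * θ)) / (polarPt x (σ * θ) + μ)).im
      = - (2 * μ * Real.exp x * Real.sin (σ * θ)) / ‖polarPt x (σ * θ) + μ‖ ^ 2 := fun x => by
    rw [Complex.div_im, Complex.normSq_eq_norm_sq]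
    simp only [Complex.add_re, Complex.add_im, Complex.sub_re, Complex.sub_im, Complex.ofReal_re,
      Complex.ofReal_im, polarPt_im]
    ring
  -- The antiderivative is the logarithm of the Möbius map z ↦ (μ - z)/(z + μ). By `him` its
  -- imaginary part does not vanish on the ray, so the principal branch is smooth there.
  have hderiv : ∀ x : ℝ, HasDerivAt
      (fun x : ℝ => Complex.log ((μ - polarPt x (σ * θ)) / (polarPt x (σ * θ) + μ)))
      (2 * μ / ((polarPt x (σ * θ) + μ) * (polarPt x (σ * θ) - μ)) * polarPt x (σ * θ)) x := by
    intro x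
    have h1 := hasDerivAt_polarPt x (σ * θ)
    have h2 : HasDerivAt (fun x : ℝ => (μ - polarPt x (σ * θ)) / (polarPt x (σ * θ) + μ)) _ x :=
      (h1.const_sub (μ : ℂ)).div (h1.add_const (μ : ℂ)) (hadd x)
    have hslit : (μ - polarPt x (σ * θ)) / (polarPt x (σ * θ) + μ) ∈ Complex.slitPlane := by
      refine Or.inr ?_
      rw [him x]
      have hs : Real.sin (σ * θ) ≠ 0 := by
        rcases hσ with rfl | rfl <;> simp [hsin.ne']
      have := norm_pos_iff.2 (hadd x)
      have := Real.exp_pos x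
      refine div_ne_zero (neg_ne_zero.2 ?_) (by positivity)
      positivity
    refine (h2.clog_real hslit).congr_deriv ?_
    have e1 := hsub x
    have e2 := hadd x
    have e3 : (μ : ℂ) - polarPt x (σ * θ) ≠ 0 := by
      rw [← neg_sub]; exact neg_ne_zero.2 e1
    field_simp
    ring
  have hP0 : Tendsto (fun x : ℝ => polarPt x (σ * θ)) atBot (𝓝 0) := by
    rw [tendsto_zero_iff_norm_tendsto_zero]
    simpa [norm_polarPt] using Real.tendsto_exp_atBot
  have hμ0 : (μ : ℂ) ≠ 0 := by exact_mod_cast hμ.ne'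
  have hbot : Tendsto
      (fun x : ℝ => Complex.log ((μ - polarPt x (σ * θ)) / (polarPt x (σ * θ) + μ))) atBot
      (𝓝 0) := by
    have h : Tendsto (fun x : ℝ => (μ - polarPt x (σ * θ)) / (polarPt x (σ * θ) + μ)) atBot
        (𝓝 1) := by
      have := (hP0.const_sub (μ : ℂ)).div (hP0.add_const (μ : ℂ)) (by simpa using hμ.ne')
      rw [sub_zero, zero_add, div_self hμ0] at this
      exact this
    have h2 := (continuousAt_clog (x := 1) (by simp)).tendsto.comp h
    rw [Complex.log_one] at h2
    exact h2
  have htop0 : Tendsto (fun x : ℝ => (μ - polarPt x (σ * θ)) / (polarPt x (σ * θ) + μ)) atTop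
      (𝓝 (-1)) := by
    have h : Tendsto (fun x : ℝ => (polarPt x (σ * θ) + μ)⁻¹) atTop (𝓝 0) := by
      rw [tendsto_zero_iff_norm_tendsto_zero]
      refine squeeze_zero (fun x => norm_nonneg _) (fun x => ?_) Real.tendsto_exp_neg_atTop_nhds_zero
      rw [norm_inv, Real.exp_neg]
      gcongr
      exact (hadd_norm x).1
    have h2 : Tendsto (fun x : ℝ => -1 + 2 * μ * (polarPt x (σ * θ) + μ)⁻¹) atTop
        (𝓝 (-1 + 2 * μ * 0)) := (h.const_mul _).const_add _
    rw [mul_zero, add_zero] at h2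
    refine h2.congr fun x => ?_
    have := hadd x
    field_simp
    ring
  -- The Möbius map tends to -1, a point of the branch cut. The sign of its imaginary part decides
  -- between the limits -πi and πi; these two boundary values together produce the residue 2πi.
  have htop : Tendsto
      (fun x : ℝ => Complex.log ((μ - polarPt x (σ * θ)) / (polarPt x (σ * θ) + μ))) atTop
      (𝓝 (-σ * Real.pi * Complex.I)) := by
    rcases hσ with rfl | rfl
    · have h := (Complex.tendsto_log_nhdsWithin_im_neg_of_re_neg_of_im_zero (z := -1)
        (by simp) (by simp)).comp (tendsto_nhdsWithin_iff.2 ⟨htop0, Eventually.of_forall fun x => ?_⟩)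
      · refine h.trans_eq ?_
        simp
      · show Complex.im _ < 0
        rw [him x]
        have := norm_pos_iff.2 (hadd x)
        have := Real.exp_pos x
        rw [one_mul] at *
        exact div_neg_of_neg_of_pos (neg_lt_zero.2 (by positivity)) (by positivity)
    · have h := (Complex.tendsto_log_nhdsWithin_im_nonneg_of_re_neg_of_im_zero (z := -1)
        (by simp) (by simp)).comp (tendsto_nhdsWithin_iff.2 ⟨htop0, Eventually.of_forall fun x => ?_⟩)
      · refine h.trans_eq ?_
        simp
      · show 0 ≤ Complex.im _
        rw [him x, neg_one_mul, Real.sin_neg]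
        have := Real.exp_pos x
        have h3 : 0 ≤ -(2 * μ * Real.exp x * -Real.sin θ) := by
          rw [mul_neg, neg_neg]; positivity
        positivity
  rw [integral_of_hasDerivAt_of_tendsto hderiv hint hbot htop, sub_zero]

end DGCG

namespace DGCG

theorem ofReal_mem_sector {θ μ : ℝ} (hμ : 0 < μ) : (μ : ℂ) ∈ sector θ := by
  have h : ‖(μ : ℂ)‖ = μ := by rw [Complex.norm_real, Real.norm_of_nonneg hμ.le]
  refine ⟨by rwa [h], ?_⟩
  rw [h, Complex.ofReal_re]
  nlinarith [Real.cos_le_one θ]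

theorem re_nonneg_of_mem_sector {θ : ℝ} (hθ : 0 < θ) (hθ' : θ < Real.pi / 2) {z : ℂ}
    (hz : z ∈ sector θ) : 0 < z.re :=
  lt_of_lt_of_le (mul_pos (Real.cos_pos_of_mem_Ioo ⟨by linarith, hθ'⟩) hz.1) hz.2

/-- From |z - μ| ≥ ||z| - μ|; the constant 1/3 is attained by this bound at both cutoffs |z| = μ/2
and |z| = 2μ. -/
theorem add_div_three_le_norm_sub {z : ℂ} {μ : ℝ} (hμ : 0 < μ) (hz : ‖z‖ < μ / 2 ∨ 2 * μ < ‖z‖) :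
    (‖z‖ + μ) / 3 ≤ ‖z - μ‖ := by
  have h1 := norm_sub_norm_le z (μ : ℂ)
  have h2 := norm_sub_norm_le (μ : ℂ) z
  rw [norm_sub_rev] at h2
  rw [Complex.norm_real, Real.norm_of_nonneg hμ.le] at h1 h2
  rcases hz with h | h <;> linarith

theorem add_div_three_le_norm_add {z : ℂ} {μ : ℝ} (hμ : 0 < μ) (hz : 0 ≤ z.re) :
    (‖z‖ + μ) / 3 ≤ ‖z + μ‖ := by
  have h1 : μ ≤ ‖z + μ‖ := by
    refine le_trans ?_ (Complex.re_le_norm _)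
    simpa using hz
  have h2 := norm_sub_norm_le z (-(μ : ℂ))
  rw [norm_neg, Complex.norm_real, Real.norm_of_nonneg hμ.le, sub_neg_eq_add] at h2
  linarith

/-- The pole of `z g(z) / (z - μ)` at `μ` can be subtracted, keeping the decay at infinity. -/
theorem exists_bound_dslope {g : ℂ → ℂ} {θ K a μ : ℝ} (hθ : 0 < θ) (hθ' : θ < Real.pi / 2)
    (ha : 0 < a) (hμ : 0 < μ)
    (hb : ∀ z ∈ sector θ, ‖g z‖ ≤ K / (1 + (a * ‖z‖) ^ 2)) (c : ℂ)
    (hc : ∀ z ∈ sector θ,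
      ContinuousAt (dslope (fun z => z * g z - c * (2 * μ / (z + μ))) (μ : ℂ)) z)
    (hψ : (μ : ℂ) * g μ - c * (2 * μ / (μ + μ)) = 0) :
    ∃ K', ∀ z ∈ sector θ,
      ‖dslope (fun z => z * g z - c * (2 * μ / (z + μ))) (μ : ℂ) z‖ ≤ K' / (1 + ‖z‖ ^ 2) := by
  set h := dslope (fun z => z * g z - c * (2 * μ / (z + μ))) (μ : ℂ) with hh
  have hcomp : IsCompact {z : ℂ | ‖z‖ ≤ 2 * μ ∧ μ / 2 ≤ ‖z‖ ∧ Real.cos θ * ‖z‖ ≤ z.re} := by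
    refine (isCompact_closedBall (0 : ℂ) (2 * μ)).of_isClosed_subset ?_ fun z hz => by
      simpa using hz.1
    exact (isClosed_le continuous_norm continuous_const).inter
      ((isClosed_le continuous_const continuous_norm).inter
        (isClosed_le (continuous_const.mul continuous_norm) Complex.continuous_re))
  obtain ⟨B, hB⟩ := hcomp.exists_bound_of_continuousOn (f := h) fun z hz =>
    (hc z ⟨lt_of_lt_of_le (by positivity) hz.2.1, hz.2.2⟩).continuousWithinAt
  have hK : 0 ≤ K := by
    have h0 := ofReal_mem_sector (θ := θ) hμ
    have h1 := (norm_nonneg _).trans (hb _ h0)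
    by_contra hK
    have h3 : K / (1 + (a * ‖(μ : ℂ)‖) ^ 2) < 0 := div_neg_of_neg_of_pos (not_le.1 hK) (by positivity)
    linarith
  set K₁ : ℝ := 3 * K * (1 + (a ^ 2)⁻¹)
  set K₂ : ℝ := 18 * ‖c‖ * μ * (1 + (μ ^ 2)⁻¹)
  set K₃ : ℝ := |B| * (1 + (2 * μ) ^ 2)
  have hK₁ : 0 ≤ K₁ := by positivity
  have hK₂ : 0 ≤ K₂ := by positivity
  have hK₃ : 0 ≤ K₃ := by positivity
  refine ⟨K₁ + K₂ + K₃, fun z hz => ?_⟩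
  have hz0 := norm_nonneg z
  rw [le_div_iff₀ (by positivity)]
  -- The annulus around the removed pole is compact, so continuity bounds the quotient there. Away
  -- from it the numerator terms are estimated separately, since |z - μ| is comparable with |z| + μ.
  by_cases hmid : ‖z‖ ≤ 2 * μ ∧ μ / 2 ≤ ‖z‖
  · have h1 := hB z ⟨hmid.1, hmid.2, hz.2⟩
    have h2 : ‖h z‖ * (1 + ‖z‖ ^ 2) ≤ K₃ := by
      have : ‖z‖ ^ 2 ≤ (2 * μ) ^ 2 := by gcongr; exact hmid.1
      have := h1.trans (le_abs_self B)
      simp only [K₃]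
      gcongr
    linarith
  · have hout : ‖z‖ < μ / 2 ∨ 2 * μ < ‖z‖ := by
      rw [not_and_or, not_le, not_le] at hmid; exact hmid.symm
    have h1 := add_div_three_le_norm_sub hμ hout
    have h2 := add_div_three_le_norm_add hμ (re_nonneg_of_mem_sector hθ hθ' hz).le
    have hne : z ≠ μ := by
      rintro rfl
      rw [sub_self, norm_zero] at h1
      linarith
    have e : h z = z * g z / (z - μ) - c * (2 * μ) / ((z + μ) * (z - μ)) := by
      rw [hh, dslope_of_ne _ hne, slope_def_field, hψ, sub_zero, sub_div, ← mul_div_assoc,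
        div_div]
    have hr : 0 < (‖z‖ + μ) / 3 := by positivity
    have b1 : ‖z * g z / (z - μ)‖ * (1 + ‖z‖ ^ 2) ≤ K₁ := by
      rw [norm_div, norm_mul]
      have e1 : ‖z‖ * ‖g z‖ / ‖z - μ‖ ≤ 3 * ‖g z‖ := by
        rw [div_le_iff₀ (hr.trans_le h1)]
        nlinarith [norm_nonneg (g z)]
      have e2 : (1 + ‖z‖ ^ 2) ≤ (1 + (a ^ 2)⁻¹) * (1 + (a * ‖z‖) ^ 2) := by
        have : (a ^ 2)⁻¹ * (a * ‖z‖) ^ 2 = ‖z‖ ^ 2 := by field_simp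
        have h5 : 0 ≤ (a ^ 2)⁻¹ := by positivity
        nlinarith [sq_nonneg (a * ‖z‖)]
      calc _ ≤ 3 * (K / (1 + (a * ‖z‖) ^ 2)) * ((1 + (a ^ 2)⁻¹) * (1 + (a * ‖z‖) ^ 2)) := by
            gcongr
            exact e1.trans (by gcongr; exact hb z hz)
        _ = K₁ := by simp only [K₁]; field_simp
    have b2 : ‖c * (2 * μ) / ((z + μ) * (z - μ))‖ * (1 + ‖z‖ ^ 2) ≤ K₂ := by
      rw [norm_div, norm_mul, norm_mul, norm_mul, Complex.norm_real, Real.norm_of_nonneg hμ.le,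
        RCLike.norm_ofNat]
      have e2 : (1 + ‖z‖ ^ 2) ≤ (1 + (μ ^ 2)⁻¹) * (‖z‖ + μ) ^ 2 := by
        have : (μ ^ 2)⁻¹ * μ ^ 2 = 1 := by field_simp
        have h5 : 0 ≤ (μ ^ 2)⁻¹ := by positivity
        nlinarith [mul_nonneg hz0 hμ.le, mul_nonneg h5 (mul_nonneg hz0 hμ.le),
          mul_nonneg h5 (sq_nonneg ‖z‖)]
      calc _ ≤ ‖c‖ * (2 * μ) / ((‖z‖ + μ) / 3 * ((‖z‖ + μ) / 3))
            * ((1 + (μ ^ 2)⁻¹) * (‖z‖ + μ) ^ 2) := by gcongr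
        _ = K₂ := by simp only [K₂]; field_simp; ring
    rw [e]
    calc _ ≤ (‖z * g z / (z - μ)‖ + ‖c * (2 * μ) / ((z + μ) * (z - μ))‖) * (1 + ‖z‖ ^ 2) := by
          gcongr; exact norm_sub_le _ _
      _ ≤ _ := by linarith

/-- On the ray |z| / |z - μ| ≤ 1 / sin θ, so the integrand is dominated by that of
`integral_exp_div`, for every real μ. -/
theorem integrable_ray {g : ℂ → ℂ} {θ K a μ : ℝ} (hθ : 0 < θ) (hθ' : θ < Real.pi / 2)
    (ha : 0 < a)
    (hd : ∀ z ∈ sector θ, DifferentiableAt ℂ g z)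
    (hb : ∀ z ∈ sector θ, ‖g z‖ ≤ K / (1 + (a * ‖z‖) ^ 2)) {y : ℝ} (hy : |y| = θ) :
    Integrable fun x : ℝ => polarPt x y * g (polarPt x y) / (polarPt x y - μ) * polarPt x y := by
  have hsin : 0 < Real.sin θ := Real.sin_pos_of_pos_of_lt_pi hθ (by linarith [Real.pi_pos])
  have hsub : ∀ x : ℝ, polarPt x y - μ ≠ 0 := fun x h => by
    have := norm_polarPt_sub_ge x hy μ
    rw [h, norm_zero] at this
    have := mul_pos hsin (Real.exp_pos x)
    linarith
  refine Integrable.mono' ((integrable_exp_div ha).const_mul (K / Real.sin θ)) ?_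
    (Eventually.of_forall fun x => ?_)
  · refine Continuous.aestronglyMeasurable ?_
    have h1 := continuous_polarPt y
    have h2 : Continuous fun x => g (polarPt x y) := continuous_iff_continuousAt.2 fun x =>
      ContinuousAt.comp (f := fun x => polarPt x y)
        (hd _ (polarPt_mem_sector hθ' x hy.le)).continuousAt h1.continuousAt
    exact ((h1.mul h2).div (h1.sub continuous_const) hsub).mul h1
  · have h1 := norm_polarPt_sub_ge x hy μ
    have h2 := hb _ (polarPt_mem_sector hθ' x hy.le)
    have he := Real.exp_pos x
    rw [norm_mul, norm_div, norm_mul]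
    rw [norm_polarPt] at *
    have hpos : 0 ≤ K / (1 + (a * Real.exp x) ^ 2) := (norm_nonneg _).trans h2
    calc _ ≤ Real.exp x * (K / (1 + (a * Real.exp x) ^ 2)) / (Real.sin θ * Real.exp x)
          * Real.exp x := by gcongr
      _ = _ := by field_simp

/-- Cauchy's formula for `z g(z)` on a sector. -/
theorem cauchy_sector {g : ℂ → ℂ} {θ K a μ : ℝ} (hθ : 0 < θ) (hθ' : θ < Real.pi / 2)
    (ha : 0 < a) (hμ : 0 ≤ μ)
    (hd : ∀ z ∈ sector θ, DifferentiableAt ℂ g z)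
    (hb : ∀ z ∈ sector θ, ‖g z‖ ≤ K / (1 + (a * ‖z‖) ^ 2)) :
    (∫ x : ℝ, polarPt x (-θ) * g (polarPt x (-θ)) / (polarPt x (-θ) - μ) * polarPt x (-θ))
      - ∫ x : ℝ, polarPt x θ * g (polarPt x θ) / (polarPt x θ - μ) * polarPt x θ
      = 2 * Real.pi * Complex.I * (μ * g μ) := by
  -- For μ = 0 the factor z cancels the pole, the integrand is g itself and both sides vanish.
  rcases hμ.eq_or_lt with rfl | hμ
  · have hK' : ∀ z ∈ sector θ, ‖g z‖ ≤ K * (1 + (a ^ 2)⁻¹) / (1 + ‖z‖ ^ 2) := by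
      intro z hz
      have h1 := hb z hz
      have hK : 0 ≤ K := by
        by_contra hK
        have h3 : K / (1 + (a * ‖z‖) ^ 2) < 0 := div_neg_of_neg_of_pos (not_le.1 hK) (by positivity)
        linarith [norm_nonneg (g z)]
      refine h1.trans ?_
      rw [div_le_div_iff₀ (by positivity) (by positivity), mul_assoc]
      refine mul_le_mul_of_nonneg_left ?_ hK
      have : (a ^ 2)⁻¹ * (a * ‖z‖) ^ 2 = ‖z‖ ^ 2 := by field_simp
      have h5 : 0 ≤ (a ^ 2)⁻¹ := by positivity
      nlinarith [sq_nonneg (a * ‖z‖)]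
    have h := integral_rays_eq (z₀ := 0) hθ.le hθ' (fun z hz => (hd z hz).continuousAt)
      (fun z hz _ => hd z hz) hK'
    have e : ∀ x y : ℝ, polarPt x y * g (polarPt x y) / (polarPt x y - (0 : ℝ)) = g (polarPt x y) := by
      intro x y
      rw [Complex.ofReal_zero, sub_zero, mul_div_assoc, mul_div_cancel₀ _ (polarPt_ne_zero x y)]
    simp only [e]
    rw [h]; simp
  -- The comparison function c·2μ/(z + μ) takes the value c at μ, decays at infinity and has its
  -- pole outside the sector. Subtracting it from z g(z) leaves a divided difference without pole,
  -- with equal integrals over both rays; `integral_ray_pole` evaluates the rest.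
  · set c : ℂ := μ * g μ with hc
    have hμ0 : (μ : ℂ) ≠ 0 := by exact_mod_cast hμ.ne'
    have hψ : (μ : ℂ) * g μ - c * (2 * μ / (μ + μ)) = 0 := by
      rw [← two_mul, div_self (by simpa using hμ.ne'), mul_one, hc, sub_self]
    have hadd : ∀ z ∈ sector θ, z + μ ≠ 0 := fun z hz h => by
      have := re_nonneg_of_mem_sector hθ hθ' hz
      have h2 := congrArg Complex.re h
      simp at h2
      linarith
    have hψd : ∀ z ∈ sector θ,
        DifferentiableAt ℂ (fun z => z * g z - c * (2 * μ / (z + μ))) z := fun z hz =>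
      (differentiableAt_id.mul (hd z hz)).sub ((differentiableAt_const _).mul
        ((differentiableAt_const _).div (differentiableAt_id.add_const _) (hadd z hz)))
    set h := dslope (fun z => z * g z - c * (2 * μ / (z + μ))) (μ : ℂ) with hh
    have hcont : ∀ z ∈ sector θ, ContinuousAt h z := by
      intro z hz
      by_cases hne : z = μ
      · rw [hne]; exact continuousAt_dslope_same.2 (hψd _ (ofReal_mem_sector hμ))
      · exact (continuousAt_dslope_of_ne hne).2 (hψd z hz).continuousAt
    obtain ⟨K', hK'⟩ := exists_bound_dslope hθ hθ' ha hμ hb c hcont hψ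
    have hrays := integral_rays_eq (z₀ := μ) hθ.le hθ' hcont
      (fun z hz hne => (differentiableAt_dslope_of_ne hne).2 (hψd z hz)) hK'
    have hsplit : ∀ σ : ℝ, σ = 1 ∨ σ = -1 →
        ∫ x : ℝ, polarPt x (σ * θ) * g (polarPt x (σ * θ)) / (polarPt x (σ * θ) - μ)
          * polarPt x (σ * θ)
        = (∫ x : ℝ, h (polarPt x (σ * θ)) * polarPt x (σ * θ)) + c * (-σ * Real.pi * Complex.I) := by
      intro σ hσ
      have habs : |σ * θ| = θ := by
        rcases hσ with rfl | rfl <;> simp [abs_of_pos hθ]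
      obtain ⟨i1, i2⟩ := integral_ray_pole hμ hθ hθ' hσ
      have i3 := integrable_ray (μ := μ) hθ hθ' ha hd hb habs
      rw [← i2, ← integral_const_mul, ← sub_eq_iff_eq_add, ← integral_sub i3 (i1.const_mul c)]
      refine integral_congr_ae (Eventually.of_forall fun x => ?_)
      have hsin : 0 < Real.sin θ := Real.sin_pos_of_pos_of_lt_pi hθ (by linarith [Real.pi_pos])
      have hsub : polarPt x (σ * θ) - μ ≠ 0 := fun h => by
        have := norm_polarPt_sub_ge x habs μ
        rw [h, norm_zero] at this
        have := mul_pos hsin (Real.exp_pos x)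
        linarith
      have h2 := hadd _ (polarPt_mem_sector hθ' x habs.le)
      simp only [hh]
      rw [dslope_of_ne _ (sub_ne_zero.1 hsub), slope_def_field, hψ, sub_zero]
      field_simp
    have h1 := hsplit 1 (Or.inl rfl)
    have h2 := hsplit (-1) (Or.inr rfl)
    rw [one_mul] at h1
    rw [neg_one_mul] at h2
    rw [h1, h2, hrays]
    push_cast
    ring

end DGCG

namespace DGCG

/-! ### Seminorms of vector-valued integrals. -/

/-- A seminorm is attained by a real linear functional that it dominates. -/
theorem exists_functional_eq_seminorm {V : Type*} [AddCommGroup V] [Module ℂ V]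
    (N : Seminorm ℂ V) (x : V) :
    ∃ l : V →ₗ[ℝ] ℝ, l x = N x ∧ ∀ y, l y ≤ N y := by
  by_cases hx : x = 0
  · exact ⟨0, by simp [hx], fun y => by simp⟩
  have hN : ∀ (c : ℝ) (y : V), N (c • y) = |c| * N y := fun c y => by
    have := map_smul_eq_mul N (c : ℂ) y
    rwa [Complex.norm_real, Real.norm_eq_abs, Complex.coe_smul] at this
  obtain ⟨l, hl, hl'⟩ := exists_extension_of_le_sublinear
    (LinearPMap.mkSpanSingleton (K := ℝ) (L := ℝ) (σ := RingHom.id ℝ) x (N x) hx) N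
    (fun c hc y => by rw [hN, abs_of_pos hc]) (map_add_le_add N) (by
      rintro ⟨y, hy⟩
      obtain ⟨c, rfl⟩ := Submodule.mem_span_singleton.1 hy
      refine (LinearPMap.mkSpanSingleton'_apply _ _ _ c hy).le.trans ?_
      change c * N x ≤ N (c • x)
      rw [hN]
      exact mul_le_mul_of_nonneg_right (le_abs_self c) (apply_nonneg N x))
  refine ⟨l, ?_, hl'⟩
  exact (hl ⟨x, Submodule.mem_span_singleton_self x⟩).trans
    (LinearPMap.mkSpanSingleton_apply ℝ ℝ hx (N x))

/-- A functional dominated by N and attaining N at the integral reduces the claim to monotonicity of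
the scalar integral. -/
theorem seminorm_integral_le {V : Type*} [NormedAddCommGroup V] [NormedSpace ℂ V]
    [FiniteDimensional ℂ V] (N : Seminorm ℂ V) {α : Type*} [MeasurableSpace α] {μ : Measure α}
    {f : α → V} {b : α → ℝ} (hf : Integrable f μ) (hb : Integrable b μ)
    (h : ∀ᵐ x ∂μ, N (f x) ≤ b x) : N (∫ x, f x ∂μ) ≤ ∫ x, b x ∂μ := by
  obtain ⟨l, hl, hl'⟩ := exists_functional_eq_seminorm N (∫ x, f x ∂μ)
  have : FiniteDimensional ℝ V := FiniteDimensional.complexToReal V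
  have : CompleteSpace V := FiniteDimensional.complete ℂ V
  rw [← hl, ← LinearMap.coe_toContinuousLinearMap' l, ← ContinuousLinearMap.integral_comp_comm _ hf]
  refine integral_mono_ae (ContinuousLinearMap.integrable_comp _ hf) hb ?_
  filter_upwards [h] with x hx
  exact (hl' _).trans hx

/-! ### Functions of a diagonalizable operator -/

section calculus

variable {V : Type*} [NormedAddCommGroup V] [NormedSpace ℂ V] {ι : Type*} [Fintype ι]

/-- The function `g` of the operator with eigenbasis `e` and eigenvalues `ev`. -/
noncomputable def opFun (e : Module.Basis ι ℂ V) (ev : ι → ℝ) (g : ℂ → ℂ) : V →ₗ[ℂ] V :=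
  e.constr ℂ fun i => g (ev i) • e i

theorem opFun_apply (e : Module.Basis ι ℂ V) (ev : ι → ℝ) (g : ℂ → ℂ) (v : V) :
    opFun e ev g v = ∑ i, (e.repr v i * g (ev i)) • e i := by
  simp [opFun, Module.Basis.constr_apply_fintype, smul_smul]

theorem repr_opFun (e : Module.Basis ι ℂ V) (ev : ι → ℝ) (g : ℂ → ℂ) (v : V) (i : ι) :
    e.repr (opFun e ev g v) i = g (ev i) * e.repr v i := by
  classical
  rw [opFun_apply, map_sum, Finsupp.finsetSum_apply]
  simp [Finsupp.single_apply, mul_comm]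

/-- The operator given by an eigenbasis `e` with eigenvalues `ev` satisfies the resolvent estimate
with constant `M` outside of the sector of angle `γ`, in the seminorm `N`. -/
def ResolventBound (e : Module.Basis ι ℂ V) (ev : ι → ℝ) (N : Seminorm ℂ V) (γ M : ℝ) : Prop :=
  ∀ z : ℂ, ¬ |z.arg| ≤ γ → ∀ v : V, N (opFun e ev (fun w => (z - w)⁻¹) v) ≤ M / ‖z‖ * N v

/-- The Dunford integral over the boundary of a sector. -/
theorem opFun_bound [FiniteDimensional ℂ V] {e : Module.Basis ι ℂ V} {ev : ι → ℝ}
    {N : Seminorm ℂ V} {γ θ M : ℝ}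
    (hev : ∀ i, 0 ≤ ev i) (hres : ResolventBound e ev N γ M) (hθ : 0 < θ) (hγθ : γ < θ)
    (hθ' : θ < Real.pi / 2) {g : ℂ → ℂ} {K a : ℝ} (ha : 0 < a)
    (hd : ∀ z ∈ sector θ, DifferentiableAt ℂ g z)
    (hb : ∀ z ∈ sector θ, ‖g z‖ ≤ K / (1 + (a * ‖z‖) ^ 2)) (v : V) :
    N (opFun e ev (fun z => z * g z) v) ≤ M * (K / (2 * a)) * N v := by
  set R : ℝ → ℝ → V := fun y x => (polarPt x y * g (polarPt x y) * polarPt x y) •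
    opFun e ev (fun w => (polarPt x y - w)⁻¹) v with hR
  have habs : |-θ| = θ := by rw [abs_neg, abs_of_pos hθ]
  have habs' : |θ| = θ := abs_of_pos hθ
  have hRsum : ∀ y x, R y x = ∑ i, (e.repr v i *
      (polarPt x y * g (polarPt x y) / (polarPt x y - ev i) * polarPt x y)) • e i := by
    intro y x
    simp only [hR, opFun_apply, Finset.smul_sum, smul_smul]
    refine Finset.sum_congr rfl fun i _ => ?_
    congr 1
    rw [div_eq_mul_inv]; ring
  have hInt : ∀ y, |y| = θ → Integrable (R y) := by
    intro y hy
    have : R y = fun x => ∑ i, (e.repr v i *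
      (polarPt x y * g (polarPt x y) / (polarPt x y - ev i) * polarPt x y)) • e i :=
      funext (hRsum y)
    rw [this]
    exact integrable_finsetSum _ fun i _ =>
      ((integrable_ray hθ hθ' ha hd hb hy).const_mul _).smul_const _
  have hval : ∀ y, |y| = θ → ∫ x, R y x = ∑ i, (e.repr v i *
      ∫ x : ℝ, polarPt x y * g (polarPt x y) / (polarPt x y - ev i) * polarPt x y) • e i := by
    intro y hy
    have : CompleteSpace V := FiniteDimensional.complete ℂ V
    simp only [hRsum]
    rw [integral_finsetSum _ fun i _ =>
      ((integrable_ray hθ hθ' ha hd hb hy).const_mul _).smul_const _]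
    refine Finset.sum_congr rfl fun i _ => ?_
    rw [integral_smul_const, integral_const_mul]
  -- Cauchy's formula for each eigenvalue separately; the eigenvalue 0 may occur.
  have hkey : (2 * Real.pi * Complex.I) • opFun e ev (fun z => z * g z) v
      = (∫ x, R (-θ) x) - ∫ x, R θ x := by
    rw [hval _ habs, hval _ habs', ← Finset.sum_sub_distrib, opFun_apply, Finset.smul_sum]
    refine Finset.sum_congr rfl fun i _ => ?_
    rw [← sub_smul, ← mul_sub, cauchy_sector hθ hθ' ha (hev i) hd hb, smul_smul]
    congr 1
    ring
  -- The three factors exp x are |z| from z g(z), the resolvent's 1/|z|, and |dz| = exp x dx. The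
  -- first two cancel, so the contour may run through the vertex.
  have hbound : ∀ y, |y| = θ → N (∫ x, R y x) ≤ M * K * N v * (Real.pi / (2 * a)) := by
    intro y hy
    rw [← integral_exp_div ha, ← integral_const_mul]
    refine seminorm_integral_le N (hInt y hy) ((integrable_exp_div ha).const_mul _)
      (Eventually.of_forall fun x => ?_)
    have h1 := hres (polarPt x y) (by
      rw [arg_polarPt x (by rw [hy]; linarith [Real.pi_pos]), hy]; exact not_le.2 hγθ) v
    have h2 := hb _ (polarPt_mem_sector hθ' x hy.le)
    simp only [hR]
    rw [map_smul_eq_mul, norm_mul, norm_mul]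
    rw [norm_polarPt] at *
    have he := Real.exp_pos x
    have hpos : 0 ≤ K / (1 + (a * Real.exp x) ^ 2) := (norm_nonneg _).trans h2
    calc _ ≤ Real.exp x * (K / (1 + (a * Real.exp x) ^ 2)) * Real.exp x
          * (M / Real.exp x * N v) := by gcongr
      _ = _ := by field_simp
  have h3 := congrArg N hkey
  have h4 : N ((∫ x, R (-θ) x) - ∫ x, R θ x) ≤ 2 * (M * K * N v * (Real.pi / (2 * a))) :=
    (map_sub_le_add N _ _).trans (by linarith [hbound _ habs, hbound _ habs'])
  rw [map_smul_eq_mul] at h3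
  have h5 : ‖(2 * Real.pi * Complex.I : ℂ)‖ = 2 * Real.pi := by
    simp [abs_of_pos Real.pi_pos]
  rw [h5] at h3
  rw [← h3] at h4
  have hpi := Real.pi_pos
  have e1 : 2 * (M * K * N v * (Real.pi / (2 * a))) = 2 * Real.pi * (M * (K / (2 * a)) * N v) := by
    field_simp
  rw [e1] at h4
  exact le_of_mul_le_mul_left h4 (by positivity)

end calculus

end DGCG

namespace DGCG

/-! ### The matrices of the dG(q) method on the reference interval -/

/-- The mass matrix of the monomials `1, t, …, t^(n-1)` on `(0,1)`. -/
noncomputable def massMat (n : ℕ) : Matrix (Fin n) (Fin n) ℂ :=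
  Matrix.of fun i j => 1 / ((i : ℂ) + (j : ℂ) + 1)

/-- The matrix of `(p, φ) ↦ ∫₀¹ p' φ + p(0) φ(0)` in the monomial basis. -/
noncomputable def dgMat (q : ℕ) : Matrix (Fin (q + 1)) (Fin (q + 1)) ℂ :=
  Matrix.of fun i j => (j : ℂ) / ((i : ℂ) + (j : ℂ)) + (if i = 0 then 1 else 0) * if j = 0 then 1 else 0

/-- The squared `L²(0,1)`-norm of the polynomial with coefficients `U`. -/
noncomputable def polyEnergy {n : ℕ} (U : Fin n → ℂ) : ℝ :=
  ∫ t in (0 : ℝ)..1, ‖∑ j, U j * (t : ℂ) ^ (j : ℕ)‖ ^ 2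

theorem integral_pow_unit (n : ℕ) : ∫ t in (0 : ℝ)..1, ((t : ℂ) ^ n) = 1 / ((n : ℂ) + 1) := by
  have h : ∫ t in (0 : ℝ)..1, ((t : ℂ) ^ n) = ((∫ t in (0 : ℝ)..1, t ^ n : ℝ) : ℂ) := by
    rw [← intervalIntegral.integral_ofReal]; simp
  rw [h, integral_pow]; simp

theorem star_dotProduct_massMat {n : ℕ} (U : Fin n → ℂ) :
    star U ⬝ᵥ (massMat n).mulVec U = (polyEnergy U : ℂ) := by
  rw [polyEnergy, ← intervalIntegral.integral_ofReal]
  have h : ∀ t : ℝ, ((‖∑ j, U j * (t : ℂ) ^ (j : ℕ)‖ ^ 2 : ℝ) : ℂ)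
      = ∑ i, ∑ j, star (U i) * U j * (t : ℂ) ^ ((i : ℕ) + j) := by
    intro t
    push_cast
    rw [← Complex.conj_mul', map_sum, Finset.sum_mul_sum]
    refine Finset.sum_congr rfl fun i _ => Finset.sum_congr rfl fun j _ => ?_
    rw [map_mul, map_pow, Complex.conj_ofReal, pow_add, starRingEnd_apply]; ring
  simp only [h]
  rw [intervalIntegral.integral_finsetSum fun i _ => Continuous.intervalIntegrable (by fun_prop) _ _]
  simp only [dotProduct, Matrix.mulVec, massMat, Matrix.of_apply, Pi.star_apply]
  refine Finset.sum_congr rfl fun i _ => ?_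
  rw [intervalIntegral.integral_finsetSum
    fun i _ => Continuous.intervalIntegrable (by fun_prop) _ _, Finset.mul_sum]
  refine Finset.sum_congr rfl fun j _ => ?_
  rw [intervalIntegral.integral_const_mul, integral_pow_unit]
  push_cast
  ring

theorem polyEnergy_pos {n : ℕ} {U : Fin n → ℂ} (hU : U ≠ 0) : 0 < polyEnergy U := by
  refine intervalIntegral.integral_pos one_pos (by fun_prop) (fun t _ => by positivity) ?_
  by_contra! hcon
  refine hU ?_
  set p : Polynomial ℂ := ∑ j : Fin n, Polynomial.C (U j) * Polynomial.X ^ (j : ℕ) with hp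
  have hp0 : p = 0 := by
    refine Polynomial.eq_zero_of_infinite_isRoot p (Set.Infinite.mono (s := Complex.ofReal ''
      Set.Icc (0 : ℝ) 1) ?_ ((Set.Icc_infinite one_pos).image Complex.ofReal_injective.injOn))
    rintro _ ⟨t, ht, rfl⟩
    have h := hcon t ht
    have h2 : ‖∑ j, U j * (t : ℂ) ^ (j : ℕ)‖ = 0 := by
      nlinarith [norm_nonneg (∑ j, U j * (t : ℂ) ^ (j : ℕ))]
    rw [norm_eq_zero] at h2
    simpa [Polynomial.IsRoot, hp, Polynomial.eval_finsetSum] using h2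
  funext i
  have h := congrArg (fun r => Polynomial.coeff r (i : ℕ)) hp0
  simp only [hp, Polynomial.finsetSum_coeff, Polynomial.coeff_C_mul, Polynomial.coeff_X_pow,
    Polynomial.coeff_zero] at h
  rw [Finset.sum_eq_single i] at h
  · simpa using h
  · intro j _ hj
    have : (i : ℕ) ≠ j := fun h => hj (Fin.ext h.symm)
    simp [this]
  · simp

/-- The energy is continuous, positive off 0 and homogeneous of degree two, so its minimum over the
unit sphere serves. The sphere is empty exactly when n = 0. -/
theorem exists_polyEnergy_ge (n : ℕ) : ∃ m : ℝ, 0 < m ∧ ∀ U : Fin n → ℂ,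
    m * ‖U‖ ^ 2 ≤ polyEnergy U := by
  have hsmul : ∀ (c : ℝ) (U : Fin n → ℂ), polyEnergy (c • U) = c ^ 2 * polyEnergy U := by
    intro c U
    rw [polyEnergy, polyEnergy, ← intervalIntegral.integral_const_mul]
    congr 1
    funext t
    have : ∑ j, (c • U) j * (t : ℂ) ^ (j : ℕ) = c * ∑ j, U j * (t : ℂ) ^ (j : ℕ) := by
      rw [Finset.mul_sum]
      simp [mul_assoc]
    rw [this, norm_mul, mul_pow]; simp
  have hcont : Continuous (polyEnergy (n := n)) := by
    have h : Continuous fun U : Fin n → ℂ => (star U ⬝ᵥ (massMat n).mulVec U).re := by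
      simp only [dotProduct, Matrix.mulVec, Pi.star_apply]
      fun_prop
    refine h.congr fun U => ?_
    rw [star_dotProduct_massMat, Complex.ofReal_re]
  rcases (Metric.sphere (0 : Fin n → ℂ) 1).eq_empty_or_nonempty with he | hne
  · refine ⟨1, one_pos, fun U => ?_⟩
    have hU : U = 0 := by
      by_contra hU
      have : (‖U‖⁻¹ : ℝ) • U ∈ Metric.sphere (0 : Fin n → ℂ) 1 := by
        simp [norm_smul, norm_ne_zero_iff.2 hU]
      rw [he] at this
      exact this
    subst hU
    have := hsmul 0 0
    simp at this
    simp [this]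
  · obtain ⟨U₀, hU₀, hmin⟩ := (isCompact_sphere (0 : Fin n → ℂ) 1).exists_isMinOn hne
      hcont.continuousOn
    have hU₀' : U₀ ≠ 0 := by
      rintro rfl
      simp at hU₀
    refine ⟨polyEnergy U₀, polyEnergy_pos hU₀', fun U => ?_⟩
    by_cases hU : U = 0
    · subst hU
      have := hsmul 0 0
      simp at this
      simp [this]
    · have hn := norm_ne_zero_iff.2 hU
      have hmem : (‖U‖⁻¹ : ℝ) • U ∈ Metric.sphere (0 : Fin n → ℂ) 1 := by
        simp [norm_smul, hn]
      have h : polyEnergy U₀ ≤ polyEnergy ((‖U‖⁻¹ : ℝ) • U) := hmin hmem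
      rw [hsmul] at h
      calc _ ≤ (‖U‖⁻¹ ^ 2 * polyEnergy U) * ‖U‖ ^ 2 := by gcongr
        _ = _ := by field_simp

theorem massMat_mulVec_injective (n : ℕ) {U : Fin n → ℂ} (hU : (massMat n).mulVec U = 0) :
    U = 0 := by
  by_contra h
  have h1 := star_dotProduct_massMat U
  rw [hU, dotProduct_zero] at h1
  have := polyEnergy_pos h
  exact this.ne (by exact_mod_cast h1)

/-- Integration by parts: for the polynomial p with coefficients U, Re ∫ p' p̄ = (|p(1)|² -
|p(0)|²)/2, and the jump term adds |p(0)|². In matrix form, D + Dᵀ is the all-ones matrix plus a 1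
in the corner (0,0). -/
theorem re_star_dotProduct_dgMat (q : ℕ) (U : Fin (q + 1) → ℂ) :
    (star U ⬝ᵥ (dgMat q).mulVec U).re = (‖∑ j, U j‖ ^ 2 + ‖U 0‖ ^ 2) / 2 := by
  set d : Fin (q + 1) → Fin (q + 1) → ℝ := fun i j => (j : ℝ) / ((i : ℝ) + (j : ℝ))
    + (if i = 0 then 1 else 0) * if j = 0 then 1 else 0 with hd
  have hsym : ∀ i j, d i j + d j i = 1 + (if i = 0 then 1 else 0) * if j = 0 then 1 else 0 := by
    intro i j
    simp only [hd]
    -- At (0,0) the quotient j/(i + j) is 0/0 = 0, the correct value since the derivative of a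
    -- constant vanishes; the entry 1 comes from the jump term alone.
    by_cases hij : i = 0 ∧ j = 0
    · obtain ⟨rfl, rfl⟩ := hij
      norm_num
    · have hpos : ((i : ℕ) : ℝ) + ((j : ℕ) : ℝ) ≠ 0 := by
        rw [not_and_or, Fin.ext_iff, Fin.ext_iff] at hij
        have : (i : ℕ) + (j : ℕ) ≠ 0 := by simp only [Fin.val_zero] at hij; omega
        exact_mod_cast this
      have hz : (if i = 0 then (1 : ℝ) else 0) * (if j = 0 then 1 else 0) = 0 := by
        rcases not_and_or.1 hij with h | h <;> simp [h]
      rw [mul_comm (if j = 0 then (1 : ℝ) else 0), hz, add_comm ((j : ℕ) : ℝ) (i : ℕ), add_zero,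
        add_zero, add_zero, ← add_div, add_comm ((j : ℕ) : ℝ) (i : ℕ), div_self hpos]
  set r : Fin (q + 1) → Fin (q + 1) → ℝ := fun i j => (U i).re * (U j).re + (U i).im * (U j).im
    with hr
  have h1 : (star U ⬝ᵥ (dgMat q).mulVec U).re = ∑ i, ∑ j, r i j * d i j := by
    simp only [dotProduct, Matrix.mulVec, dgMat, Matrix.of_apply, Pi.star_apply, Finset.mul_sum,
      Complex.re_sum]
    refine Finset.sum_congr rfl fun i _ => Finset.sum_congr rfl fun j _ => ?_
    have e : ((j : ℂ) / ((i : ℂ) + (j : ℂ)) + (if i = 0 then 1 else 0) * if j = 0 then 1 else 0)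
        = ((d i j : ℝ) : ℂ) := by
      simp only [hd]
      split_ifs <;> push_cast <;> simp
    rw [e, hr]
    simp [Complex.mul_re]
    ring
  have h2 : ∑ i, ∑ j, r i j * d i j = ∑ i, ∑ j, r i j * d j i := by
    rw [Finset.sum_comm]
    refine Finset.sum_congr rfl fun i _ => Finset.sum_congr rfl fun j _ => ?_
    simp only [hr]; ring
  have h3 : ∑ i, ∑ j, r i j * d i j + ∑ i, ∑ j, r i j * d j i
      = (∑ i, ∑ j, r i j) + r 0 0 := by
    rw [← Finset.sum_add_distrib]
    have : ∀ i, (∑ j, r i j * d i j) + ∑ j, r i j * d j i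
        = (∑ j, r i j) + if i = 0 then r 0 0 else 0 := by
      intro i
      rw [← Finset.sum_add_distrib]
      simp only [← mul_add, hsym]
      by_cases hi : i = 0
      · simp [hi, mul_add, Finset.sum_add_distrib]
      · simp [hi]
    simp [this, Finset.sum_add_distrib]
  have h4 : ∑ i, ∑ j, r i j = ‖∑ j, U j‖ ^ 2 := by
    rw [← Complex.normSq_eq_norm_sq, Complex.normSq_apply]
    simp only [Complex.re_sum, Complex.im_sum, Finset.sum_mul_sum, hr, Finset.sum_add_distrib]
  have h5 : r 0 0 = ‖U 0‖ ^ 2 := by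
    rw [← Complex.normSq_eq_norm_sq, Complex.normSq_apply]
  rw [h1, ← h4, ← h5]
  linarith

/-- The energy identity gives p(0) = 0. Testing then with powers below q shows that p', of degree
below q, is orthogonal to all polynomials of its kind; this is injectivity of the smaller mass
matrix. -/
theorem dgMat_mulVec_injective (q : ℕ) {U : Fin (q + 1) → ℂ} (hU : (dgMat q).mulVec U = 0) :
    U = 0 := by
  have h1 := re_star_dotProduct_dgMat q U
  rw [hU, dotProduct_zero, Complex.zero_re] at h1
  have hU0 : U 0 = 0 := by
    have : ‖U 0‖ = 0 := by nlinarith [norm_nonneg (U 0), sq_nonneg ‖∑ j, U j‖]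
    simpa using this
  have h2 : (fun j : Fin q => ((j : ℂ) + 1) * U j.succ) = 0 := by
    refine massMat_mulVec_injective q (funext fun i => ?_)
    have h3 := congrFun hU i.castSucc
    simp only [Matrix.mulVec, dotProduct, dgMat, Matrix.of_apply, Fin.sum_univ_succ, hU0, mul_zero,
      zero_add, Pi.zero_apply] at h3
    simp only [Matrix.mulVec, dotProduct, massMat, Matrix.of_apply, Pi.zero_apply]
    rw [← h3]
    refine Finset.sum_congr rfl fun j _ => ?_
    simp [Fin.succ_ne_zero]
    ring
  funext j
  refine Fin.cases hU0 (fun j => ?_) j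
  have h4 := congrFun h2 j
  have h5 : (((j : ℕ) : ℂ) + 1) ≠ 0 := Nat.cast_add_one_ne_zero _
  simpa [h5] using h4

end DGCG

namespace DGCG

/-! ### The one-step solution matrix and the stability function on a cone. -/

/-- The matrix of one step of the dG(q) method for `u' + w u = f` on the unit interval. -/
noncomputable def stepMat (q : ℕ) (w : ℂ) : Matrix (Fin (q + 1)) (Fin (q + 1)) ℂ :=
  dgMat q + w • massMat (q + 1)

/-- The solution operator of one step of the dG(q) method. -/
noncomputable def solMat (q : ℕ) (w : ℂ) : Matrix (Fin (q + 1)) (Fin (q + 1)) ℂ := (stepMat q w)⁻¹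

/-- The stability function of the dG(q) method. -/
noncomputable def stabFun (q : ℕ) (w : ℂ) : ℂ := ∑ i, solMat q w i 0

/-- The part of the solution operator with quadratic decay. -/
noncomputable def remMat (q : ℕ) (w : ℂ) : Matrix (Fin (q + 1)) (Fin (q + 1)) ℂ :=
  solMat q w - (1 + w)⁻¹ • (massMat (q + 1))⁻¹

theorem exists_mulVec_bound {n : ℕ} (A : Matrix (Fin n) (Fin n) ℂ) :
    ∃ C, 0 ≤ C ∧ ∀ v, ‖A.mulVec v‖ ≤ C * ‖v‖ :=
  ⟨‖LinearMap.toContinuousLinearMap (Matrix.toLin' A)‖, norm_nonneg _, fun v => by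
    simpa using (LinearMap.toContinuousLinearMap (Matrix.toLin' A)).le_opNorm v⟩

theorem isUnit_of_mulVec_injective {n : ℕ} {A : Matrix (Fin n) (Fin n) ℂ}
    (h : ∀ v, A.mulVec v = 0 → v = 0) : IsUnit A := by
  rw [← Matrix.mulVec_injective_iff_isUnit]
  intro v w hvw
  refine sub_eq_zero.1 (h _ ?_)
  rw [Matrix.mulVec_sub, hvw, sub_self]

theorem re_star_dotProduct_stepMat (q : ℕ) (w : ℂ) (U : Fin (q + 1) → ℂ) :
    (star U ⬝ᵥ (stepMat q w).mulVec U).re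
      = (‖∑ j, U j‖ ^ 2 + ‖U 0‖ ^ 2) / 2 + w.re * polyEnergy U := by
  rw [stepMat, Matrix.add_mulVec, dotProduct_add, Complex.add_re, re_star_dotProduct_dgMat,
    Matrix.smul_mulVec, dotProduct_smul, star_dotProduct_massMat]
  simp

theorem norm_sum_le_card_mul {n : ℕ} (U : Fin n → ℂ) : ‖∑ j, U j‖ ≤ n * ‖U‖ := by
  refine (norm_sum_le _ _).trans ?_
  refine (Finset.sum_le_card_nsmul _ _ ‖U‖ fun i _ => norm_le_pi_norm U i).trans ?_
  simp

theorem norm_star_dotProduct_le {n : ℕ} (U y : Fin n → ℂ) : ‖star U ⬝ᵥ y‖ ≤ n * ‖U‖ * ‖y‖ := by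
  refine (norm_sum_le _ _).trans ?_
  refine (Finset.sum_le_card_nsmul _ _ (‖U‖ * ‖y‖) fun i _ => ?_).trans ?_
  · rw [norm_mul, Pi.star_apply, norm_star]
    gcongr
    · exact norm_le_pi_norm U i
    · exact norm_le_pi_norm y i
  · simp [mul_assoc]

/-- Write y = (D + wG)U. The real part of the energy identity controls Re w · ‖U‖² and hence ‖w‖‖U‖,
by coercivity of G. Then U = D⁻¹(y - wGU) controls ‖U‖ itself, uniformly down to w = 0. -/
theorem exists_apriori (q : ℕ) {α : ℝ} (hα : 0 < α) : ∃ C, 0 < C ∧ ∀ (w : ℂ), α * ‖w‖ ≤ w.re →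
    ∀ U, (1 + ‖w‖) * ‖U‖ ≤ C * ‖(stepMat q w).mulVec U‖ := by
  obtain ⟨m, hm, hmE⟩ := exists_polyEnergy_ge (q + 1)
  obtain ⟨CD, hCD, hD⟩ := exists_mulVec_bound (dgMat q)⁻¹
  obtain ⟨CG, hCG, hG⟩ := exists_mulVec_bound (massMat (q + 1))
  have hDu : IsUnit (dgMat q) := isUnit_of_mulVec_injective fun v => dgMat_mulVec_injective q
  set C₁ : ℝ := ((q + 1 : ℕ) : ℝ) / (α * m) with hC₁
  refine ⟨CD * (1 + CG * C₁) + C₁, by positivity, fun w hw U => ?_⟩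
  set y := (stepMat q w).mulVec U with hy
  have h1 : ‖w‖ * ‖U‖ ≤ C₁ * ‖y‖ := by
    have e1 := re_star_dotProduct_stepMat q w U
    have e2 := (Complex.re_le_norm _).trans (norm_star_dotProduct_le U y)
    rw [← hy] at e1
    rw [e1] at e2
    have e3 : α * ‖w‖ * (m * ‖U‖ ^ 2) ≤ w.re * polyEnergy U :=
      mul_le_mul hw (hmE U) (by positivity) ((by positivity : (0 : ℝ) ≤ α * ‖w‖).trans hw)
    have e4 : ‖U‖ * (α * m * (‖w‖ * ‖U‖)) ≤ ‖U‖ * (((q + 1 : ℕ) : ℝ) * ‖y‖) := by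
      nlinarith [sq_nonneg ‖∑ j, U j‖, sq_nonneg ‖U 0‖]
    rcases (norm_nonneg U).eq_or_lt with h0 | h0
    · rw [← h0, mul_zero]; positivity
    · have e5 := le_of_mul_le_mul_left e4 h0
      rw [hC₁, div_mul_eq_mul_div, le_div_iff₀ (by positivity)]
      linarith
  have h2 : ‖U‖ ≤ CD * (‖y‖ + CG * (C₁ * ‖y‖)) := by
    have e1 : (dgMat q)⁻¹.mulVec (y - w • (massMat (q + 1)).mulVec U) = U := by
      rw [hy, stepMat, Matrix.add_mulVec, Matrix.smul_mulVec, add_sub_cancel_right,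
        Matrix.mulVec_mulVec, Matrix.nonsing_inv_mul _ ((Matrix.isUnit_iff_isUnit_det _).1 hDu),
        Matrix.one_mulVec]
    have e2 := hD (y - w • (massMat (q + 1)).mulVec U)
    rw [e1] at e2
    refine e2.trans ?_
    gcongr
    refine (norm_sub_le _ _).trans (add_le_add le_rfl ?_)
    rw [norm_smul]
    have := hG U
    have hw0 := norm_nonneg w
    calc ‖w‖ * ‖(massMat (q + 1)).mulVec U‖ ≤ ‖w‖ * (CG * ‖U‖) := by gcongr
      _ = CG * (‖w‖ * ‖U‖) := by ring
      _ ≤ _ := by gcongr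
  calc _ = ‖U‖ + ‖w‖ * ‖U‖ := by ring
    _ ≤ _ := by linarith

theorem isUnit_stepMat (q : ℕ) {α : ℝ} (hα : 0 < α) {w : ℂ} (hw : α * ‖w‖ ≤ w.re) :
    IsUnit (stepMat q w).det := by
  rw [← Matrix.isUnit_iff_isUnit_det]
  obtain ⟨C, hC, h⟩ := exists_apriori q hα
  refine isUnit_of_mulVec_injective fun v hv => ?_
  have h1 := h w hw v
  rw [hv, norm_zero, mul_zero] at h1
  have : 0 < 1 + ‖w‖ := by positivity
  have h2 : ‖v‖ ≤ 0 := by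
    by_contra hcon
    have := mul_pos this (not_le.1 hcon)
    linarith
  simpa using h2

theorem isUnit_massMat (n : ℕ) : IsUnit (massMat n).det := by
  rw [← Matrix.isUnit_iff_isUnit_det]
  exact isUnit_of_mulVec_injective fun v => massMat_mulVec_injective n

theorem isUnit_dgMat (q : ℕ) : IsUnit (dgMat q).det := by
  rw [← Matrix.isUnit_iff_isUnit_det]
  exact isUnit_of_mulVec_injective fun v => dgMat_mulVec_injective q

theorem stepMat_mulVec_solMat_col (q : ℕ) {α : ℝ} (hα : 0 < α) {w : ℂ} (hw : α * ‖w‖ ≤ w.re)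
    (j : Fin (q + 1)) : (stepMat q w).mulVec (fun i => solMat q w i j) = Pi.single j 1 := by
  have h := Matrix.mul_nonsing_inv _ (isUnit_stepMat q hα hw)
  funext i
  have h2 := congrFun (congrFun h i) j
  rw [Matrix.mul_apply, Matrix.one_apply] at h2
  simp only [Matrix.mulVec, dotProduct, Pi.single_apply]
  exact h2

theorem exists_solMat_bound (q : ℕ) {α : ℝ} (hα : 0 < α) : ∃ C, 0 < C ∧ ∀ (w : ℂ),
    α * ‖w‖ ≤ w.re → ∀ i j, ‖solMat q w i j‖ ≤ C / (1 + ‖w‖) := by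
  obtain ⟨C, hC, h⟩ := exists_apriori q hα
  refine ⟨C, hC, fun w hw i j => ?_⟩
  have h1 := h w hw (fun i => solMat q w i j)
  rw [stepMat_mulVec_solMat_col q hα hw] at h1
  have h2 : ‖(Pi.single j 1 : Fin (q + 1) → ℂ)‖ ≤ 1 := by
    refine (pi_norm_le_iff_of_nonneg zero_le_one).2 fun i => ?_
    rw [Pi.single_apply]; split_ifs <;> simp
  rw [le_div_iff₀ (by positivity), mul_comm]
  have h3 := norm_le_pi_norm (fun i => solMat q w i j) i
  calc _ ≤ (1 + ‖w‖) * ‖fun i => solMat q w i j‖ := by gcongr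
    _ ≤ _ := h1
    _ ≤ C * 1 := by gcongr
    _ = C := mul_one C

/-- The first column U of the solution matrix solves the step with initial value 1 and no data. The
energy identity and 2|U 0| ≤ 1 + |U 0|² give |R|² + 2 Re w · E(U) ≤ 1, and E(U) dominates a multiple
of |R|² because R = p(1). -/
theorem exists_stabFun_sq_bound (q : ℕ) {α : ℝ} (hα : 0 < α) : ∃ c, 0 < c ∧ ∀ (w : ℂ),
    α * ‖w‖ ≤ w.re → ‖stabFun q w‖ ^ 2 * (1 + c * ‖w‖) ≤ 1 := by
  obtain ⟨m, hm, hmE⟩ := exists_polyEnergy_ge (q + 1)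
  set n : ℝ := ((q + 1 : ℕ) : ℝ) with hn
  have hn0 : 0 < n := by positivity
  refine ⟨2 * α * m / n ^ 2, by positivity, fun w hw => ?_⟩
  set U : Fin (q + 1) → ℂ := fun i => solMat q w i 0 with hU
  have h1 := re_star_dotProduct_stepMat q w U
  rw [hU, stepMat_mulVec_solMat_col q hα hw 0, ← hU] at h1
  have hR : ∑ j, U j = stabFun q w := rfl
  rw [hR] at h1
  have h2 : (star U ⬝ᵥ (Pi.single 0 1 : Fin (q + 1) → ℂ)).re ≤ ‖U 0‖ := by
    simpa using (Complex.re_le_norm (U 0))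
  have h3 : ‖stabFun q w‖ ^ 2 ≤ n ^ 2 / m * polyEnergy U := by
    have e1 := norm_sum_le_card_mul U
    rw [hR] at e1
    calc _ ≤ (n * ‖U‖) ^ 2 := by gcongr
      _ = n ^ 2 / m * (m * ‖U‖ ^ 2) := by field_simp
      _ ≤ _ := by gcongr; exact hmE U
  have h4 : 2 * α * m / n ^ 2 * ‖w‖ * ‖stabFun q w‖ ^ 2 ≤ 2 * (w.re * polyEnergy U) := by
    calc _ ≤ 2 * α * m / n ^ 2 * ‖w‖ * (n ^ 2 / m * polyEnergy U) := by gcongr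
      _ = 2 * ((α * ‖w‖) * polyEnergy U) := by field_simp
      _ ≤ _ := by
        have : 0 ≤ polyEnergy U := (by positivity : (0 : ℝ) ≤ m * ‖U‖ ^ 2).trans (hmE U)
        gcongr
  nlinarith [sq_nonneg (‖U 0‖ - 1)]

/-- The energy bound is sharp near w = 0, where the bound must tend to 1, but decays only like
|w|^(-1/2). The solution matrix decays like 1/|w|, with a constant in front. They are glued at |w| =
2 C₂. -/
theorem exists_stabFun_bound (q : ℕ) {α : ℝ} (hα : 0 < α) : ∃ c, 0 < c ∧ c ≤ 1 ∧ ∀ (w : ℂ),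
    α * ‖w‖ ≤ w.re → ‖stabFun q w‖ ≤ 1 / (1 + c * ‖w‖) := by
  obtain ⟨C, hC, hS⟩ := exists_solMat_bound q hα
  obtain ⟨c₁, hc₁, h1⟩ := exists_stabFun_sq_bound q hα
  set C₂ : ℝ := ((q + 1 : ℕ) : ℝ) * C with hC₂
  have hC₂0 : 0 < C₂ := by positivity
  -- For |w| ≤ 2C₂ the first two choices give c|w| ≤ 1 and (1 + c|w|)² ≤ 1 + 3c|w| ≤ 1 + c₁|w|. For
  -- larger |w| the first gives C₂(1 + c|w|) ≤ |w|. The cap at 1 lets c|z| be bounded by |z| later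
  -- on.
  set c : ℝ := min (min (1 / (2 * C₂)) (c₁ / 3)) 1 with hc
  have hc0 : 0 < c := by positivity
  have hcle : c ≤ 1 / (2 * C₂) := (min_le_left _ _).trans (min_le_left _ _)
  have hcle' : c ≤ c₁ / 3 := (min_le_left _ _).trans (min_le_right _ _)
  refine ⟨c, hc0, min_le_right _ _, fun w hw => ?_⟩
  rw [le_div_iff₀ (by positivity)]
  have hw0 := norm_nonneg w
  have hc2 : c * (2 * C₂) ≤ 1 := by
    rwa [le_div_iff₀ (by positivity)] at hcle
  rcases le_total ‖w‖ (2 * C₂) with hle | hle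
  · have e1 : (1 + c * ‖w‖) ^ 2 ≤ 1 + c₁ * ‖w‖ := by
      have : c * (c * ‖w‖) ≤ c * 1 := by
        gcongr
        calc c * ‖w‖ ≤ c * (2 * C₂) := by gcongr
          _ ≤ 1 := hc2
      nlinarith
    have e2 : (‖stabFun q w‖ * (1 + c * ‖w‖)) ^ 2 ≤ 1 := by
      rw [mul_pow]
      calc _ ≤ ‖stabFun q w‖ ^ 2 * (1 + c₁ * ‖w‖) := by gcongr
        _ ≤ 1 := h1 w hw
    exact (sq_le_one_iff₀ (by positivity)).1 e2
  · have e1 : ‖stabFun q w‖ ≤ C₂ / (1 + ‖w‖) := by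
      refine (norm_sum_le _ _).trans ((Finset.sum_le_card_nsmul _ _ _
        fun i _ => hS w hw i 0).trans ?_)
      simp [hC₂, mul_div_assoc]
    calc _ ≤ C₂ / (1 + ‖w‖) * (1 + c * ‖w‖) := by gcongr
      _ ≤ 1 := by
        rw [div_mul_eq_mul_div, div_le_one (by positivity)]
        nlinarith

/-- A resolvent-type identity: (1 + w)G - (D + wG) = G - D does not depend on w. The difference of
the two inverses therefore carries both factors of decay. -/
theorem remMat_eq (q : ℕ) {α : ℝ} (hα : 0 < α) {w : ℂ} (hw : α * ‖w‖ ≤ w.re) :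
    remMat q w = (1 + w)⁻¹ • (solMat q w *
      ((massMat (q + 1) - dgMat q) * (massMat (q + 1))⁻¹)) := by
  have h1 : solMat q w * stepMat q w = 1 := Matrix.nonsing_inv_mul _ (isUnit_stepMat q hα hw)
  have h2 : massMat (q + 1) * (massMat (q + 1))⁻¹ = 1 :=
    Matrix.mul_nonsing_inv _ (isUnit_massMat _)
  have hne : (1 + w) ≠ 0 := fun h => by
    have h3 := congrArg Complex.re h
    simp at h3
    have : 0 ≤ α * ‖w‖ := by positivity
    linarith
  have h3 : massMat (q + 1) - dgMat q = (1 + w) • massMat (q + 1) - stepMat q w := by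
    rw [stepMat, add_smul, one_smul]; abel
  rw [h3, Matrix.sub_mul, Matrix.mul_sub, ← Matrix.mul_assoc (solMat q w) (stepMat q w), h1,
    Matrix.one_mul, Matrix.smul_mul, h2, Matrix.mul_smul, Matrix.mul_one, smul_sub, smul_smul,
    inv_mul_cancel₀ hne, one_smul, remMat]

theorem exists_remMat_bound (q : ℕ) {α : ℝ} (hα : 0 < α) : ∃ C, 0 < C ∧ ∀ (w : ℂ),
    α * ‖w‖ ≤ w.re → ∀ i j, ‖remMat q w i j‖ ≤ C / (1 + ‖w‖) ^ 2 := by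
  obtain ⟨C, hC, hS⟩ := exists_solMat_bound q hα
  set B := (massMat (q + 1) - dgMat q) * (massMat (q + 1))⁻¹ with hB
  set b : ℝ := 1 + ∑ k, ∑ j, ‖B k j‖ with hb
  have hb0 : 0 < b := by positivity
  refine ⟨3 * (C * b), by positivity, fun w hw i j => ?_⟩
  rw [remMat_eq q hα hw, Matrix.smul_apply, smul_eq_mul, norm_mul, norm_inv, Matrix.mul_apply]
  have hre : 0 ≤ w.re := (by positivity : 0 ≤ α * ‖w‖).trans hw
  have h1 := add_div_three_le_norm_add (z := w) one_pos hre
  rw [Complex.ofReal_one] at h1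
  have h2 : ‖∑ k, solMat q w i k * B k j‖ ≤ C / (1 + ‖w‖) * b := by
    refine (norm_sum_le _ _).trans ?_
    calc _ ≤ ∑ k, C / (1 + ‖w‖) * ‖B k j‖ := by
          refine Finset.sum_le_sum fun k _ => ?_
          rw [norm_mul]
          gcongr
          exact hS w hw i k
      _ = C / (1 + ‖w‖) * ∑ k, ‖B k j‖ := by rw [Finset.mul_sum]
      _ ≤ _ := by
          gcongr
          have : ∑ k, ‖B k j‖ ≤ ∑ k, ∑ j, ‖B k j‖ := Finset.sum_le_sum fun k _ =>
            Finset.single_le_sum (f := fun j => ‖B k j‖) (fun _ _ => norm_nonneg _)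
              (Finset.mem_univ j)
          linarith
  rw [add_comm 1 w]
  calc _ ≤ ((‖w‖ + 1) / 3)⁻¹ * (C / (1 + ‖w‖) * b) := by gcongr
    _ = _ := by
      rw [add_comm ‖w‖ 1]
      field_simp

theorem differentiableAt_det {n : ℕ} {A : ℂ → Matrix (Fin n) (Fin n) ℂ} {w : ℂ}
    (h : ∀ i j, DifferentiableAt ℂ (fun w => A w i j) w) :
    DifferentiableAt ℂ (fun w => (A w).det) w := by
  simp only [Matrix.det_apply]
  exact DifferentiableAt.fun_sum fun σ _ => (DifferentiableAt.fun_finsetProd fun i _ => h _ _).const_smul _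

/-- Cramer's rule: the entries are rational in w, and the determinant does not vanish on the cone.
-/
theorem differentiableAt_solMat (q : ℕ) {α : ℝ} (hα : 0 < α) {w : ℂ} (hw : α * ‖w‖ ≤ w.re)
    (i j : Fin (q + 1)) : DifferentiableAt ℂ (fun w => solMat q w i j) w := by
  have hent : ∀ i j, DifferentiableAt ℂ (fun w => stepMat q w i j) w := fun i j => by
    simp only [stepMat, Matrix.add_apply, Matrix.smul_apply, smul_eq_mul]
    fun_prop
  have e : (fun w => solMat q w i j)
      = fun w => ((stepMat q w).det)⁻¹ * (stepMat q w).adjugate i j := by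
    funext w
    rw [solMat, Matrix.inv_def, Matrix.smul_apply, Ring.inverse_eq_inv', smul_eq_mul]
  rw [e]
  refine ((differentiableAt_det hent).inv (isUnit_stepMat q hα hw).ne_zero).mul ?_
  simp only [Matrix.adjugate_apply]
  refine differentiableAt_det fun a b => ?_
  simp only [Matrix.updateRow_apply]
  split_ifs
  · fun_prop
  · exact hent a b

end DGCG

namespace DGCG

/-! ### The solution operator over several time steps -/

/-- A product over steps of comparable size grows at least quadratically in the total length. -/
theorem prod_one_add_ge {k : ℕ → ℝ} {κ : ℝ} (hκ : 0 < κ) {l m : ℕ} (hlm : l + 1 ≤ m)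
    (hk : ∀ n, l ≤ n → n ≤ m → 0 < k n)
    (hr : ∀ n, l ≤ n → n < m → k n ≤ κ * k (n + 1) ∧ k (n + 1) ≤ κ * k n) {y : ℝ} (hy : 0 ≤ y) :
    1 + (∑ n ∈ Finset.Ico l (m + 1), k n) * y
        + 1 / (2 + 2 * κ) * (∑ n ∈ Finset.Ico l (m + 1), k n) ^ 2 * y ^ 2
      ≤ ∏ n ∈ Finset.Ico l (m + 1), (1 + k n * y) := by
  have hδ0 : 0 < 1 / (2 + 2 * κ) := by positivity
  have hδ : 1 / (2 + 2 * κ) * (2 + 2 * κ) = 1 := by field_simp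
  set δ := 1 / (2 + 2 * κ)
  induction m, hlm using Nat.le_induction with
  | base =>
    have e1 : ∑ n ∈ Finset.Ico l (l + 1 + 1), k n = k l + k (l + 1) := by
      rw [Finset.sum_Ico_succ_top (by omega), Finset.sum_Ico_succ_top (by omega)]; simp
    have e2 : ∏ n ∈ Finset.Ico l (l + 1 + 1), (1 + k n * y)
        = (1 + k l * y) * (1 + k (l + 1) * y) := by
      rw [Finset.prod_Ico_succ_top (by omega), Finset.prod_Ico_succ_top (by omega)]; simp
    rw [e1, e2]
    have ha := hk l le_rfl (by omega)
    have hb := hk (l + 1) (by omega) le_rfl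
    obtain ⟨h1, h2⟩ := hr l le_rfl (by omega)
    generalize k l = a at *
    generalize k (l + 1) = b at *
    -- Comparability gives a² ≤ κab and b² ≤ κab, hence (a + b)² ≤ (2 + 2κ)ab; this fixes δ. Two
    -- factors are the least number that can grow quadratically.
    have h3 : δ * (a + b) ^ 2 ≤ a * b := by
      have : (a + b) ^ 2 ≤ (2 + 2 * κ) * (a * b) := by nlinarith
      calc _ ≤ δ * ((2 + 2 * κ) * (a * b)) := by gcongr
        _ = _ := by rw [← mul_assoc, hδ, one_mul]
    have := mul_le_mul_of_nonneg_right h3 (sq_nonneg y)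
    nlinarith
  | succ m hlm ih =>
    have ih := ih (fun n h1 h2 => hk n h1 (by omega)) (fun n h1 h2 => hr n h1 (by omega))
    rw [Finset.sum_Ico_succ_top (by omega), Finset.prod_Ico_succ_top (by omega)]
    have hS : k m ≤ ∑ n ∈ Finset.Ico l (m + 1), k n :=
      Finset.single_le_sum (f := k) (fun n hn => (hk n (Finset.mem_Ico.1 hn).1
        (by have := (Finset.mem_Ico.1 hn).2; omega)).le) (Finset.mem_Ico.2 ⟨by omega, by omega⟩)
    have hb := hk (m + 1) (by omega) le_rfl
    have hm := hk m (by omega) (by omega)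
    have h2 := (hr m (by omega) (by omega)).2
    generalize ∑ n ∈ Finset.Ico l (m + 1), k n = S at *
    generalize k (m + 1) = b at *
    have hS0 : 0 < S := hm.trans_le hS
    have h3 : b ≤ κ * S := h2.trans (by gcongr)
    -- Only b ≤ κS is needed, so the same δ survives every step of the induction.
    have h4 : δ * (S + b) ^ 2 ≤ δ * S ^ 2 + b * S := by
      have : 2 * b * S + b ^ 2 ≤ (2 + 2 * κ) * (b * S) := by nlinarith [mul_pos hb hS0]
      have h5 : δ * (2 * b * S + b ^ 2) ≤ b * S := by
        calc _ ≤ δ * ((2 + 2 * κ) * (b * S)) := by gcongr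
          _ = _ := by rw [← mul_assoc, hδ, one_mul]
      nlinarith
    calc _ ≤ (1 + S * y + δ * S ^ 2 * y ^ 2) * (1 + b * y) := by
          have := mul_le_mul_of_nonneg_right h4 (sq_nonneg y)
          have h6 : 0 ≤ δ * S ^ 2 * y ^ 2 * (b * y) := by positivity
          nlinarith
      _ ≤ _ := by gcongr

/-- The value at the end of the step, as a function of the `j`-th moment of the data. -/
noncomputable def endFun (q : ℕ) (j : Fin (q + 1)) (w : ℂ) : ℂ := ∑ i, solMat q w i j

/-- The influence of the `j`-th moment of the data on the `l`-th interval on the `i`-th coefficient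
of the solution on the `m`-th interval. -/
noncomputable def kerFun (q : ℕ) (k : ℕ → ℝ) (l m : ℕ) (i j : Fin (q + 1)) (z : ℂ) : ℂ :=
  solMat q (k m * z) i 0 * (∏ n ∈ Finset.Ico (l + 1) m, stabFun q (k n * z))
    * endFun q j (k l * z)

theorem mul_mem_cone {α k : ℝ} (hk : 0 < k) {z : ℂ} (hz : α * ‖z‖ ≤ z.re) :
    α * ‖(k : ℂ) * z‖ ≤ ((k : ℂ) * z).re := by
  rw [norm_mul, Complex.norm_real, Real.norm_of_nonneg hk.le, Complex.re_ofReal_mul]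
  calc _ = k * (α * ‖z‖) := by ring
    _ ≤ _ := by gcongr

theorem norm_ofReal_mul {k : ℝ} (hk : 0 < k) (z : ℂ) : ‖(k : ℂ) * z‖ = k * ‖z‖ := by
  rw [norm_mul, Complex.norm_real, Real.norm_of_nonneg hk.le]

/-- One factor 1/(1 + k_n y), with y = c|z|, comes from each interval: from the solution matrix at
both ends and from the stability function in between. As l < m there are at least two, so
`prod_one_add_ge` yields quadratic decay on the scale of the total length. -/
theorem exists_kerFun_bound (q : ℕ) {α κ : ℝ} (hα : 0 < α) (hκ : 0 < κ) :
    ∃ K a, 0 < K ∧ 0 < a ∧ ∀ (k : ℕ → ℝ) (l m : ℕ), l < m → (∀ n, l ≤ n → n ≤ m → 0 < k n) →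
      (∀ n, l ≤ n → n < m → k n ≤ κ * k (n + 1) ∧ k (n + 1) ≤ κ * k n) →
      ∀ (i j : Fin (q + 1)) (z : ℂ), α * ‖z‖ ≤ z.re →
        ‖kerFun q k l m i j z‖
          ≤ K / (1 + (a * (∑ n ∈ Finset.Ico l (m + 1), k n) * ‖z‖) ^ 2) := by
  obtain ⟨C, hC, hS⟩ := exists_solMat_bound q hα
  obtain ⟨c, hc, hc1, hR⟩ := exists_stabFun_bound q hα
  set δ : ℝ := 1 / (2 + 2 * κ)
  have hδ : 0 < δ := by positivity
  set n₀ : ℝ := ((q + 1 : ℕ) : ℝ)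
  refine ⟨C * (n₀ * C), Real.sqrt δ * c, by positivity, by positivity,
    fun k l m hlm hk hr i j z hz => ?_⟩
  set y : ℝ := c * ‖z‖
  have hy : 0 ≤ y := by positivity
  have hkm := hk m (by omega) le_rfl
  have hkl := hk l le_rfl (by omega)
  have h1 : ‖solMat q (k m * z) i 0‖ ≤ C / (1 + k m * y) := by
    refine (hS _ (mul_mem_cone hkm hz) i 0).trans ?_
    rw [norm_ofReal_mul hkm]
    have : y ≤ ‖z‖ := mul_le_of_le_one_left (norm_nonneg z) hc1
    gcongr
  have h2 : ‖endFun q j (k l * z)‖ ≤ n₀ * C / (1 + k l * y) := by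
    have : y ≤ ‖z‖ := mul_le_of_le_one_left (norm_nonneg z) hc1
    refine (norm_sum_le _ _).trans ((Finset.sum_le_card_nsmul _ _ (C / (1 + k l * y))
      fun i _ => ?_).trans ?_)
    · refine (hS _ (mul_mem_cone hkl hz) i j).trans ?_
      rw [norm_ofReal_mul hkl]
      gcongr
    · simp [n₀, mul_div_assoc]
  have h3 : ‖∏ n ∈ Finset.Ico (l + 1) m, stabFun q (k n * z)‖
      ≤ 1 / ∏ n ∈ Finset.Ico (l + 1) m, (1 + k n * y) := by
    rw [norm_prod, one_div, ← Finset.prod_inv_distrib]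
    refine Finset.prod_le_prod (fun _ _ => norm_nonneg _) fun n hn => ?_
    rw [Finset.mem_Ico] at hn
    have hkn := hk n (by omega) (by omega)
    refine (hR _ (mul_mem_cone hkn hz)).trans ?_
    rw [norm_ofReal_mul hkn, one_div]
    refine le_of_eq ?_
    congr 1
    ring
  have h4 := prod_one_add_ge hκ hlm hk hr hy
  have e4 : ∏ n ∈ Finset.Ico l (m + 1), (1 + k n * y)
      = (1 + k l * y) * (∏ n ∈ Finset.Ico (l + 1) m, (1 + k n * y)) * (1 + k m * y) := by
    rw [Finset.prod_Ico_succ_top (by omega), Finset.prod_eq_prod_Ico_succ_bot (by omega)]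
  have hpos : 0 < ∏ n ∈ Finset.Ico (l + 1) m, (1 + k n * y) := by
    refine Finset.prod_pos fun n hn => ?_
    rw [Finset.mem_Ico] at hn
    have hkn := hk n (by omega) (by omega)
    positivity
  have hτ : 0 ≤ ∑ n ∈ Finset.Ico l (m + 1), k n := Finset.sum_nonneg fun n hn => by
    rw [Finset.mem_Ico] at hn
    exact (hk n (by omega) (by omega)).le
  rw [e4] at h4
  have h5 : 1 + (Real.sqrt δ * c * (∑ n ∈ Finset.Ico l (m + 1), k n) * ‖z‖) ^ 2
      ≤ (1 + k l * y) * (∏ n ∈ Finset.Ico (l + 1) m, (1 + k n * y)) * (1 + k m * y) := by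
    refine le_trans ?_ h4
    have e5 : (Real.sqrt δ * c * (∑ n ∈ Finset.Ico l (m + 1), k n) * ‖z‖) ^ 2
        = δ * (∑ n ∈ Finset.Ico l (m + 1), k n) ^ 2 * y ^ 2 := by
      simp only [mul_pow, y, Real.sq_sqrt hδ.le]; ring
    rw [e5]
    have := mul_nonneg hτ hy
    linarith
  rw [kerFun, norm_mul, norm_mul]
  calc _ ≤ C / (1 + k m * y) * (1 / ∏ n ∈ Finset.Ico (l + 1) m, (1 + k n * y))
        * (n₀ * C / (1 + k l * y)) := by gcongr
    _ = C * (n₀ * C) / ((1 + k l * y) * (∏ n ∈ Finset.Ico (l + 1) m, (1 + k n * y))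
        * (1 + k m * y)) := by field_simp
    _ ≤ _ := by gcongr

theorem differentiableAt_solMat_comp (q : ℕ) {α k : ℝ} (hα : 0 < α) (hk : 0 < k) {z : ℂ}
    (hz : α * ‖z‖ ≤ z.re) (i j : Fin (q + 1)) :
    DifferentiableAt ℂ (fun z => solMat q (k * z) i j) z :=
  DifferentiableAt.comp (f := fun z : ℂ => (k : ℂ) * z) z
    (differentiableAt_solMat q hα (mul_mem_cone hk hz) i j) (by fun_prop)

theorem differentiableAt_kerFun (q : ℕ) {α : ℝ} (hα : 0 < α) {k : ℕ → ℝ} {l m : ℕ} (hlm : l < m)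
    (hk : ∀ n, l ≤ n → n ≤ m → 0 < k n) (i j : Fin (q + 1)) {z : ℂ} (hz : α * ‖z‖ ≤ z.re) :
    DifferentiableAt ℂ (kerFun q k l m i j) z := by
  refine DifferentiableAt.mul (DifferentiableAt.mul ?_ ?_) ?_
  · exact differentiableAt_solMat_comp q hα (hk m hlm.le le_rfl) hz i 0
  · refine DifferentiableAt.fun_finsetProd fun n hn => ?_
    rw [Finset.mem_Ico] at hn
    exact DifferentiableAt.fun_sum fun i _ =>
      differentiableAt_solMat_comp q hα (hk n (by omega) (by omega)) hz i 0
  · exact DifferentiableAt.fun_sum fun i _ =>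
      differentiableAt_solMat_comp q hα (hk l le_rfl (by omega)) hz i j

section operators

variable {V : Type*} [NormedAddCommGroup V] [NormedSpace ℂ V] {ι : Type*} [Fintype ι]
  {e : Module.Basis ι ℂ V} {ev : ι → ℝ} {N : Seminorm ℂ V} {γ M : ℝ}

/-- kz/(1 + kz) = 1 + k⁻¹(-k⁻¹ - z)⁻¹, so one resolvent at the negative point -1/k, whose argument π
exceeds γ, is enough. -/
theorem opFun_div_one_add_bound (hev : ∀ i, 0 ≤ ev i) (hres : ResolventBound e ev N γ M)
    (hγ : γ < Real.pi) {k : ℝ} (hk : 0 < k) (v : V) :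
    N (opFun e ev (fun z => k * z * (1 + k * z)⁻¹) v) ≤ (1 + M) * N v := by
  have hk' : (k : ℂ) ≠ 0 := by exact_mod_cast hk.ne'
  have h1 : opFun e ev (fun z => k * z * (1 + k * z)⁻¹) v
      = v + ((k : ℂ)⁻¹) • opFun e ev (fun w => ((-k⁻¹ : ℝ) - w)⁻¹) v := by
    conv_rhs => lhs; rw [← e.sum_repr v]
    rw [opFun_apply, opFun_apply, Finset.smul_sum, ← Finset.sum_add_distrib]
    refine Finset.sum_congr rfl fun i _ => ?_
    rw [smul_smul, ← add_smul]
    congr 1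
    have h2 : (1 + k * ev i : ℂ) ≠ 0 := by
      have : 0 < 1 + k * ev i := by have := hev i; positivity
      exact_mod_cast this.ne'
    have h3 : ((-k⁻¹ : ℝ) - ev i : ℂ) = -(k : ℂ)⁻¹ * (1 + k * ev i) := by
      push_cast
      field_simp
      ring
    rw [h3]
    field_simp
    ring
  have h2 := hres (-k⁻¹ : ℝ) (by
    rw [Complex.arg_ofReal_of_neg (by simpa using hk), abs_of_pos Real.pi_pos]
    exact not_le.2 hγ) v
  rw [Complex.norm_real, norm_neg, Real.norm_of_nonneg (by positivity), div_inv_eq_mul] at h2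
  rw [h1]
  refine (map_add_le_add N _ _).trans ?_
  rw [map_smul_eq_mul, norm_inv, Complex.norm_real, Real.norm_of_nonneg hk.le]
  calc _ ≤ N v + k⁻¹ * (M * k * N v) := by gcongr
    _ = _ := by field_simp

end operators

/-- The Dunford bound with scale a τ: smoothing over the elapsed length τ costs the factor 1/τ,
uniformly in the mesh. -/
theorem exists_opFun_kerFun_bound (q : ℕ) {θ κ : ℝ} (hθ : 0 < θ) (hθ' : θ < Real.pi / 2)
    (hκ : 0 < κ) : ∃ C, 0 < C ∧ ∀ {V : Type} [NormedAddCommGroup V] [NormedSpace ℂ V]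
      [FiniteDimensional ℂ V] {ι : Type} [Fintype ι] {e : Module.Basis ι ℂ V} {ev : ι → ℝ}
      {N : Seminorm ℂ V} {γ M : ℝ}, (∀ i, 0 ≤ ev i) → ResolventBound e ev N γ M → γ < θ →
      ∀ (k : ℕ → ℝ) (l m : ℕ), l < m → (∀ n, l ≤ n → n ≤ m → 0 < k n) →
      (∀ n, l ≤ n → n < m → k n ≤ κ * k (n + 1) ∧ k (n + 1) ≤ κ * k n) →
      ∀ (i j : Fin (q + 1)) (v : V), N (opFun e ev (fun z => z * kerFun q k l m i j z) v)
        ≤ C * M * (1 / ∑ n ∈ Finset.Ico l (m + 1), k n) * N v := by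
  have hα : 0 < Real.cos θ := Real.cos_pos_of_mem_Ioo ⟨by linarith, hθ'⟩
  obtain ⟨K, a, hK, ha, h⟩ := exists_kerFun_bound q hα hκ
  refine ⟨K / (2 * a), by positivity, ?_⟩
  intro V _ _ _ ι _ e ev N γ M hev hres hγθ k l m hlm hk hr i j v
  have hτ : 0 < ∑ n ∈ Finset.Ico l (m + 1), k n := Finset.sum_pos (fun n hn => by
    rw [Finset.mem_Ico] at hn
    exact hk n (by omega) (by omega)) ⟨l, Finset.mem_Ico.2 ⟨le_rfl, by omega⟩⟩
  have := opFun_bound hev hres hθ hγθ hθ' (mul_pos ha hτ)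
    (fun z hz => differentiableAt_kerFun q hα hlm hk i j hz.2)
    (fun z hz => h k l m hlm hk hr i j z hz.2) v
  refine this.trans (le_of_eq ?_)
  field_simp

/-- The symbol tends to an entry of G⁻¹ at infinity, so the Dunford bound does not apply to it
directly. The remainder `remMat` decays quadratically, and the scale k cancels. The hypothesis on M
absorbs 1 + M into 3M. -/
theorem exists_opFun_solMat_bound (q : ℕ) {θ : ℝ} (hθ : 0 < θ) (hθ' : θ < Real.pi / 2) :
    ∃ C, 0 < C ∧ ∀ {V : Type} [NormedAddCommGroup V] [NormedSpace ℂ V]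
      [FiniteDimensional ℂ V] {ι : Type} [Fintype ι] {e : Module.Basis ι ℂ V} {ev : ι → ℝ}
      {N : Seminorm ℂ V} {γ M : ℝ}, (∀ i, 0 ≤ ev i) → ResolventBound e ev N γ M → γ < θ →
      1 / 2 ≤ M → ∀ (k : ℝ), 0 < k → ∀ (i j : Fin (q + 1)) (v : V),
        N (opFun e ev (fun z => k * z * solMat q (k * z) i j) v) ≤ C * M * N v := by
  have hα : 0 < Real.cos θ := Real.cos_pos_of_mem_Ioo ⟨by linarith, hθ'⟩
  obtain ⟨K, hK, h⟩ := exists_remMat_bound q hα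
  set B : ℝ := ∑ i, ∑ j, ‖(massMat (q + 1))⁻¹ i j‖ with hB
  have hB0 : 0 ≤ B := by positivity
  refine ⟨K / 2 + 3 * B, by positivity, ?_⟩
  intro V _ _ _ ι _ e ev N γ M hev hres hγθ hM k hk i j v
  have hBij : ‖(massMat (q + 1))⁻¹ i j‖ ≤ B :=
    (Finset.single_le_sum (f := fun j => ‖(massMat (q + 1))⁻¹ i j‖) (fun _ _ => norm_nonneg _)
      (Finset.mem_univ j)).trans (Finset.single_le_sum
        (f := fun i => ∑ j, ‖(massMat (q + 1))⁻¹ i j‖)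
        (fun _ _ => Finset.sum_nonneg fun _ _ => norm_nonneg _) (Finset.mem_univ i))
  have e1 : opFun e ev (fun z => k * z * solMat q (k * z) i j) v
      = opFun e ev (fun z => z * (k * remMat q (k * z) i j)) v
        + (massMat (q + 1))⁻¹ i j • opFun e ev (fun z => k * z * (1 + k * z)⁻¹) v := by
    rw [opFun_apply, opFun_apply, opFun_apply, Finset.smul_sum, ← Finset.sum_add_distrib]
    refine Finset.sum_congr rfl fun p _ => ?_
    rw [smul_smul, ← add_smul]
    congr 1
    simp only [remMat, Matrix.sub_apply, Matrix.smul_apply, smul_eq_mul]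
    ring
  have b1 : N (opFun e ev (fun z => z * (k * remMat q (k * z) i j)) v) ≤ M * (K / 2) * N v := by
    have := opFun_bound (K := k * K) (a := k) hev hres hθ hγθ hθ' hk
      (g := fun z => k * remMat q (k * z) i j) (fun z hz => ?_) (fun z hz => ?_) v
    · refine this.trans (le_of_eq ?_)
      field_simp
    · simp only [remMat, Matrix.sub_apply, Matrix.smul_apply, smul_eq_mul]
      have h0 := re_nonneg_of_mem_sector hθ hθ' hz
      have hne : 1 + (k : ℂ) * z ≠ 0 := fun h => by
        have h3 := congrArg Complex.re h
        simp at h3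
        have : 0 < k * z.re := by positivity
        linarith
      have h1 := differentiableAt_solMat_comp q hα hk hz.2 i j
      have h2 : DifferentiableAt ℂ (fun z : ℂ => (1 + (k : ℂ) * z)⁻¹) z :=
        DifferentiableAt.inv (by fun_prop) hne
      exact (h1.sub (h2.mul_const _)).const_mul _
    · rw [norm_ofReal_mul hk]
      have h1 := h _ (mul_mem_cone hk hz.2) i j
      rw [norm_ofReal_mul hk] at h1
      rw [mul_div_assoc]
      refine mul_le_mul_of_nonneg_left (h1.trans ?_) hk.le
      have : 0 ≤ k * ‖z‖ := by positivity
      gcongr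
      nlinarith
  have b2 := opFun_div_one_add_bound hev hres (hγθ.trans (by linarith [Real.pi_pos])) hk v
  rw [e1]
  refine (map_add_le_add N _ _).trans ?_
  rw [map_smul_eq_mul]
  have hN : 0 ≤ N v := apply_nonneg N v
  calc _ ≤ M * (K / 2) * N v + B * ((1 + M) * N v) := by gcongr
    _ ≤ M * (K / 2) * N v + B * ((3 * M) * N v) := by gcongr; linarith
    _ = _ := by ring

end DGCG

namespace DGCG

theorem seminorm_sum_le {V : Type*} [AddCommGroup V] [Module ℂ V] (N : Seminorm ℂ V) {α : Type*}
    (s : Finset α) (f : α → V) : N (∑ i ∈ s, f i) ≤ ∑ i ∈ s, N (f i) :=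
  Finset.le_sum_of_subadditive N (map_zero N).le (map_add_le_add N) s f

/-! ### The equations of the dG(q) method in local coordinates -/

/-- The value at the beginning of the `m`-th step, coming from the previous step. -/
def prevVal {V : Type*} [AddCommMonoid V] {q : ℕ} (U : ℕ → Fin (q + 1) → V) : ℕ → V
  | 0 => 0
  | m + 1 => ∑ j, U m j

/-- The coefficients `U` (in the local monomial basis) solve the equations of the dG(q) method for
`u' + A u = f`, where `F m i` is the `i`-th moment of the data on the `m`-th interval. -/
def StepEquations {V : Type*} [AddCommGroup V] [Module ℂ V] (q : ℕ) (A : V →ₗ[ℂ] V) (k : ℕ → ℝ)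
    (n : ℕ) (U F : ℕ → Fin (q + 1) → V) : Prop :=
  ∀ m < n, ∀ i, (∑ j, dgMat q i j • U m j) + (k m : ℂ) • ∑ j, massMat (q + 1) i j • A (U m j)
    = (if i = 0 then (1 : ℂ) else 0) • prevVal U m + (k m : ℂ) • F m i

section scalar

variable {q : ℕ} {k : ℕ → ℝ} {n : ℕ} {μ : ℝ} {x f : ℕ → Fin (q + 1) → ℂ}

theorem scalar_step (hμ : 0 ≤ μ) (hk : ∀ m < n, 0 < k m)
    (h : StepEquations q ((μ : ℂ) • (LinearMap.id : ℂ →ₗ[ℂ] ℂ)) k n x f) {m : ℕ} (hm : m < n)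
    (i : Fin (q + 1)) :
    x m i = solMat q (k m * μ) i 0 * prevVal x m
      + k m * ∑ j, solMat q (k m * μ) i j * f m j := by
  have hkm := hk m hm
  have hw : 1 * ‖(k m : ℂ) * μ‖ ≤ ((k m : ℂ) * μ).re := by
    rw [← Complex.ofReal_mul, Complex.norm_real, Real.norm_of_nonneg (by positivity), one_mul,
      Complex.ofReal_re]
  have h1 : (stepMat q (k m * μ)).mulVec (x m)
      = prevVal x m • Pi.single 0 1 + (k m : ℂ) • f m := by
    funext i
    have := h m hm i
    simp only [LinearMap.smul_apply, LinearMap.id_apply, smul_eq_mul] at this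
    simp only [Pi.add_apply, Pi.smul_apply, Pi.single_apply, smul_eq_mul]
    rw [mul_comm (prevVal x m), ← this, stepMat, Matrix.add_mulVec, Matrix.smul_mulVec]
    simp only [Pi.add_apply, Pi.smul_apply, Matrix.mulVec, dotProduct, smul_eq_mul, Finset.mul_sum]
    congr 1
    refine Finset.sum_congr rfl fun j _ => by ring
  have h2 : x m = (solMat q (k m * μ)).mulVec (prevVal x m • Pi.single 0 1 + (k m : ℂ) • f m) := by
    rw [← h1, Matrix.mulVec_mulVec, solMat,
      Matrix.nonsing_inv_mul _ (isUnit_stepMat q one_pos hw), Matrix.one_mulVec]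
  have h3 := congrFun h2 i
  rw [h3, Matrix.mulVec_add, Matrix.mulVec_smul, Matrix.mulVec_smul]
  simp [Matrix.mulVec, dotProduct, mul_comm]

/-- Discrete Duhamel formula: the end value produced on the l-th interval is carried on by the
stability functions of the intervals strictly between l and m. -/
theorem scalar_prevVal (hμ : 0 ≤ μ) (hk : ∀ m < n, 0 < k m)
    (h : StepEquations q ((μ : ℂ) • (LinearMap.id : ℂ →ₗ[ℂ] ℂ)) k n x f) {m : ℕ} (hm : m ≤ n) :
    prevVal x m = ∑ l ∈ Finset.range m, (∏ p ∈ Finset.Ico (l + 1) m, stabFun q (k p * μ))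
      * (k l * ∑ j, endFun q j (k l * μ) * f l j) := by
  induction m with
  | zero => simp [prevVal]
  | succ m ih =>
    have ih := ih (by omega)
    have e1 : prevVal x (m + 1) = stabFun q (k m * μ) * prevVal x m
        + k m * ∑ j, endFun q j (k m * μ) * f m j := by
      rw [prevVal]
      simp only [scalar_step hμ hk h (show m < n by omega)]
      rw [Finset.sum_add_distrib, ← Finset.sum_mul, ← Finset.mul_sum, Finset.sum_comm]
      simp only [stabFun, endFun, Finset.sum_mul]
    rw [e1, ih, Finset.sum_range_succ, Finset.mul_sum]
    congr 1
    · refine Finset.sum_congr rfl fun l hl => ?_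
      rw [Finset.mem_range] at hl
      rw [Finset.prod_Ico_succ_top (by omega)]
      ring
    · simp

end scalar

section operators

variable {q : ℕ} {V : Type*} [NormedAddCommGroup V] [NormedSpace ℂ V] {ι : Type*}
  {e : Module.Basis ι ℂ V} {ev : ι → ℝ} {k : ℕ → ℝ} {n : ℕ} {U F : ℕ → Fin (q + 1) → V}

theorem repr_prevVal (p : ι) (m : ℕ) :
    e.repr (prevVal U m) p = prevVal (fun m j => e.repr (U m j) p) m := by
  cases m with
  | zero => simp [prevVal]
  | succ m => simp [prevVal, map_sum, Finsupp.finsetSum_apply]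

variable [Fintype ι]

theorem StepEquations.repr (h : StepEquations q (opFun e ev id) k n U F) (p : ι) :
    StepEquations q ((ev p : ℂ) • (LinearMap.id : ℂ →ₗ[ℂ] ℂ)) k n
      (fun m j => e.repr (U m j) p) (fun m j => e.repr (F m j) p) := by
  intro m hm i
  have := congrArg (fun v => e.repr v p) (h m hm i)
  simp only [map_add, map_smul, map_sum, Finsupp.add_apply, Finsupp.smul_apply,
    Finsupp.finsetSum_apply, repr_opFun, repr_prevVal, id] at this
  exact this

/-- The representation of `A u` by the data. -/
theorem StepEquations.apply_eq (hev : ∀ i, 0 ≤ ev i) (hk : ∀ m < n, 0 < k m)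
    (h : StepEquations q (opFun e ev id) k n U F) {m : ℕ} (hm : m < n) (i : Fin (q + 1)) :
    opFun e ev id (U m i)
      = (∑ l ∈ Finset.range m, (k l : ℂ) •
          ∑ j, opFun e ev (fun z => z * kerFun q k l m i j z) (F l j))
        + ∑ j, opFun e ev (fun z => k m * z * solMat q (k m * z) i j) (F m j) := by
  refine e.ext_elem fun p => ?_
  simp only [map_add, map_smul, map_sum, Finsupp.add_apply, Finsupp.smul_apply,
    Finsupp.finsetSum_apply, repr_opFun, id, smul_eq_mul]
  have h1 := scalar_step (hev p) hk (h.repr p) hm i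
  have h2 := scalar_prevVal (hev p) hk (h.repr p) hm.le
  rw [h1, h2, mul_add]
  congr 1
  · rw [Finset.mul_sum, Finset.mul_sum]
    refine Finset.sum_congr rfl fun l _ => ?_
    simp only [Finset.mul_sum, kerFun]
    refine Finset.sum_congr rfl fun j _ => ?_
    ring
  · simp only [Finset.mul_sum]
    refine Finset.sum_congr rfl fun j _ => ?_
    ring

end operators

/-- The weight with which the data on the `l`-th interval enter on the `m`-th interval. -/
noncomputable def stepWeight (k : ℕ → ℝ) (l m : ℕ) : ℝ := k l / ∑ n ∈ Finset.Ico l (m + 1), k n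

theorem stepWeight_self {k : ℕ → ℝ} {m : ℕ} (hk : 0 < k m) : stepWeight k m m = 1 := by
  simp [stepWeight, hk.ne']

theorem stepWeight_nonneg {k : ℕ → ℝ} {l m : ℕ} (hk : ∀ n ≤ m, 0 < k n) (hlm : l ≤ m) :
    0 ≤ stepWeight k l m :=
  div_nonneg (hk l hlm).le (Finset.sum_nonneg fun n hn => by
    rw [Finset.mem_Ico] at hn
    exact (hk n (by omega)).le)

/-- History terms are weighted by k_l times the kernel bound 1/τ; the local term fits the same
pattern, because the diagonal weight is 1. -/
theorem exists_apply_bound (q : ℕ) {θ κ : ℝ} (hθ : 0 < θ) (hθ' : θ < Real.pi / 2)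
    (hκ : 0 < κ) : ∃ C, 0 < C ∧ ∀ {V : Type} [NormedAddCommGroup V] [NormedSpace ℂ V]
      [FiniteDimensional ℂ V] {ι : Type} [Fintype ι] {e : Module.Basis ι ℂ V} {ev : ι → ℝ}
      {N : Seminorm ℂ V} {γ M : ℝ}, (∀ i, 0 ≤ ev i) → ResolventBound e ev N γ M → γ < θ →
      1 / 2 ≤ M → ∀ (k : ℕ → ℝ) (n : ℕ), (∀ m < n, 0 < k m) →
      (∀ m, m + 1 < n → k m ≤ κ * k (m + 1) ∧ k (m + 1) ≤ κ * k m) →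
      ∀ (U F : ℕ → Fin (q + 1) → V), StepEquations q (opFun e ev id) k n U F →
      ∀ m < n, ∀ i, N (opFun e ev id (U m i))
        ≤ C * M * ∑ l ∈ Finset.range (m + 1), stepWeight k l m * ∑ j, N (F l j) := by
  obtain ⟨C₁, hC₁, h1⟩ := exists_opFun_kerFun_bound q hθ hθ' hκ
  obtain ⟨C₂, hC₂, h2⟩ := exists_opFun_solMat_bound q hθ hθ'
  refine ⟨C₁ + C₂, by positivity, ?_⟩
  intro V _ _ _ ι _ e ev N γ M hev hres hγθ hM k n hk hr U F h m hm i
  have hM0 : 0 ≤ M := by linarith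
  have hS : ∀ l, 0 ≤ ∑ j, N (F l j) := fun l => Finset.sum_nonneg fun j _ => apply_nonneg N _
  rw [h.apply_eq hev hk hm i, Finset.sum_range_succ, mul_add]
  refine (map_add_le_add N _ _).trans (add_le_add ?_ ?_)
  · refine (seminorm_sum_le N _ _).trans ?_
    rw [Finset.mul_sum]
    refine Finset.sum_le_sum fun l hl => ?_
    rw [Finset.mem_range] at hl
    have hkl := hk l (by omega)
    rw [map_smul_eq_mul, Complex.norm_real, Real.norm_of_nonneg hkl.le]
    have e1 : N (∑ j, opFun e ev (fun z => z * kerFun q k l m i j z) (F l j))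
        ≤ C₁ * M * (1 / ∑ p ∈ Finset.Ico l (m + 1), k p) * ∑ j, N (F l j) := by
      refine (seminorm_sum_le N _ _).trans ?_
      rw [Finset.mul_sum]
      exact Finset.sum_le_sum fun j _ => h1 hev hres hγθ k l m hl
        (fun p _ hp => hk p (by omega)) (fun p _ hp => hr p (by omega)) i j _
    have hw := stepWeight_nonneg (fun p hp => hk p (by omega)) hl.le
    calc _ ≤ k l * (C₁ * M * (1 / ∑ p ∈ Finset.Ico l (m + 1), k p) * ∑ j, N (F l j)) := by gcongr
      _ = C₁ * M * (stepWeight k l m * ∑ j, N (F l j)) := by rw [stepWeight]; ring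
      _ ≤ _ := by
        have := mul_nonneg hw (hS l)
        gcongr
        linarith
  · rw [stepWeight_self (hk m hm), one_mul]
    calc _ ≤ C₂ * M * ∑ j, N (F m j) := by
          refine (seminorm_sum_le N _ _).trans ?_
          rw [Finset.mul_sum]
          exact Finset.sum_le_sum fun j _ => h2 hev hres hγθ hM (k m) (hk m hm) i j _
      _ ≤ _ := by
        have := hS m
        gcongr
        linarith

/-- The jump (in the place `0`) and the nonconstant coefficients, which determine `∂_t u`. -/
def jumpCoeff {V : Type*} [AddCommGroup V] {q : ℕ} (U : ℕ → Fin (q + 1) → V) (m : ℕ)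
    (i : Fin (q + 1)) : V := U m i - if i = 0 then prevVal U m else 0

/-- The equations read D·(jump coefficients) = k(F - G A U), and D is invertible. Dividing by k thus
bounds jumps and time derivatives by quantities already estimated. -/
theorem StepEquations.jumpCoeff_eq {V : Type*} [AddCommGroup V] [Module ℂ V] {q : ℕ}
    {A : V →ₗ[ℂ] V} {k : ℕ → ℝ} {n : ℕ} {U F : ℕ → Fin (q + 1) → V}
    (h : StepEquations q A k n U F) {m : ℕ} (hm : m < n) (i : Fin (q + 1)) :
    jumpCoeff U m i = (k m : ℂ) • ∑ j, (dgMat q)⁻¹ i j •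
      (F m j - ∑ l, massMat (q + 1) j l • A (U m l)) := by
  have h1 : ∀ j, ∑ l, dgMat q j l • jumpCoeff U m l
      = (k m : ℂ) • (F m j - ∑ l, massMat (q + 1) j l • A (U m l)) := by
    intro j
    have h2 : ∑ l, dgMat q j l • jumpCoeff U m l
        = (∑ l, dgMat q j l • U m l) - (if j = 0 then (1 : ℂ) else 0) • prevVal U m := by
      simp only [jumpCoeff, smul_sub, Finset.sum_sub_distrib]
      congr 1
      -- Column 0 of D is the first unit vector, so subtracting the old value from coefficient 0
      -- subtracts it from equation 0 only.
      rw [Finset.sum_eq_single 0]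
      · simp [dgMat]
      · intro b _ hb; simp [hb]
      · simp
    rw [h2, smul_sub, sub_eq_sub_iff_add_eq_add, h m hm j, add_comm]
  calc jumpCoeff U m i = ∑ l, (1 : Matrix (Fin (q + 1)) (Fin (q + 1)) ℂ) i l • jumpCoeff U m l := by
        simp [Matrix.one_apply]
    _ = ∑ j, (dgMat q)⁻¹ i j • ∑ l, dgMat q j l • jumpCoeff U m l := by
        rw [← Matrix.nonsing_inv_mul _ (isUnit_dgMat q)]
        simp only [Matrix.mul_apply, Finset.sum_smul, Finset.smul_sum, smul_smul]
        exact Finset.sum_comm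
    _ = _ := by
        simp only [h1, Finset.smul_sum, smul_smul]
        exact Finset.sum_congr rfl fun j _ => by rw [mul_comm]

theorem exists_jumpCoeff_bound (q : ℕ) {θ κ : ℝ} (hθ : 0 < θ) (hθ' : θ < Real.pi / 2)
    (hκ : 0 < κ) : ∃ C, 0 < C ∧ ∀ {V : Type} [NormedAddCommGroup V] [NormedSpace ℂ V]
      [FiniteDimensional ℂ V] {ι : Type} [Fintype ι] {e : Module.Basis ι ℂ V} {ev : ι → ℝ}
      {N : Seminorm ℂ V} {γ M : ℝ}, (∀ i, 0 ≤ ev i) → ResolventBound e ev N γ M → γ < θ →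
      1 / 2 ≤ M → ∀ (k : ℕ → ℝ) (n : ℕ), (∀ m < n, 0 < k m) →
      (∀ m, m + 1 < n → k m ≤ κ * k (m + 1) ∧ k (m + 1) ≤ κ * k m) →
      ∀ (U F : ℕ → Fin (q + 1) → V), StepEquations q (opFun e ev id) k n U F →
      ∀ m < n, ∀ i,
        N (opFun e ev id (U m i))
          ≤ C * M * ∑ l ∈ Finset.range (m + 1), stepWeight k l m * ∑ j, N (F l j) ∧
        N (jumpCoeff U m i)
          ≤ k m * (C * M * ∑ l ∈ Finset.range (m + 1), stepWeight k l m * ∑ j, N (F l j)) := by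
  obtain ⟨C, hC, h1⟩ := exists_apply_bound q hθ hθ' hκ
  set B : ℝ := ∑ i, ∑ j, ‖(dgMat q)⁻¹ i j‖
  set G : ℝ := ∑ i, ∑ j, ‖massMat (q + 1) i j‖
  have hB0 : 0 ≤ B := by positivity
  have hG0 : 0 ≤ G := by positivity
  refine ⟨C + B * (2 + G * C), by positivity, ?_⟩
  intro V _ _ _ ι _ e ev N γ M hev hres hγθ hM k n hk hr U F h m hm i
  have hM0 : 0 < M := by linarith
  have hS : ∀ l, 0 ≤ ∑ j, N (F l j) := fun l => Finset.sum_nonneg fun j _ => apply_nonneg N _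
  have hterm : ∀ l ∈ Finset.range (m + 1), 0 ≤ stepWeight k l m * ∑ j, N (F l j) := fun l hl =>
    mul_nonneg (stepWeight_nonneg (fun p hp => hk p (by omega))
      (by rw [Finset.mem_range] at hl; omega)) (hS l)
  set W : ℝ := ∑ l ∈ Finset.range (m + 1), stepWeight k l m * ∑ j, N (F l j) with hW
  have hW0 : 0 ≤ W := Finset.sum_nonneg hterm
  have hA := fun i => h1 hev hres hγθ hM k n hk hr U F h m hm i
  rw [← hW] at hA
  have hF : ∀ j, N (F m j) ≤ W := by
    intro j
    have e1 := Finset.single_le_sum hterm (Finset.mem_range.2 (Nat.lt_succ_self m))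
    rw [stepWeight_self (hk m hm), one_mul] at e1
    exact (Finset.single_le_sum (f := fun j => N (F m j)) (fun _ _ => apply_nonneg N _)
      (Finset.mem_univ j)).trans e1
  refine ⟨(hA i).trans ?_, ?_⟩
  · gcongr
    exact le_add_of_nonneg_right (by positivity)
  have hrow : ∀ (n : ℕ) (X : Matrix (Fin n) (Fin n) ℂ) (i : Fin n),
      ∑ j, ‖X i j‖ ≤ ∑ i, ∑ j, ‖X i j‖ := fun n X i =>
    Finset.single_le_sum (f := fun i => ∑ j, ‖X i j‖)
      (fun _ _ => Finset.sum_nonneg fun _ _ => norm_nonneg _) (Finset.mem_univ i)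
  rw [h.jumpCoeff_eq hm i, map_smul_eq_mul, Complex.norm_real, Real.norm_of_nonneg (hk m hm).le]
  have hin : ∀ j, N (F m j - ∑ l, massMat (q + 1) j l • opFun e ev id (U m l))
      ≤ (2 + G * C) * M * W := by
    intro j
    refine (map_sub_le_add N _ _).trans ?_
    have e1 : N (∑ l, massMat (q + 1) j l • opFun e ev id (U m l)) ≤ G * (C * M * W) := by
      refine (seminorm_sum_le N _ _).trans ?_
      calc _ ≤ ∑ l, ‖massMat (q + 1) j l‖ * (C * M * W) := by
            refine Finset.sum_le_sum fun l _ => ?_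
            rw [map_smul_eq_mul]
            gcongr
            exact hA l
        _ = (∑ l, ‖massMat (q + 1) j l‖) * (C * M * W) := by rw [Finset.sum_mul]
        _ ≤ _ := by
          gcongr
          exact hrow _ (massMat (q + 1)) j
    -- Here 1 ≤ 2M turns a bound without M into one linear in M.
    have e2 : N (F m j) ≤ 2 * M * W := (hF j).trans (by nlinarith)
    calc _ ≤ 2 * M * W + G * (C * M * W) := add_le_add e2 e1
      _ = _ := by ring
  refine mul_le_mul_of_nonneg_left ?_ (hk m hm).le
  refine (seminorm_sum_le N _ _).trans ?_
  calc _ ≤ ∑ j, ‖(dgMat q)⁻¹ i j‖ * ((2 + G * C) * M * W) := by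
        refine Finset.sum_le_sum fun j _ => ?_
        rw [map_smul_eq_mul]
        gcongr
        exact hin j
    _ = (∑ j, ‖(dgMat q)⁻¹ i j‖) * ((2 + G * C) * M * W) := (Finset.sum_mul _ _ _).symm
    _ ≤ B * ((2 + G * C) * M * W) := by
      gcongr
      exact hrow _ (dgMat q)⁻¹ i
    _ = B * (2 + G * C) * M * W := by ring
    _ ≤ _ := by
      gcongr
      linarith

end DGCG

namespace DGCG

/-! ### Schur's test -/

/-- Hölder applied to KG = K^(1-1/p) (K G^p)^(1/p). -/
theorem lintegral_mul_rpow_le {X : Type*} [MeasurableSpace X] {μ : Measure X} {K G : X → ℝ≥0∞}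
    (hK : AEMeasurable K μ) (hG : AEMeasurable G μ) {p : ℝ} (hp : 1 ≤ p) :
    (∫⁻ x, K x * G x ∂μ) ^ p ≤ (∫⁻ x, K x ∂μ) ^ (p - 1) * ∫⁻ x, K x * G x ^ p ∂μ := by
  have hp0 : 0 < p := by linarith
  have hp1 : 0 ≤ 1 - 1 / p := by rw [sub_nonneg, div_le_one hp0]; exact hp
  have h := ENNReal.lintegral_mul_norm_pow_le (μ := μ) hK (hK.mul (hG.pow_const p))
    (p := 1 - 1 / p) (q := 1 / p) hp1 (by positivity) (by ring)
  have e : ∀ x, K x ^ (1 - 1 / p) * (K x * G x ^ p) ^ (1 / p) = K x * G x := by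
    intro x
    rw [ENNReal.mul_rpow_of_nonneg _ _ (by positivity), ← ENNReal.rpow_mul, mul_one_div_cancel hp0.ne',
      ENNReal.rpow_one, ← mul_assoc, ← ENNReal.rpow_add_of_nonneg _ _ hp1 (by positivity)]
    simp
  simp only [Pi.mul_apply, e] at h
  calc _ ≤ ((∫⁻ x, K x ∂μ) ^ (1 - 1 / p) * (∫⁻ x, K x * G x ^ p ∂μ) ^ (1 / p)) ^ p := by gcongr
    _ = _ := by
      rw [ENNReal.mul_rpow_of_nonneg _ _ hp0.le, ← ENNReal.rpow_mul, ← ENNReal.rpow_mul,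
        one_div_mul_cancel hp0.ne', ENNReal.rpow_one]
      congr 2
      field_simp

/-- Row bounds enter through Hölder with power p - 1; after exchanging sum and integral the column
bound contributes the last factor L. -/
theorem schur_test {X : Type*} [MeasurableSpace X] {μ : Measure X} {K : ℕ → X → ℝ≥0∞}
    {G : X → ℝ≥0∞} {a : ℕ → ℝ≥0∞} {L : ℝ≥0∞} {n : ℕ} (hK : ∀ m, Measurable (K m))
    (hG : AEMeasurable G μ) (h1 : ∀ m < n, ∫⁻ x, K m x ∂μ ≤ L)
    (h2 : ∀ x, ∑ m ∈ Finset.range n, a m * K m x ≤ L) {p : ℝ} (hp : 1 ≤ p) :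
    ∑ m ∈ Finset.range n, a m * (∫⁻ x, K m x * G x ∂μ) ^ p ≤ L ^ p * ∫⁻ x, G x ^ p ∂μ := by
  have hp0 : 0 ≤ p - 1 := by linarith
  calc _ ≤ ∑ m ∈ Finset.range n, a m * (L ^ (p - 1) * ∫⁻ x, K m x * G x ^ p ∂μ) := by
        refine Finset.sum_le_sum fun m hm => ?_
        refine mul_le_mul_right ((lintegral_mul_rpow_le (hK m).aemeasurable hG hp).trans ?_) _
        gcongr
        exact h1 m (Finset.mem_range.1 hm)
    _ = L ^ (p - 1) * ∫⁻ x, ∑ m ∈ Finset.range n, a m * (K m x * G x ^ p) ∂μ := by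
        have hm : ∀ m, AEMeasurable (fun x => K m x * G x ^ p) μ := fun m =>
          (hK m).aemeasurable.mul (hG.pow_const p)
        rw [lintegral_finsetSum' _ fun m _ => (hm m).const_mul _, Finset.mul_sum]
        refine Finset.sum_congr rfl fun m _ => ?_
        rw [lintegral_const_mul'' _ (hm m)]
        ring
    _ ≤ L ^ (p - 1) * ∫⁻ x, L * G x ^ p ∂μ := by
        gcongr with x
        simp only [← mul_assoc]
        rw [← Finset.sum_mul]
        gcongr
        exact h2 x
    _ = _ := by
        rw [lintegral_const_mul'' _ (hG.pow_const p), ← mul_assoc]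
        congr 1
        nth_rewrite 2 [← ENNReal.rpow_one L]
        rw [← ENNReal.rpow_add_of_nonneg _ _ hp0 zero_le_one, sub_add_cancel]

/-! ### Time partitions -/

namespace TimePartition

variable {T : ℝ} (P : TimePartition T)

theorem step_pos {m : ℕ} (hm : m < P.M) : 0 < P.step m := sub_pos.2 (P.t_lt m hm)

theorem t_mono {l m : ℕ} (hlm : l ≤ m) (hm : m ≤ P.M) : P.t l ≤ P.t m := by
  induction m, hlm using Nat.le_induction with
  | base => exact le_rfl
  | succ m _ ih => exact (ih (by omega)).trans (P.t_lt m (by omega)).le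

theorem t_strictMono {l m : ℕ} (hlm : l < m) (hm : m ≤ P.M) : P.t l < P.t m :=
  (P.t_lt l (by omega)).trans_le (P.t_mono hlm hm)

theorem t_nonneg {m : ℕ} (hm : m ≤ P.M) : 0 ≤ P.t m := by
  rw [← P.t_zero]; exact P.t_mono (Nat.zero_le m) hm

theorem t_le {m : ℕ} (hm : m ≤ P.M) : P.t m ≤ T := by
  conv_rhs => rw [← P.t_last]
  exact P.t_mono hm le_rfl

theorem measurableSet_interval (m : ℕ) : MeasurableSet (P.interval m) := measurableSet_Ioc

theorem interval_subset {m : ℕ} (hm : m < P.M) : P.interval m ⊆ Set.Ioc 0 T :=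
  Set.Ioc_subset_Ioc (P.t_nonneg hm.le) (P.t_le hm)

theorem index_unique {l m : ℕ} (hl : l < P.M) (hm : m < P.M) {x : ℝ} (hxl : x ∈ P.interval l)
    (hxm : x ∈ P.interval m) : l = m := by
  by_contra hne
  rcases lt_or_gt_of_ne hne with h | h
  · exact absurd (hxl.2.trans (P.t_mono h hm.le)) (not_le.2 hxm.1)
  · exact absurd (hxm.2.trans (P.t_mono h hl.le)) (not_le.2 hxl.1)

theorem sum_step {l m : ℕ} (hlm : l ≤ m) :
    ∑ n ∈ Finset.Ico l m, P.step n = P.t m - P.t l := by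
  simp only [step]
  rw [Finset.sum_Ico_eq_sub _ hlm, Finset.sum_range_sub, Finset.sum_range_sub]
  ring

theorem lintegral_eq_sum (f : ℝ → ℝ≥0∞) :
    ∫⁻ t in Set.Ioc 0 T, f t = ∑ m ∈ Finset.range P.M, ∫⁻ t in P.interval m, f t := by
  have h : ∀ n ≤ P.M, ∫⁻ t in Set.Ioc 0 (P.t n), f t
      = ∑ m ∈ Finset.range n, ∫⁻ t in P.interval m, f t := by
    intro n
    induction n with
    | zero => simp [P.t_zero]
    | succ n ih =>
      intro hn
      rw [Finset.sum_range_succ, ← ih (by omega), ← Set.Ioc_union_Ioc_eq_Ioc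
        (P.t_nonneg (m := n) (by omega)) (P.t_lt n (by omega)).le,
        lintegral_union measurableSet_Ioc (Set.Ioc_disjoint_Ioc_of_le le_rfl)]
      rfl
  rw [← h P.M le_rfl, P.t_last]

theorem sub_div_le_log_sub {a b : ℝ} (ha : 0 < a) (hb : 0 < b) :
    (a - b) / a ≤ Real.log a - Real.log b := by
  have h := Real.one_sub_inv_le_log_of_pos (div_pos ha hb)
  rw [Real.log_div ha.ne' hb.ne', inv_div] at h
  rwa [sub_div, div_self ha.ne']

/-- Each off-diagonal weight is at most the drop of log(t_{m+1} - t_l) from l to l + 1, so the sum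
telescopes. The diagonal term must be kept apart, as the next logarithm would be log 0. -/
theorem sum_left_le {m : ℕ} (hm : m < P.M) :
    ∑ l ∈ Finset.range (m + 1), stepWeight P.step l m ≤ 1 + Real.log (T / P.step m) := by
  have hk := P.step_pos hm
  have hT : 0 < T := hk.trans_le (by
    have := P.t_le hm; have := P.t_nonneg hm.le; simp only [step]; linarith)
  rw [Finset.sum_range_succ, stepWeight_self hk, add_comm]
  gcongr
  have h1 : ∀ n ≤ m, ∑ l ∈ Finset.range n, stepWeight P.step l m
      ≤ Real.log (P.t (m + 1) - P.t 0) - Real.log (P.t (m + 1) - P.t n) := by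
    intro n
    induction n with
    | zero => simp
    | succ n ih =>
      intro hn
      rw [Finset.sum_range_succ]
      have ha : 0 < P.t (m + 1) - P.t n := sub_pos.2 (P.t_strictMono (by omega) (by omega))
      have hb : 0 < P.t (m + 1) - P.t (n + 1) := sub_pos.2 (P.t_strictMono (by omega) (by omega))
      have h2 := sub_div_le_log_sub ha hb
      have h3 : stepWeight P.step n m = (P.t (m + 1) - P.t n - (P.t (m + 1) - P.t (n + 1)))
          / (P.t (m + 1) - P.t n) := by
        rw [stepWeight, P.sum_step (by omega), step]; ring
      rw [h3]
      have := ih (by omega)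
      linarith
  refine (h1 m le_rfl).trans ?_
  rw [Real.log_div hT.ne' hk.ne', P.t_zero, sub_zero]
  have h4 : 0 < P.t (m + 1) := by
    have := P.t_strictMono (Nat.zero_lt_succ m) hm
    rwa [P.t_zero] at this
  have := Real.log_le_log h4 (P.t_le hm)
  simp only [step]
  linarith

/-- The same telescoping in the other index, now with log(t_m - t_l) and with m = l kept apart. -/
theorem sum_right_le {l : ℕ} (hl : l < P.M) :
    ∑ m ∈ Finset.Ico l P.M, P.step m * (1 / (P.t (m + 1) - P.t l))
      ≤ 1 + Real.log (T / P.step l) := by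
  have hk := P.step_pos hl
  have hT : 0 < T := hk.trans_le (by
    have := P.t_le hl; have := P.t_nonneg hl.le; simp only [step]; linarith)
  have h1 : ∀ n, l + 1 ≤ n → n ≤ P.M →
      ∑ m ∈ Finset.Ico l n, P.step m * (1 / (P.t (m + 1) - P.t l))
      ≤ 1 + (Real.log (P.t n - P.t l) - Real.log (P.step l)) := by
    intro n hn
    induction n, hn using Nat.le_induction with
    | base =>
      intro _
      rw [Finset.sum_Ico_succ_top le_rfl, Finset.Ico_self, Finset.sum_empty]
      have e : P.step l * (1 / (P.t (l + 1) - P.t l)) = 1 := mul_one_div_cancel hk.ne'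
      rw [e, step]; simp
    | succ n hn ih =>
      intro hnM
      rw [Finset.sum_Ico_succ_top (by omega)]
      have ha : 0 < P.t (n + 1) - P.t l := sub_pos.2 (P.t_strictMono (by omega) (by omega))
      have hb : 0 < P.t n - P.t l := sub_pos.2 (P.t_strictMono (by omega) (by omega))
      have h2 := sub_div_le_log_sub ha hb
      have h3 : P.step n * (1 / (P.t (n + 1) - P.t l))
          = (P.t (n + 1) - P.t l - (P.t n - P.t l)) / (P.t (n + 1) - P.t l) := by
        rw [step]; ring
      rw [h3]
      have := ih (by omega)
      linarith
  refine (h1 P.M hl le_rfl).trans ?_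
  rw [Real.log_div hT.ne' hk.ne', P.t_last]
  have h5 := P.t_strictMono hl le_rfl
  rw [P.t_last] at h5
  have := Real.log_le_log (sub_pos.2 h5) (by linarith [P.t_nonneg hl.le] : T - P.t l ≤ T)
  linarith

theorem kmin_le {m : ℕ} (hm : m < P.M) : P.kmin ≤ P.step m :=
  ciInf_le (Set.finite_range _).bddBelow (⟨m, hm⟩ : Fin P.M)

theorem step_le_kmax {m : ℕ} (hm : m < P.M) : P.step m ≤ P.kmax :=
  le_ciSup (f := fun m : Fin P.M => P.step m) (Set.finite_range _).bddAbove (⟨m, hm⟩ : Fin P.M)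

theorem M_pos (hT : 0 < T) : 0 < P.M := by
  by_contra h
  have h1 := P.t_last
  rw [Nat.eq_zero_of_not_pos h, P.t_zero] at h1
  linarith

theorem kmax_pos (hT : 0 < T) : 0 < P.kmax :=
  (P.step_pos (P.M_pos hT)).trans_le (P.step_le_kmax (P.M_pos hT))

/-- log 4 ≥ 1. This is what allows additive constants to be absorbed into the logarithm. -/
theorem one_le_log {c β κ : ℝ} (hT : 0 < T) (hP : P.Admissible c β κ) :
    1 ≤ Real.log (T / P.kmax) := by
  have hk := P.kmax_pos hT
  have h1 : 4 ≤ T / P.kmax := by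
    rw [le_div_iff₀ hk]; linarith [hP.max_step]
  have h2 := Real.log_le_log (by norm_num) h1
  have h3 : Real.log 4 = 2 * Real.log 2 := by
    rw [show (4 : ℝ) = 2 ^ 2 by norm_num, Real.log_pow]; norm_num
  have := Real.log_two_gt_d9
  linarith

/-- k_m ≥ c k^β gives 1 + log(T/k_m) ≤ β log(T/k) + (1 + (1 - β) log T - log c), and the constant is
absorbed since log(T/k) ≥ 1. -/
theorem exists_log_bound {c β : ℝ} (hT : 0 < T) (hc : 0 < c) (hβ : 0 < β) :
    ∃ C, 0 < C ∧ ∀ (P : TimePartition T) {κ : ℝ}, P.Admissible c β κ → ∀ m < P.M,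
      1 + Real.log (T / P.step m) ≤ C * Real.log (T / P.kmax) := by
  refine ⟨β + |1 + (1 - β) * Real.log T - Real.log c|, by positivity, fun P κ hP m hm => ?_⟩
  have hk := P.kmax_pos hT
  have h1 := P.one_le_log hT hP
  have h2 : c * P.kmax ^ β ≤ P.step m := hP.min_step.trans (P.kmin_le hm)
  have hpos : 0 < P.kmax ^ β := Real.rpow_pos_of_pos hk β
  have h3 := Real.log_le_log (by positivity) h2
  rw [Real.log_mul hc.ne' hpos.ne', Real.log_rpow hk] at h3
  rw [Real.log_div hT.ne' (P.step_pos hm).ne']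
  rw [Real.log_div hT.ne' hk.ne'] at *
  have h4 := le_abs_self (1 + (1 - β) * Real.log T - Real.log c)
  have h5 := abs_nonneg (1 + (1 - β) * Real.log T - Real.log c)
  nlinarith

/-- The kernel `1 / (t_{m+1} - t_l)` for `x` in the `l`-th interval. -/
noncomputable def kernel (m : ℕ) (x : ℝ) : ℝ≥0∞ :=
  ∑ l ∈ Finset.range (m + 1),
    (P.interval l).indicator (fun _ => ENNReal.ofReal (1 / (P.t (m + 1) - P.t l))) x

theorem measurable_kernel (m : ℕ) : Measurable (P.kernel m) :=
  Finset.measurable_sum _ fun _ _ => measurable_const.indicator measurableSet_Ioc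

theorem kernel_eq {l m : ℕ} (hl : l < P.M) (hm : m < P.M) {x : ℝ} (hx : x ∈ P.interval l) :
    P.kernel m x
      = if l ∈ Finset.range (m + 1) then ENNReal.ofReal (1 / (P.t (m + 1) - P.t l)) else 0 := by
  rw [kernel, ← Finset.sum_ite_eq (Finset.range (m + 1)) l
    fun l => ENNReal.ofReal (1 / (P.t (m + 1) - P.t l))]
  refine Finset.sum_congr rfl fun l' hl' => ?_
  rw [Finset.mem_range] at hl'
  by_cases h : l = l'
  · subst h; simp [hx]
  · have : x ∉ P.interval l' := fun hx' => h (P.index_unique hl (by omega) hx hx')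
    simp [h, this]

theorem lintegral_kernel_mul {m : ℕ} (hm : m < P.M) (G : ℝ → ℝ≥0∞) :
    ∫⁻ x in Set.Ioc 0 T, P.kernel m x * G x
      = ∑ l ∈ Finset.range (m + 1),
        ENNReal.ofReal (1 / (P.t (m + 1) - P.t l)) * ∫⁻ x in P.interval l, G x := by
  have h0 : ∀ l ∈ Finset.range P.M, ∫⁻ x in P.interval l, P.kernel m x * G x
      = if l ∈ Finset.range (m + 1) then
        ENNReal.ofReal (1 / (P.t (m + 1) - P.t l)) * ∫⁻ x in P.interval l, G x else 0 := by
    intro l hl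
    rw [Finset.mem_range] at hl
    have h1 : ∫⁻ x in P.interval l, P.kernel m x * G x = ∫⁻ x in P.interval l,
        (if l ∈ Finset.range (m + 1) then ENNReal.ofReal (1 / (P.t (m + 1) - P.t l)) else 0)
          * G x :=
      setLIntegral_congr_fun measurableSet_Ioc fun x hx => by
        simp only [P.kernel_eq hl hm hx]
    rw [h1]
    split_ifs
    · exact lintegral_const_mul' _ _ ENNReal.ofReal_ne_top
    · simp
  rw [P.lintegral_eq_sum, Finset.sum_congr rfl h0, ← Finset.sum_filter]
  refine Finset.sum_congr ?_ fun _ _ => rfl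
  ext l
  simp only [Finset.mem_filter, Finset.mem_range]
  omega

theorem lintegral_kernel_le {m : ℕ} (hm : m < P.M) :
    ∫⁻ x in Set.Ioc 0 T, P.kernel m x ≤ ENNReal.ofReal (1 + Real.log (T / P.step m)) := by
  have h := P.lintegral_kernel_mul hm (fun _ => 1)
  simp only [mul_one] at h
  rw [h]
  refine le_trans (le_of_eq ?_) (ENNReal.ofReal_le_ofReal (P.sum_left_le hm))
  rw [ENNReal.ofReal_sum_of_nonneg fun l hl => stepWeight_nonneg (fun n hn => P.step_pos (by omega))
    (by rw [Finset.mem_range] at hl; omega)]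
  refine Finset.sum_congr rfl fun l hl => ?_
  rw [Finset.mem_range] at hl
  have hpos : 0 < P.t (m + 1) - P.t l := sub_pos.2 (P.t_strictMono (by omega) (by omega))
  rw [setLIntegral_one, interval, Real.volume_Ioc, ← ENNReal.ofReal_mul (by positivity),
    stepWeight, P.sum_step (by omega), step]
  congr 1
  ring

theorem sum_kernel_le {L : ℝ≥0∞}
    (hL : ∀ l < P.M, ENNReal.ofReal (1 + Real.log (T / P.step l)) ≤ L) (x : ℝ) :
    ∑ m ∈ Finset.range P.M, ENNReal.ofReal (P.step m) * P.kernel m x ≤ L := by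
  by_cases hx : ∃ l < P.M, x ∈ P.interval l
  · obtain ⟨l, hl, hx⟩ := hx
    refine le_trans ?_ (hL l hl)
    refine le_trans ?_ (ENNReal.ofReal_le_ofReal (P.sum_right_le hl))
    have hpos : ∀ m ∈ Finset.Ico l P.M, 0 < P.step m * (1 / (P.t (m + 1) - P.t l)) := by
      intro m hm
      rw [Finset.mem_Ico] at hm
      have h1 := P.step_pos hm.2
      have h2 : 0 < P.t (m + 1) - P.t l := sub_pos.2 (P.t_strictMono (by omega) (by omega))
      positivity
    rw [ENNReal.ofReal_sum_of_nonneg fun m hm => (hpos m hm).le]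
    have h1 : ∀ m ∈ Finset.range P.M, ENNReal.ofReal (P.step m) * P.kernel m x
        = if m ∈ Finset.Ico l P.M then
          ENNReal.ofReal (P.step m * (1 / (P.t (m + 1) - P.t l))) else 0 := by
      intro m hm
      rw [Finset.mem_range] at hm
      rw [P.kernel_eq hl hm hx]
      by_cases hlm : l ≤ m
      · rw [if_pos (Finset.mem_range.2 (by omega)), if_pos (Finset.mem_Ico.2 ⟨hlm, hm⟩),
          ENNReal.ofReal_mul (P.step_pos hm).le]
      · rw [if_neg (by rw [Finset.mem_range]; omega), if_neg (by rw [Finset.mem_Ico]; omega),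
          mul_zero]
    rw [Finset.sum_congr rfl h1, ← Finset.sum_filter]
    refine le_of_eq (Finset.sum_congr ?_ fun _ _ => rfl)
    ext m
    simp only [Finset.mem_filter, Finset.mem_range, Finset.mem_Ico]
    omega
  · push Not at hx
    refine le_trans (le_of_eq ?_) zero_le
    refine Finset.sum_eq_zero fun m hm => ?_
    rw [Finset.mem_range] at hm
    rw [kernel, Finset.sum_eq_zero, mul_zero]
    intro l hl
    rw [Finset.mem_range] at hl
    simp [hx l (by omega)]

/-- The norm of `L^s(0,T)` for step functions on the partition. -/
noncomputable def stepNorm (s : ℝ≥0∞) (b : ℕ → ℝ≥0∞) : ℝ≥0∞ :=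
  if s = ⊤ then ⨆ m ∈ Finset.range P.M, b m
  else (∑ m ∈ Finset.range P.M, ENNReal.ofReal (P.step m) * b m ^ s.toReal) ^ (1 / s.toReal)

theorem stepNorm_mono {s : ℝ≥0∞} {b b' : ℕ → ℝ≥0∞} (h : ∀ m < P.M, b m ≤ b' m) :
    P.stepNorm s b ≤ P.stepNorm s b' := by
  rw [stepNorm, stepNorm]
  split_ifs
  · exact iSup₂_mono fun m hm => h m (Finset.mem_range.1 hm)
  · gcongr with m hm
    exact h m (Finset.mem_range.1 hm)

theorem stepNorm_const_mul {s : ℝ≥0∞} (hs : 1 ≤ s) (c : ℝ≥0∞) (b : ℕ → ℝ≥0∞) :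
    P.stepNorm s (fun m => c * b m) = c * P.stepNorm s b := by
  rw [stepNorm, stepNorm]
  split_ifs with h
  · simp only [ENNReal.mul_iSup]
  · have h1 : 0 < s.toReal := ENNReal.toReal_pos (by positivity) h
    have e : ∀ m, ENNReal.ofReal (P.step m) * (c * b m) ^ s.toReal
        = c ^ s.toReal * (ENNReal.ofReal (P.step m) * b m ^ s.toReal) := by
      intro m
      rw [ENNReal.mul_rpow_of_nonneg _ _ h1.le]; ring
    simp only [e]
    rw [← Finset.mul_sum, ENNReal.mul_rpow_of_nonneg _ _ (by positivity), ← ENNReal.rpow_mul,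
      mul_one_div_cancel h1.ne', ENNReal.rpow_one]

/-- For s = ∞ the row bound alone is enough; otherwise this is Schur's test from (0, T) with
Lebesgue measure to the subintervals weighted by their lengths. Keeping the data as a function of
time avoids a separate averaging step. -/
theorem stepNorm_kernel_le {s : ℝ≥0∞} (hs : 1 ≤ s) {L : ℝ≥0∞}
    (hL : ∀ l < P.M, ENNReal.ofReal (1 + Real.log (T / P.step l)) ≤ L) {g : ℝ → ℝ}
    (hg : AEMeasurable g (volume.restrict (Set.Ioc 0 T))) :
    P.stepNorm s (fun m => ∫⁻ x in Set.Ioc 0 T, P.kernel m x * ‖g x‖ₑ)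
      ≤ L * eLpNorm g s (volume.restrict (Set.Ioc 0 T)) := by
  have h1 : ∀ m < P.M, ∫⁻ x in Set.Ioc 0 T, P.kernel m x ≤ L := fun m hm =>
    (P.lintegral_kernel_le hm).trans (hL m hm)
  rw [stepNorm]
  split_ifs with h
  · subst h
    refine iSup₂_le fun m hm => ?_
    rw [eLpNorm_exponent_top]
    calc _ ≤ ∫⁻ x in Set.Ioc 0 T, P.kernel m x
          * eLpNormEssSup g (volume.restrict (Set.Ioc 0 T)) := by
          refine lintegral_mono_ae ?_
          filter_upwards [enorm_ae_le_eLpNormEssSup g (volume.restrict (Set.Ioc 0 T))] with x hx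
          gcongr
      _ = (∫⁻ x in Set.Ioc 0 T, P.kernel m x) * _ :=
          lintegral_mul_const'' _ (P.measurable_kernel m).aemeasurable
      _ ≤ _ := by
          gcongr
          exact h1 m (Finset.mem_range.1 hm)
  · have hs1 : 1 ≤ s.toReal := by
      rw [← ENNReal.toReal_one]; exact ENNReal.toReal_mono h hs
    have hs0 : 0 < s.toReal := by linarith
    rw [eLpNorm_eq_lintegral_rpow_enorm_toReal (by positivity) h]
    have h2 := schur_test (μ := volume.restrict (Set.Ioc 0 T)) (K := P.kernel)
      (G := fun x => ‖g x‖ₑ) P.measurable_kernel hg.enorm h1 (P.sum_kernel_le hL) hs1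
    calc _ ≤ (L ^ s.toReal * ∫⁻ x in Set.Ioc 0 T, ‖g x‖ₑ ^ s.toReal) ^ (1 / s.toReal) := by gcongr
      _ = _ := by
        rw [ENNReal.mul_rpow_of_nonneg _ _ (by positivity), ← ENNReal.rpow_mul,
          mul_one_div_cancel hs0.ne', ENNReal.rpow_one]

theorem eLpNorm_le_stepNorm {s : ℝ≥0∞} (hs : 1 ≤ s) {w : ℝ → ℝ} {b : ℕ → ℝ≥0∞}
    (h : ∀ m < P.M, ∀ᵐ x ∂volume.restrict (P.interval m), ‖w x‖ₑ ≤ b m) :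
    eLpNorm w s (volume.restrict (Set.Ioc 0 T)) ≤ P.stepNorm s b := by
  rw [stepNorm]
  split_ifs with hs'
  · subst hs'
    rw [eLpNorm_exponent_top]
    refine essSup_le_of_ae_le _ ?_
    have hcov : ∀ x ∈ Set.Ioc 0 T, ∃ m < P.M, x ∈ P.interval m := by
      intro x hx
      have h1 : ∀ n ≤ P.M, x ≤ P.t n → ∃ m < P.M, x ∈ P.interval m := by
        intro n
        induction n with
        | zero => intro _ h; rw [P.t_zero] at h; exact absurd hx.1 (not_lt.2 h)
        | succ n ih =>
          intro hn hxn
          rcases le_or_gt x (P.t n) with h | h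
          · exact ih (by omega) h
          · exact ⟨n, by omega, h, hxn⟩
      exact h1 P.M le_rfl (by rw [P.t_last]; exact hx.2)
    have h2 : ∀ᵐ x, ∀ m, m < P.M → x ∈ P.interval m → ‖w x‖ₑ ≤ b m := by
      rw [ae_all_iff]
      intro m
      by_cases hm : m < P.M
      · filter_upwards [(ae_restrict_iff' measurableSet_Ioc).1 (h m hm)] with x hx _ hxm
        exact hx hxm
      · exact Eventually.of_forall fun x h => absurd h hm
    rw [EventuallyLE, ae_restrict_iff' measurableSet_Ioc]
    filter_upwards [h2] with x hx hxT
    obtain ⟨m, hm, hxm⟩ := hcov x hxT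
    exact (hx m hm hxm).trans (le_iSup₂ (f := fun m (_ : m ∈ Finset.range P.M) => b m) m
      (Finset.mem_range.2 hm))
  · have hs0 : 0 < s.toReal := ENNReal.toReal_pos (by positivity) hs'
    rw [eLpNorm_eq_lintegral_rpow_enorm_toReal (by positivity) hs', P.lintegral_eq_sum]
    gcongr with m hm
    rw [Finset.mem_range] at hm
    calc _ ≤ ∫⁻ _ in P.interval m, b m ^ s.toReal := by
          refine lintegral_mono_ae ?_
          filter_upwards [h m hm] with x hx
          gcongr
      _ = _ := by
        rw [setLIntegral_const, interval, Real.volume_Ioc, mul_comm]; rfl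

end TimePartition

end DGCG

namespace DGCG

/-! ### Local coordinates in time -/

/-- Polynomials of degree at most `q` are invariant under affine substitutions. -/
theorem exists_poly_comp_affine {V : Type*} [AddCommGroup V] [Module ℂ V] {q : ℕ}
    (a : Fin (q + 1) → V) (α β : ℂ) : ∃ b : Fin (q + 1) → V, ∀ t : ℂ,
      ∑ j : Fin (q + 1), (β * t + α) ^ (j : ℕ) • a j = ∑ j : Fin (q + 1), t ^ (j : ℕ) • b j := by
  refine ⟨fun i => ∑ j : Fin (q + 1), (β ^ (i : ℕ) * α ^ ((j : ℕ) - i) * ((j : ℕ).choose i : ℂ)) • a j,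
    fun t => ?_⟩
  simp only [Finset.smul_sum, smul_smul]
  rw [Finset.sum_comm]
  refine Finset.sum_congr rfl fun j _ => ?_
  rw [← Finset.sum_smul]
  congr 1
  rw [add_pow, Fin.sum_univ_eq_sum_range
    (fun i => t ^ i * (β ^ i * α ^ ((j : ℕ) - i) * ((j : ℕ).choose i : ℂ))) (q + 1)]
  have hsub : Finset.range ((j : ℕ) + 1) ⊆ Finset.range (q + 1) :=
    Finset.range_subset_range.2 (by omega)
  rw [← Finset.sum_subset hsub]
  · refine Finset.sum_congr rfl fun i _ => ?_
    rw [mul_pow]; ring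
  · intro i _ hi
    rw [Finset.mem_range, not_lt] at hi
    rw [Nat.choose_eq_zero_of_lt (by omega)]
    simp

namespace TimePartition

variable {T : ℝ} (P : TimePartition T)

/-- The local coordinate on the `m`-th interval, with values in `[0,1]`. -/
noncomputable def loc (m : ℕ) (t : ℝ) : ℂ := (((t - P.t m) / P.step m : ℝ) : ℂ)

theorem hasDerivAt_loc (m : ℕ) (t : ℝ) :
    HasDerivAt (P.loc m) ((P.step m : ℂ)⁻¹) t := by
  have h : HasDerivAt (fun t : ℝ => (t - P.t m) / P.step m) (1 / P.step m) t :=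
    ((hasDerivAt_id t).sub_const _).div_const _
  have := h.ofReal_comp
  rw [one_div, Complex.ofReal_inv] at this
  exact this

theorem continuous_loc (m : ℕ) : Continuous (P.loc m) := by unfold loc; fun_prop

theorem loc_left (m : ℕ) : P.loc m (P.t m) = 0 := by simp [loc]

theorem loc_right {m : ℕ} (hm : m < P.M) : P.loc m (P.t (m + 1)) = 1 := by
  have := (P.step_pos hm).ne'
  rw [loc, ← step, div_self this, Complex.ofReal_one]

theorem norm_loc_le {m : ℕ} (hm : m < P.M) {t : ℝ} (ht : t ∈ P.interval m) : ‖P.loc m t‖ ≤ 1 := by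
  have hk := P.step_pos hm
  have h1 : 0 ≤ t - P.t m := sub_nonneg.2 ht.1.le
  rw [loc, Complex.norm_real, Real.norm_of_nonneg (by positivity), div_le_one hk, step]
  linarith [ht.2]

theorem star_loc_pow (m i : ℕ) (t : ℝ) : (starRingEnd ℂ) (P.loc m t ^ i) = P.loc m t ^ i := by
  rw [map_pow, loc, Complex.conj_ofReal]

theorem integral_loc_pow {m : ℕ} (hm : m < P.M) (n : ℕ) :
    ∫ t in P.interval m, P.loc m t ^ n = P.step m / ((n : ℂ) + 1) := by
  have hn : ((n : ℂ) + 1) ≠ 0 := Nat.cast_add_one_ne_zero n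
  have hk : (P.step m : ℂ) ≠ 0 := by exact_mod_cast (P.step_pos hm).ne'
  have hd : ∀ t ∈ Set.uIcc (P.t m) (P.t (m + 1)), HasDerivAt
      (fun t => P.step m / ((n : ℂ) + 1) * P.loc m t ^ (n + 1)) (P.loc m t ^ n) t := by
    intro t _
    refine (((P.hasDerivAt_loc m t).pow (n + 1)).const_mul _).congr_deriv ?_
    push_cast
    field_simp
  have := P.continuous_loc m
  rw [interval, ← intervalIntegral.integral_of_le (P.t_lt m hm).le,
    intervalIntegral.integral_eq_sub_of_hasDerivAt hd
      (Continuous.intervalIntegrable (by fun_prop) _ _), P.loc_left, P.loc_right hm]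
  simp

theorem integrableOn_loc_mul {m : ℕ} (n : ℕ) (c : ℂ) :
    IntegrableOn (fun t => P.loc m t ^ n * c) (P.interval m) := by
  have := P.continuous_loc m
  exact (Continuous.integrableOn_Icc (by fun_prop)).mono_set Set.Ioc_subset_Icc_self

section limits

variable {V : Type*} [NormedAddCommGroup V] [NormedSpace ℂ V] {q : ℕ}
  {u : ℝ → V} {U : Fin (q + 1) → V} {m : ℕ}

theorem rightLim_eq (hm : m < P.M)
    (hu : ∀ t ∈ P.interval m, u t = ∑ j : Fin (q + 1), P.loc m t ^ (j : ℕ) • U j) :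
    Function.rightLim u (P.t m) = U 0 := by
  refine rightLim_eq_of_tendsto ?_
  have h1 : Continuous fun t => ∑ j : Fin (q + 1), P.loc m t ^ (j : ℕ) • U j := by
    have := P.continuous_loc m
    fun_prop
  have h2 := (h1.tendsto (P.t m)).mono_left (nhdsWithin_le_nhds (s := Set.Ioi (P.t m)))
  rw [P.loc_left] at h2
  have h3 : ∑ j : Fin (q + 1), (0 : ℂ) ^ (j : ℕ) • U j = U 0 := by
    rw [Finset.sum_eq_single 0]
    · simp
    · intro j _ hj
      have : (j : ℕ) ≠ 0 := fun h => hj (Fin.ext h)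
      simp [this]
    · simp
  rw [h3] at h2
  refine h2.congr' ?_
  filter_upwards [Ioc_mem_nhdsGT (P.t_lt m hm)] with t ht
  exact (hu t ht).symm

theorem leftLim_eq (hm : m < P.M)
    (hu : ∀ t ∈ P.interval m, u t = ∑ j : Fin (q + 1), P.loc m t ^ (j : ℕ) • U j) :
    Function.leftLim u (P.t (m + 1)) = ∑ j, U j := by
  refine leftLim_eq_of_tendsto ?_
  have h1 : Continuous fun t => ∑ j : Fin (q + 1), P.loc m t ^ (j : ℕ) • U j := by
    have := P.continuous_loc m
    fun_prop
  have h2 := (h1.tendsto (P.t (m + 1))).mono_left (nhdsWithin_le_nhds (s := Set.Iio (P.t (m + 1))))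
  rw [P.loc_right hm] at h2
  simp only [one_pow, one_smul] at h2
  refine h2.congr' ?_
  filter_upwards [Ioo_mem_nhdsLT (P.t_lt m hm)] with t ht
  exact (hu t ⟨ht.1, ht.2.le⟩).symm

/-- The right end point is discarded as a null set: u may jump there, and then has no two-sided
derivative. -/
theorem deriv_eq
    (hu : ∀ t ∈ P.interval m, u t = ∑ j : Fin (q + 1), P.loc m t ^ (j : ℕ) • U j) :
    ∀ᵐ t ∂volume.restrict (P.interval m), deriv u t = (P.step m : ℂ)⁻¹ •
      ∑ j : Fin (q + 1), ((j : ℂ) * P.loc m t ^ ((j : ℕ) - 1)) • U j := by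
  have hset : ∀ᵐ t : ℝ, t ≠ P.t (m + 1) := by
    simp [ae_iff]
  rw [interval, ae_restrict_iff' measurableSet_Ioc]
  filter_upwards [hset] with t hne ht
  have hlt : t < P.t (m + 1) := lt_of_le_of_ne ht.2 hne
  have h1 : HasDerivAt (fun t => ∑ j : Fin (q + 1), P.loc m t ^ (j : ℕ) • U j)
      (∑ j : Fin (q + 1), ((j : ℕ) * P.loc m t ^ ((j : ℕ) - 1) * (P.step m : ℂ)⁻¹) • U j) t :=
    HasDerivAt.fun_sum fun j _ => ((P.hasDerivAt_loc m t).pow (j : ℕ)).smul_const (U j)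
  have h2 : u =ᶠ[𝓝 t] fun t => ∑ j : Fin (q + 1), P.loc m t ^ (j : ℕ) • U j := by
    filter_upwards [Ioo_mem_nhds ht.1 hlt] with x hx
    exact hu x ⟨hx.1, hx.2.le⟩
  rw [(h1.congr_of_eventuallyEq h2).deriv, Finset.smul_sum]
  refine Finset.sum_congr rfl fun j _ => ?_
  rw [smul_smul]
  congr 1
  ring

end limits

end TimePartition

end DGCG

namespace DGCG

/-! ### The equations for the local coefficients -/

section reduction

variable {d : ℕ} {Ω : TopologicalSpace.Opens (Eu d)} {T : ℝ} {𝒯 : Mesh Ω} {r q : ℕ}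
  {P : TimePartition T}

theorem MemX.exists_local {u : ℝ → feSpace 𝒯 r} (hu : MemX 𝒯 r q P u) :
    ∃ U : ℕ → Fin (q + 1) → feSpace 𝒯 r, ∀ m < P.M, ∀ t ∈ P.interval m,
      u t = ∑ j : Fin (q + 1), P.loc m t ^ (j : ℕ) • U m j := by
  have h : ∀ m, ∃ b : Fin (q + 1) → feSpace 𝒯 r, m < P.M → ∀ t ∈ P.interval m,
      u t = ∑ j : Fin (q + 1), P.loc m t ^ (j : ℕ) • b j := by
    intro m
    by_cases hm : m < P.M
    · obtain ⟨a, ha⟩ := hu m hm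
      obtain ⟨b, hb⟩ := exists_poly_comp_affine a (P.t m : ℂ) (P.step m : ℂ)
      refine ⟨b, fun _ t ht => ?_⟩
      have hk : (P.step m : ℂ) ≠ 0 := by exact_mod_cast (P.step_pos hm).ne'
      rw [← hb, ha t ht]
      refine Finset.sum_congr rfl fun j _ => ?_
      congr 2
      rw [TimePartition.loc]
      push_cast
      field_simp
      ring
    · exact ⟨0, fun h => absurd h hm⟩
  choose U hU using h
  exact ⟨U, fun m hm => hU m hm⟩

/-- The test function supported on the `m`-th interval. -/
noncomputable def testFun (P : TimePartition T) (m i : ℕ) (χ : feSpace 𝒯 r) : ℝ → feSpace 𝒯 r :=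
  (P.interval m).indicator fun t => P.loc m t ^ i • χ

theorem memX_testFun {m : ℕ} (hm : m < P.M) (i : Fin (q + 1)) (χ : feSpace 𝒯 r) :
    MemX 𝒯 r q P (testFun P m i χ) := by
  intro m' hm'
  by_cases h : m' = m
  · subst h
    obtain ⟨b, hb⟩ := exists_poly_comp_affine (Pi.single i χ : Fin (q + 1) → feSpace 𝒯 r)
      (-(P.t m' : ℂ) / P.step m') ((P.step m' : ℂ)⁻¹)
    refine ⟨b, fun t ht => ?_⟩
    rw [← hb, Finset.sum_eq_single i]
    · rw [testFun, Set.indicator_of_mem ht, Pi.single_eq_same]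
      congr 2
      rw [TimePartition.loc]
      push_cast
      ring
    · intro j _ hj
      rw [Pi.single_eq_of_ne hj, smul_zero]
    · simp
  · refine ⟨0, fun t ht => ?_⟩
    have : t ∉ P.interval m := fun ht' => h (P.index_unique hm' hm ht ht')
    simp [testFun, this]

theorem rightLim_testFun {m m' : ℕ} (hm : m < P.M) (hm' : m' < P.M) (i : Fin (q + 1))
    (χ : feSpace 𝒯 r) : Function.rightLim (testFun P m i χ) (P.t m')
      = if m' = m ∧ i = 0 then χ else 0 := by
  by_cases h : m' = m
  · subst h
    rw [P.rightLim_eq (q := q) (U := Pi.single i χ) hm']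
    · by_cases hi : i = 0
      · subst hi; simp
      · rw [Pi.single_eq_of_ne (Ne.symm hi)]; simp [hi]
    · intro t ht
      rw [Finset.sum_eq_single i]
      · rw [testFun, Set.indicator_of_mem ht, Pi.single_eq_same]
      · intro j _ hj
        rw [Pi.single_eq_of_ne hj, smul_zero]
      · simp
  · rw [P.rightLim_eq (q := q) (U := 0) hm']
    · simp [h]
    · intro t ht
      have : t ∉ P.interval m := fun ht' => h (P.index_unique hm' hm ht ht')
      simp [testFun, this]

/-- The functional `v ↦ (v, χ)_Ω` on `V_h`. -/
noncomputable def pairing (χ : feSpace 𝒯 r) : feSpace 𝒯 r →ₗ[ℂ] ℂ :=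
  (innerSL ℂ (χ : L2 Ω)).toLinearMap ∘ₗ (feSpace 𝒯 r).subtype

theorem l2_eq_pairing (v χ : feSpace 𝒯 r) : l2 (v : L2 Ω) (χ : L2 Ω) = pairing χ v := rfl

theorem eq_of_pairing {v w : feSpace 𝒯 r} (h : ∀ χ, pairing χ v = pairing χ w) : v = w := by
  have h1 := h (v - w)
  rw [← sub_eq_zero, ← map_sub, ← l2_eq_pairing, l2, inner_self_eq_zero] at h1
  exact sub_eq_zero.1 (Subtype.ext h1)

theorem l2_zero_right (v : L2 Ω) : l2 v ((0 : feSpace 𝒯 r) : L2 Ω) = 0 := inner_zero_left _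

theorem l2_loc_smul (v : L2 Ω) (χ : feSpace 𝒯 r) (m i : ℕ) (t : ℝ) :
    l2 v ((P.loc m t ^ i • χ : feSpace 𝒯 r) : L2 Ω) = P.loc m t ^ i * l2 v (χ : L2 Ω) := by
  have e : ((P.loc m t ^ i • χ : feSpace 𝒯 r) : L2 Ω) = P.loc m t ^ i • (χ : L2 Ω) := rfl
  rw [l2, e, _root_.inner_smul_left, P.star_loc_pow, l2]

theorem jump_eq {u : ℝ → feSpace 𝒯 r} {U : ℕ → Fin (q + 1) → feSpace 𝒯 r}
    (hU : ∀ m < P.M, ∀ t ∈ P.interval m, u t = ∑ j : Fin (q + 1), P.loc m t ^ (j : ℕ) • U m j)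
    {m : ℕ} (hm : m < P.M) : jump 𝒯 r P u m = jumpCoeff U m 0 := by
  rw [jump, jumpCoeff, if_pos rfl]
  cases m with
  | zero => rw [if_pos rfl, P.rightLim_eq hm (hU 0 hm), prevVal, sub_zero]
  | succ m =>
    rw [if_neg (Nat.succ_ne_zero m), P.rightLim_eq hm (hU _ hm),
      P.leftLim_eq (m := m) (by omega) (hU m (by omega)), prevVal]

/-- The moments of the projected right-hand side. -/
noncomputable def moment (𝒯 : Mesh Ω) (r q : ℕ) (P : TimePartition T) (f : ℝ → L2 Ω) (m : ℕ)
    (i : Fin (q + 1)) : feSpace 𝒯 r :=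
  ((P.step m : ℂ)⁻¹) • ∫ t in P.interval m, P.loc m t ^ (i : ℕ) • l2Projection 𝒯 r (f t)

theorem integrableOn_moment {f : ℝ → L2 Ω} (hf : IntegrableOn f (Set.Ioc 0 T)) {m : ℕ}
    (hm : m < P.M) (i : ℕ) :
    IntegrableOn (fun t => P.loc m t ^ i • l2Projection 𝒯 r (f t)) (P.interval m) := by
  have h1 : IntegrableOn (fun t => l2Projection 𝒯 r (f t)) (P.interval m) :=
    (l2Projection 𝒯 r).integrable_comp (hf.mono_set (P.interval_subset hm))
  refine h1.bdd_smul (φ := fun t => P.loc m t ^ i) 1 ?_ ?_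
  · have := P.continuous_loc m
    exact Continuous.aestronglyMeasurable (by fun_prop)
  · rw [ae_restrict_iff' (P.measurableSet_interval m)]
    refine Eventually.of_forall fun t ht => ?_
    rw [norm_pow]
    exact pow_le_one₀ (norm_nonneg _) (P.norm_loc_le hm ht)

theorem integral_deriv_testFun {u : ℝ → feSpace 𝒯 r} {U : ℕ → Fin (q + 1) → feSpace 𝒯 r}
    (hU : ∀ m < P.M, ∀ t ∈ P.interval m, u t = ∑ j : Fin (q + 1), P.loc m t ^ (j : ℕ) • U m j)
    {m : ℕ} (hm : m < P.M) (i : Fin (q + 1)) (χ : feSpace 𝒯 r) :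
    ∑ m' ∈ Finset.range P.M, ∫ t in P.interval m',
        l2 ((deriv u t : feSpace 𝒯 r) : L2 Ω) (testFun P m i χ t : L2 Ω)
      = ∑ j : Fin (q + 1), (j : ℂ) / ((i : ℂ) + (j : ℂ)) * l2 (U m j : L2 Ω) (χ : L2 Ω) := by
  have hk : (P.step m : ℂ) ≠ 0 := by exact_mod_cast (P.step_pos hm).ne'
  rw [Finset.sum_eq_single m]
  · have h1 : ∀ᵐ t ∂volume.restrict (P.interval m),
        l2 ((deriv u t : feSpace 𝒯 r) : L2 Ω) (testFun P m i χ t : L2 Ω)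
        = ∑ j : Fin (q + 1), P.loc m t ^ ((j : ℕ) - 1 + i)
          * ((P.step m : ℂ)⁻¹ * j * l2 (U m j : L2 Ω) (χ : L2 Ω)) := by
      filter_upwards [P.deriv_eq (hU m hm), ae_restrict_mem measurableSet_Ioc] with t ht htm
      have ht' : (deriv u t : feSpace 𝒯 r) = (P.step m : ℂ)⁻¹ •
        ∑ j : Fin (q + 1), ((j : ℂ) * P.loc m t ^ ((j : ℕ) - 1)) • U m j := ht
      rw [testFun, Set.indicator_of_mem htm, l2_loc_smul, ht', Finset.smul_sum]
      rw [l2_eq_pairing, map_sum, Finset.mul_sum]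
      simp only [map_smul, smul_eq_mul, ← l2_eq_pairing]
      refine Finset.sum_congr rfl fun j _ => ?_
      rw [pow_add]; ring
    rw [integral_congr_ae h1, integral_finsetSum _ fun j _ => P.integrableOn_loc_mul _ _]
    refine Finset.sum_congr rfl fun j _ => ?_
    rw [integral_mul_const, P.integral_loc_pow hm]
    -- For j = 0 the truncated exponent j - 1 is harmless, since the coefficient j vanishes.
    rcases Nat.eq_zero_or_pos (j : ℕ) with h | h
    · simp [h]
    · have e : (((((j : ℕ) - 1 + (i : ℕ)) : ℕ) : ℂ) + 1) = (i : ℂ) + (j : ℂ) := by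
        have : ((j : ℕ) - 1 + (i : ℕ)) + 1 = (i : ℕ) + (j : ℕ) := by omega
        exact_mod_cast this
      rw [e]
      field_simp
  · intro m' hm' hne
    rw [Finset.mem_range] at hm'
    refine setIntegral_eq_zero_of_forall_eq_zero fun t ht => ?_
    have : t ∉ P.interval m := fun ht' => hne (P.index_unique hm' hm ht ht')
    rw [testFun, Set.indicator_of_notMem this, l2_zero_right]
  · intro h
    exact absurd (Finset.mem_range.2 hm) h

theorem integral_dirichlet_testFun {u : ℝ → feSpace 𝒯 r} {U : ℕ → Fin (q + 1) → feSpace 𝒯 r}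
    (hU : ∀ m < P.M, ∀ t ∈ P.interval m, u t = ∑ j : Fin (q + 1), P.loc m t ^ (j : ℕ) • U m j)
    {m : ℕ} (hm : m < P.M) (i : Fin (q + 1)) (χ : feSpace 𝒯 r) :
    ∫ t in Set.Ioc 0 T, dirichlet 𝒯 r (u t) (testFun P m i χ t)
      = P.step m * ∑ j : Fin (q + 1), massMat (q + 1) i j *
        l2 (((-discreteLaplacian 𝒯 r) (U m j) : feSpace 𝒯 r) : L2 Ω) (χ : L2 Ω) := by
  have h0 : ∀ t, dirichlet 𝒯 r (u t) (testFun P m i χ t) = (P.interval m).indicator (fun t =>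
      ∑ j : Fin (q + 1), P.loc m t ^ ((j : ℕ) + i)
          * l2 (((-discreteLaplacian 𝒯 r) (U m j) : feSpace 𝒯 r) : L2 Ω) (χ : L2 Ω)) t := by
    intro t
    rw [← discreteLaplacian_spec]
    by_cases ht : t ∈ P.interval m
    · rw [testFun, Set.indicator_of_mem ht, Set.indicator_of_mem ht, l2_loc_smul]
      have e : -discreteLaplacian 𝒯 r (u t) = ∑ j : Fin (q + 1), P.loc m t ^ (j : ℕ) •
          (-discreteLaplacian 𝒯 r) (U m j) := by
        rw [hU m hm t ht, ← LinearMap.neg_apply, map_sum]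
        simp only [map_smul]
      rw [e, l2_eq_pairing, map_sum, Finset.mul_sum]
      simp only [map_smul, smul_eq_mul, ← l2_eq_pairing]
      refine Finset.sum_congr rfl fun j _ => ?_
      rw [pow_add]; ring
    · rw [testFun, Set.indicator_of_notMem ht, Set.indicator_of_notMem ht, l2_zero_right]
  simp only [h0]
  rw [setIntegral_indicator (P.measurableSet_interval m), Set.inter_eq_right.2 (P.interval_subset hm),
    integral_finsetSum _ fun j _ => P.integrableOn_loc_mul _ _, Finset.mul_sum]
  refine Finset.sum_congr rfl fun j _ => ?_
  rw [integral_mul_const, P.integral_loc_pow hm, massMat, Matrix.of_apply]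
  push_cast
  ring

theorem integral_data_testFun {f : ℝ → L2 Ω} (hf : IntegrableOn f (Set.Ioc 0 T))
    {m : ℕ} (hm : m < P.M) (i : Fin (q + 1)) (χ : feSpace 𝒯 r) :
    ∫ t in Set.Ioc 0 T, l2 (f t) (testFun P m i χ t : L2 Ω)
      = P.step m * l2 (moment 𝒯 r q P f m i : L2 Ω) (χ : L2 Ω) := by
  have hk : (P.step m : ℂ) ≠ 0 := by exact_mod_cast (P.step_pos hm).ne'
  have h0 : ∀ t, l2 (f t) (testFun P m i χ t : L2 Ω) = (P.interval m).indicator (fun t =>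
      pairing χ (P.loc m t ^ (i : ℕ) • l2Projection 𝒯 r (f t))) t := by
    intro t
    by_cases ht : t ∈ P.interval m
    · rw [testFun, Set.indicator_of_mem ht, Set.indicator_of_mem ht, l2_loc_smul,
        ← l2Projection_spec, l2_eq_pairing, map_smul, smul_eq_mul]
    · rw [testFun, Set.indicator_of_notMem ht, Set.indicator_of_notMem ht, l2_zero_right]
  simp only [h0]
  rw [setIntegral_indicator (P.measurableSet_interval m), Set.inter_eq_right.2 (P.interval_subset hm),
    l2_eq_pairing, moment, map_smul, smul_eq_mul, mul_inv_cancel_left₀ hk]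
  exact (LinearMap.toContinuousLinearMap (pairing χ)).integral_comp_comm
    (integrableOn_moment hf hm i)

/-- Test functions that are a local power times a fixed χ on one interval and zero elsewhere
decouple the method into steps; pairing with all χ ∈ V_h then determines the vector equation. -/
theorem IsDGSolution.stepEquations {f : ℝ → L2 Ω} (hf : IntegrableOn f (Set.Ioc 0 T))
    {u : ℝ → feSpace 𝒯 r} (hu : IsDGSolution 𝒯 r q P f u) {U : ℕ → Fin (q + 1) → feSpace 𝒯 r}
    (hU : ∀ m < P.M, ∀ t ∈ P.interval m, u t = ∑ j : Fin (q + 1), P.loc m t ^ (j : ℕ) • U m j) :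
    StepEquations q (-discreteLaplacian 𝒯 r) P.step P.M U (moment 𝒯 r q P f) := by
  intro m hm i
  refine eq_of_pairing fun χ => ?_
  have hmain : (∑ j, dgMat q i j * pairing χ (U m j)) + (P.step m : ℂ) *
      ∑ j, massMat (q + 1) i j * pairing χ ((-discreteLaplacian 𝒯 r) (U m j))
      = (if i = 0 then 1 else 0) * pairing χ (prevVal U m)
        + (P.step m : ℂ) * pairing χ (moment 𝒯 r q P f m i) := by
    have h := hu.2 _ (memX_testFun hm i χ)
    rw [formB, integral_deriv_testFun hU hm, integral_dirichlet_testFun hU hm,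
      integral_data_testFun hf hm] at h
    have hjump : ∑ m' ∈ Finset.range P.M, l2 (jump 𝒯 r P u m' : L2 Ω)
        ((Function.rightLim (testFun P m i χ) (P.t m') : feSpace 𝒯 r) : L2 Ω)
        = (if i = 0 then 1 else 0) * (l2 (U m 0 : L2 Ω) (χ : L2 Ω)
          - l2 ((prevVal U m : feSpace 𝒯 r) : L2 Ω) (χ : L2 Ω)) := by
      rw [Finset.sum_eq_single m]
      · rw [rightLim_testFun hm hm, jump_eq hU hm, jumpCoeff, if_pos rfl]
        by_cases hi : i = 0
        · rw [if_pos ⟨rfl, hi⟩, if_pos hi, one_mul, l2_eq_pairing, map_sub]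
          rfl
        · rw [if_neg (fun h => hi h.2), if_neg hi, zero_mul, l2_zero_right]
      · intro m' hm' hne
        rw [rightLim_testFun hm (Finset.mem_range.1 hm'), if_neg (fun h => hne h.1), l2_zero_right]
      · intro h
        exact absurd (Finset.mem_range.2 hm) h
    rw [hjump] at h
    simp only [l2_eq_pairing] at h
    have e : ∑ j, dgMat q i j * pairing χ (U m j)
        = (∑ j : Fin (q + 1), (j : ℂ) / ((i : ℂ) + (j : ℂ)) * pairing χ (U m j))
          + (if i = 0 then 1 else 0) * pairing χ (U m 0) := by
      simp only [dgMat, Matrix.of_apply, add_mul, Finset.sum_add_distrib]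
      congr 1
      rw [Finset.sum_eq_single 0]
      · simp
      · intro j _ hj; simp [hj]
      · simp
    rw [e]
    linear_combination h
  simp only [map_add, map_sum, map_smul, smul_eq_mul]
  exact hmain

end reduction

end DGCG

namespace DGCG

/-! ### The spectral decomposition of the discrete Laplacian -/

section spectral

variable {d : ℕ} {Ω : TopologicalSpace.Opens (Eu d)} {𝒯 : Mesh Ω} {r : ℕ}

theorem dirichlet_conj (v w : feSpace 𝒯 r) :
    (starRingEnd ℂ) (dirichlet 𝒯 r v w) = dirichlet 𝒯 r w v := by
  simp only [dirichlet, map_sum, inner_conj_symm]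

theorem isSymmetric_neg_discreteLaplacian :
    (-discreteLaplacian 𝒯 r : feSpace 𝒯 r →ₗ[ℂ] feSpace 𝒯 r).IsSymmetric := by
  intro v w
  have h1 : inner ℂ w ((-discreteLaplacian 𝒯 r) v) = dirichlet 𝒯 r v w :=
    discreteLaplacian_spec 𝒯 r v w
  have h2 : inner ℂ v ((-discreteLaplacian 𝒯 r) w) = dirichlet 𝒯 r w v :=
    discreteLaplacian_spec 𝒯 r w v
  rw [h2, ← inner_conj_symm, h1, dirichlet_conj]

theorem exists_eigenbasis (𝒯 : Mesh Ω) (r : ℕ) :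
    ∃ (n : ℕ) (e : Module.Basis (Fin n) ℂ (feSpace 𝒯 r)) (ev : Fin n → ℝ),
      (∀ i, 0 ≤ ev i) ∧ -discreteLaplacian 𝒯 r = opFun e ev id := by
  have hs := isSymmetric_neg_discreteLaplacian (𝒯 := 𝒯) (r := r)
  refine ⟨_, (hs.eigenvectorBasis rfl).toBasis, hs.eigenvalues rfl, fun i => ?_, ?_⟩
  · have h1 := hs.apply_eigenvectorBasis rfl i
    set v := hs.eigenvectorBasis rfl i with hv
    set μ := hs.eigenvalues rfl i
    have h2 := discreteLaplacian_spec 𝒯 r v v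
    have h3 : (-discreteLaplacian 𝒯 r v : feSpace 𝒯 r) = (μ : ℂ) • v := h1
    have hn : l2 (v : L2 Ω) (v : L2 Ω) = 1 := by
      have h4 : ‖(v : L2 Ω)‖ = 1 := (hs.eigenvectorBasis rfl).orthonormal.1 i
      rw [l2, _root_.inner_self_eq_norm_sq_to_K, h4]
      simp
    rw [h3, l2_eq_pairing, map_smul, ← l2_eq_pairing, hn, smul_eq_mul, mul_one] at h2
    have h5 : dirichlet 𝒯 r v v = ((∑ i, ‖gradV 𝒯 r i v‖ ^ 2 : ℝ) : ℂ) := by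
      rw [dirichlet, Complex.ofReal_sum]
      refine Finset.sum_congr rfl fun i _ => ?_
      rw [_root_.inner_self_eq_norm_sq_to_K]
      push_cast
      rfl
    rw [h5] at h2
    have h6 : μ = ∑ i, ‖gradV 𝒯 r i v‖ ^ 2 := by exact_mod_cast h2
    rw [h6]
    positivity
  · refine (hs.eigenvectorBasis rfl).toBasis.ext fun i => ?_
    rw [opFun, Module.Basis.constr_basis, OrthonormalBasis.coe_toBasis]
    exact hs.apply_eigenvectorBasis rfl i

variable {n : ℕ} {e : Module.Basis (Fin n) ℂ (feSpace 𝒯 r)} {ev : Fin n → ℝ}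

theorem resolvent_eq_opFun (hev : ∀ i, 0 ≤ ev i) (hA : -discreteLaplacian 𝒯 r = opFun e ev id)
    {z : ℂ} (hz : z.arg ≠ 0) :
    resolvent (-discreteLaplacian 𝒯 r) z = opFun e ev fun w => (z - w)⁻¹ := by
  have hne : ∀ i, z - ev i ≠ 0 := by
    intro i h
    rw [sub_eq_zero.1 h, Complex.arg_ofReal_of_nonneg (hev i)] at hz
    exact hz rfl
  have h1 : (algebraMap ℂ (Module.End ℂ (feSpace 𝒯 r)) z - (-discreteLaplacian 𝒯 r))
      * opFun e ev (fun w => (z - w)⁻¹) = 1 := by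
    refine e.ext fun i => ?_
    rw [Module.End.mul_apply, hA, LinearMap.sub_apply, Module.algebraMap_end_apply]
    rw [Module.End.one_apply]
    simp only [opFun, Module.Basis.constr_basis, map_smul, id]
    rw [smul_smul, smul_smul, ← sub_smul, mul_comm z, ← mul_sub, inv_mul_cancel₀ (hne i), one_smul]
  have h2 := Ring.inverse_mul_cancel _ (isUnit_add_discreteLaplacian 𝒯 r z hz)
  calc _ = Ring.inverse (algebraMap ℂ (Module.End ℂ (feSpace 𝒯 r)) z - (-discreteLaplacian 𝒯 r))
        * ((algebraMap ℂ (Module.End ℂ (feSpace 𝒯 r)) z - (-discreteLaplacian 𝒯 r))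
          * opFun e ev (fun w => (z - w)⁻¹)) := by rw [h1, mul_one]; rfl
    _ = _ := by rw [← mul_assoc, h2, one_mul]

theorem ResolventEstimate.resolventBound {N : Seminorm ℂ (feSpace 𝒯 r)} {γ M : ℝ} (hγ : 0 < γ)
    (hev : ∀ i, 0 ≤ ev i) (hA : -discreteLaplacian 𝒯 r = opFun e ev id)
    (h : ResolventEstimate 𝒯 r N γ M) : ResolventBound e ev N γ M := by
  intro z hz v
  have hz0 : z.arg ≠ 0 := fun h0 => hz (by rw [h0, abs_zero]; exact hγ.le)
  rw [← resolvent_eq_opFun hev hA hz0]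
  exact h z hz v

/-- Testing an eigenvector with eigenvalue μ at z = -(μ + 1) gives M ≥ (μ + 1)/(2μ + 1) ≥ 1/2.
Definiteness of N is needed to divide by its value at the eigenvector. -/
theorem ResolventBound.half_le {N : Seminorm ℂ (feSpace 𝒯 r)} {γ M : ℝ} (hγ : γ < Real.pi)
    (hev : ∀ i, 0 ≤ ev i) (hN : ∀ v, N v = 0 → v = 0) (h : ResolventBound e ev N γ M) (i : Fin n) :
    1 / 2 ≤ M := by
  have hμ := hev i
  have h1 := h (-(ev i + 1) : ℝ) (by
    rw [Complex.arg_ofReal_of_neg (by linarith), abs_of_pos Real.pi_pos]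
    exact not_le.2 hγ) (e i)
  have h2 : opFun e ev (fun w => ((-(ev i + 1) : ℝ) - w)⁻¹) (e i)
      = ((-(2 * ev i + 1)⁻¹ : ℝ) : ℂ) • e i := by
    rw [opFun, Module.Basis.constr_basis]
    congr 1
    push_cast
    rw [← inv_neg]
    congr 1
    ring
  have hpos : 0 < N (e i) := lt_of_le_of_ne (apply_nonneg N _) fun h0 => e.ne_zero i (hN _ h0.symm)
  rw [h2, map_smul_eq_mul, Complex.norm_real, Complex.norm_real, norm_neg, norm_neg,
    Real.norm_of_nonneg (by positivity), Real.norm_of_nonneg (by positivity)] at h1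
  have h3 := le_of_mul_le_mul_right h1 hpos
  rw [inv_eq_one_div, div_le_div_iff₀ (by positivity) (by positivity)] at h3
  nlinarith

end spectral

/-! ### The estimate -/

/-- A finite convex function on a finite-dimensional space is continuous. -/
theorem continuous_seminorm {V : Type*} [NormedAddCommGroup V] [NormedSpace ℂ V]
    [FiniteDimensional ℂ V] (N : Seminorm ℂ V) : Continuous N := by
  have : FiniteDimensional ℝ V := FiniteDimensional.complexToReal V
  exact continuousOn_univ.1 ((N.convexOn).continuousOn isOpen_univ)

theorem integrable_seminorm_comp {V : Type*} [NormedAddCommGroup V] [NormedSpace ℂ V]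
    [FiniteDimensional ℂ V] (N : Seminorm ℂ V) {α : Type*} [MeasurableSpace α] {μ : Measure α}
    {f : α → V} (hf : Integrable f μ) : Integrable (fun x => N (f x)) μ := by
  obtain ⟨C, _, hC⟩ := Seminorm.bound_of_continuous_normedSpace N (continuous_seminorm N)
  refine Integrable.mono' (hf.norm.const_mul C)
    ((continuous_seminorm N).comp_aestronglyMeasurable hf.1) (Eventually.of_forall fun x => ?_)
  rw [Real.norm_of_nonneg (apply_nonneg N _)]
  exact hC _

section estimate

variable {d : ℕ} {Ω : TopologicalSpace.Opens (Eu d)} {T : ℝ} {𝒯 : Mesh Ω} {r q : ℕ}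
  {P : TimePartition T} {f : ℝ → L2 Ω} {N : Seminorm ℂ (feSpace 𝒯 r)}

theorem integrableOn_projection (hf : IntegrableOn f (Set.Ioc 0 T)) :
    IntegrableOn (fun t => l2Projection 𝒯 r (f t)) (Set.Ioc 0 T) :=
  (l2Projection 𝒯 r).integrable_comp hf

theorem seminorm_moment_le (hf : IntegrableOn f (Set.Ioc 0 T)) {m : ℕ} (hm : m < P.M)
    (i : Fin (q + 1)) : N (moment 𝒯 r q P f m i)
      ≤ (P.step m)⁻¹ * ∫ t in P.interval m, N (l2Projection 𝒯 r (f t)) := by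
  have hk := P.step_pos hm
  rw [moment, map_smul_eq_mul, norm_inv, Complex.norm_real, Real.norm_of_nonneg hk.le]
  refine mul_le_mul_of_nonneg_left ?_ (by positivity)
  refine seminorm_integral_le N (integrableOn_moment hf hm i) (integrable_seminorm_comp N
    ((integrableOn_projection hf).mono_set (P.interval_subset hm))) ?_
  filter_upwards [ae_restrict_mem (P.measurableSet_interval m)] with t ht
  rw [map_smul_eq_mul, norm_pow]
  exact mul_le_of_le_one_left (apply_nonneg N _)
    (pow_le_one₀ (norm_nonneg _) (P.norm_loc_le hm ht))

/-- Each of the q + 1 moments is at most the mean of the norm of P_h f over its interval. The mean's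
1/k_l cancels the k_l in the weight and leaves the kernel. -/
theorem weighted_sum_le (hf : IntegrableOn f (Set.Ioc 0 T)) {m : ℕ} (hm : m < P.M) :
    ENNReal.ofReal (∑ l ∈ Finset.range (m + 1), stepWeight P.step l m
        * ∑ j, N (moment 𝒯 r q P f l j))
      ≤ ENNReal.ofReal (q + 1) *
        ∫⁻ t in Set.Ioc 0 T, P.kernel m t * ‖N (l2Projection 𝒯 r (f t))‖ₑ := by
  have hlM : ∀ l ∈ Finset.range (m + 1), l < P.M := fun l hl => by
    rw [Finset.mem_range] at hl; omega
  have hg : ∀ l < P.M, IntegrableOn (fun t => N (l2Projection 𝒯 r (f t))) (P.interval l) :=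
    fun l hl => integrable_seminorm_comp N
      ((integrableOn_projection hf).mono_set (P.interval_subset hl))
  have hpos : ∀ l ∈ Finset.range (m + 1), 0 < P.t (m + 1) - P.t l := fun l hl =>
    sub_pos.2 (P.t_strictMono (by rw [Finset.mem_range] at hl; omega) hm)
  have h1 : ∀ l ∈ Finset.range (m + 1), stepWeight P.step l m * ∑ j, N (moment 𝒯 r q P f l j)
      ≤ (q + 1) * (1 / (P.t (m + 1) - P.t l)
        * ∫ t in P.interval l, N (l2Projection 𝒯 r (f t))) := by
    intro l hl
    have hl' := hlM l hl
    have hk := P.step_pos hl'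
    have h2 : ∑ j, N (moment 𝒯 r q P f l j)
        ≤ (q + 1) * ((P.step l)⁻¹ * ∫ t in P.interval l, N (l2Projection 𝒯 r (f t))) := by
      refine (Finset.sum_le_card_nsmul _ _ _ fun j _ => seminorm_moment_le hf hl' j).trans ?_
      simp
    have h3 : 0 ≤ stepWeight P.step l m := stepWeight_nonneg (fun n hn => P.step_pos (by omega))
      (by rw [Finset.mem_range] at hl; omega)
    calc _ ≤ stepWeight P.step l m
          * ((q + 1) * ((P.step l)⁻¹ * ∫ t in P.interval l, N (l2Projection 𝒯 r (f t)))) := by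
          gcongr
      _ = _ := by
        rw [stepWeight, P.sum_step (by rw [Finset.mem_range] at hl; omega)]
        have := (hpos l hl).ne'
        field_simp
  refine (ENNReal.ofReal_le_ofReal (Finset.sum_le_sum h1)).trans ?_
  have h0 : ∀ l, 0 ≤ ∫ t in P.interval l, N (l2Projection 𝒯 r (f t)) := fun l =>
    integral_nonneg fun t => apply_nonneg N _
  rw [← Finset.mul_sum, ENNReal.ofReal_mul (by positivity), P.lintegral_kernel_mul hm]
  gcongr
  rw [ENNReal.ofReal_sum_of_nonneg fun l hl =>
    mul_nonneg (one_div_nonneg.2 (hpos l hl).le) (h0 l)]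
  refine Finset.sum_le_sum fun l hl => ?_
  rw [ENNReal.ofReal_mul (one_div_nonneg.2 (hpos l hl).le),
    ofReal_integral_eq_lintegral_ofReal (hg l (hlM l hl))
      (Eventually.of_forall fun t => apply_nonneg N _)]
  gcongr with t
  rw [Real.enorm_of_nonneg (apply_nonneg N _)]

variable {u : ℝ → feSpace 𝒯 r} {U : ℕ → Fin (q + 1) → feSpace 𝒯 r}

theorem seminorm_discreteLaplacian_le
    (hU : ∀ m < P.M, ∀ t ∈ P.interval m, u t = ∑ j : Fin (q + 1), P.loc m t ^ (j : ℕ) • U m j)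
    {m : ℕ} (hm : m < P.M) {B : ℝ} (hB : ∀ i, N ((-discreteLaplacian 𝒯 r) (U m i)) ≤ B) {t : ℝ}
    (ht : t ∈ P.interval m) : N (discreteLaplacian 𝒯 r (u t)) ≤ (q + 1) * B := by
  have e : N (discreteLaplacian 𝒯 r (u t)) = N ((-discreteLaplacian 𝒯 r) (u t)) := by
    rw [LinearMap.neg_apply, map_neg_eq_map]
  rw [e, hU m hm t ht, map_sum]
  refine (seminorm_sum_le N _ _).trans ((Finset.sum_le_card_nsmul _ _ B fun j _ => ?_).trans ?_)
  · rw [map_smul, map_smul_eq_mul, norm_pow]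
    exact (mul_le_of_le_one_left (apply_nonneg N _)
      (pow_le_one₀ (norm_nonneg _) (P.norm_loc_le hm ht))).trans (hB j)
  · simp

theorem seminorm_deriv_le
    (hU : ∀ m < P.M, ∀ t ∈ P.interval m, u t = ∑ j : Fin (q + 1), P.loc m t ^ (j : ℕ) • U m j)
    {m : ℕ} (hm : m < P.M) {B : ℝ} (hB0 : 0 ≤ B)
    (hB : ∀ i, N (jumpCoeff U m i) ≤ P.step m * B) :
    ∀ᵐ t ∂volume.restrict (P.interval m), N (deriv u t) ≤ (q + 1) * ((q + 1) * B) := by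
  have hk := P.step_pos hm
  filter_upwards [P.deriv_eq (hU m hm), ae_restrict_mem (P.measurableSet_interval m)] with t ht htm
  have ht' : (deriv u t : feSpace 𝒯 r) = (P.step m : ℂ)⁻¹ •
        ∑ j : Fin (q + 1), ((j : ℂ) * P.loc m t ^ ((j : ℕ) - 1)) • U m j := ht
  rw [ht', map_smul_eq_mul, norm_inv, Complex.norm_real, Real.norm_of_nonneg hk.le]
  have h1 : N (∑ j : Fin (q + 1), ((j : ℂ) * P.loc m t ^ ((j : ℕ) - 1)) • U m j)
      ≤ (q + 1) * ((q + 1) * (P.step m * B)) := by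
    refine (seminorm_sum_le N _ _).trans
      ((Finset.sum_le_card_nsmul _ _ ((q + 1) * (P.step m * B)) fun j _ => ?_).trans ?_)
    · rw [map_smul_eq_mul]
      by_cases hj : j = 0
      · subst hj
        simp only [Fin.val_zero, Nat.cast_zero, zero_mul, norm_zero]
        positivity
      · have h2 := hB j
        rw [jumpCoeff, if_neg hj, sub_zero] at h2
        have h3 : ‖(j : ℂ) * P.loc m t ^ ((j : ℕ) - 1)‖ ≤ q + 1 := by
          rw [norm_mul, norm_pow, Complex.norm_natCast]
          have h4 : ((j : ℕ) : ℝ) ≤ q + 1 := by exact_mod_cast j.2.le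
          calc _ ≤ ((q : ℝ) + 1) * 1 := by
                gcongr
                exact pow_le_one₀ (norm_nonneg _) (P.norm_loc_le hm htm)
            _ = _ := mul_one _
        gcongr
    · simp
  calc _ ≤ (P.step m)⁻¹ * ((q + 1) * ((q + 1) * (P.step m * B))) := by gcongr
    _ = _ := by field_simp

theorem jumpNorm_eq_stepNorm (s : ℝ≥0∞) : jumpNorm 𝒯 r P N s u = P.stepNorm s fun m =>
    ENNReal.ofReal (N ((((P.step m)⁻¹ : ℝ) : ℂ) • jump 𝒯 r P u m)) := rfl

theorem norms_eq_zero (hN : ∀ v, N v = 0) {s : ℝ≥0∞} (hs : 1 ≤ s) :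
    timeNorm T N s (fun t => deriv u t) + timeNorm T N s (fun t => discreteLaplacian 𝒯 r (u t))
      + jumpNorm 𝒯 r P N s u = 0 := by
  have h1 : ∀ w : ℝ → feSpace 𝒯 r, timeNorm T N s w = 0 := fun w => by simp [timeNorm, hN]
  rw [h1, h1, jumpNorm_eq_stepNorm]
  have h2 := P.stepNorm_const_mul hs 0 fun _ => 0
  simp only [zero_mul] at h2
  simp [hN, h2]

end estimate

end DGCG

/-! ### Assembly of the estimate. -/

theorem mainTheorem10 {d : ℕ} (hd : d = 2 ∨ d = 3)
    (Ω : TopologicalSpace.Opens (Eu d)) (hΩ : IsLipschitzDomain Ω)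
    (T : ℝ) (hT : 0 < T) (q r : ℕ) (hr : 1 ≤ r)
    (c β κ : ℝ) (hc : 0 < c) (hβ : 0 < β) (hκ : 0 < κ)
    (γ : ℝ) (hγ₀ : 0 < γ) (hγ : γ < Real.pi / 2)
    (s : ENNReal) (hs : 1 ≤ s) :
    ∃ C : ℝ, 0 < C ∧
      ∀ (P : TimePartition T), P.Admissible c β κ →
      ∀ (𝒯 : Mesh Ω) (N : Seminorm ℂ (feSpace 𝒯 r)), (∀ v, N v = 0 → v = 0) →
      ∀ Mh : ℝ, ResolventEstimate 𝒯 r N γ Mh →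
      ∀ f : ℝ → L2 Ω, MeasureTheory.IntegrableOn f (Set.Ioc 0 T) →
      ∀ u : ℝ → feSpace 𝒯 r, IsDGSolution 𝒯 r q P f u →
        timeNorm T N s (fun t => deriv u t)
          + timeNorm T N s (fun t => discreteLaplacian 𝒯 r (u t))
          + jumpNorm 𝒯 r P N s u
        ≤ ENNReal.ofReal (C * Mh * Real.log (T / P.kmax))
            * timeNorm T N s (fun t => l2Projection 𝒯 r (f t)) := by
  obtain ⟨CL, hCL, hlog⟩ := TimePartition.exists_log_bound hT hc hβ
  -- The contour angle is the midpoint between γ and π/2: the rays lie where the resolvent estimate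
  -- holds, and the sector stays inside the right half plane, where the method is stable.
  obtain ⟨C, hC, hcore⟩ := exists_jumpCoeff_bound q (θ := (γ + Real.pi / 2) / 2) (κ := κ)
    (by linarith) (by linarith) hκ
  -- The 3 counts the terms on the left, (q + 1)² bounds a time derivative by its coefficients, the
  -- next q + 1 counts moments, and `CL` compares the logarithms.
  refine ⟨3 * (((q : ℝ) + 1) * (((q : ℝ) + 1) * C)) * ((q : ℝ) + 1) * CL, by positivity, ?_⟩
  intro P hP 𝒯 N hN Mh hres f hf u hu
  obtain ⟨n, e, ev, hev, hA⟩ := exists_eigenbasis 𝒯 r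
  have hres' := hres.resolventBound hγ₀ hev hA
  -- If V_h = 0 the resolvent estimate says nothing about M_h, which might even be negative, but the
  -- left side is zero.
  rcases Nat.eq_zero_or_pos n with hn | hn
  · subst hn
    have hz : ∀ v, N v = 0 := fun v => by
      rw [← e.sum_repr v, Finset.univ_eq_empty, Finset.sum_empty, map_zero]
    rw [norms_eq_zero hz hs]
    exact zero_le
  have hM : 1 / 2 ≤ Mh := hres'.half_le (by linarith) hev hN ⟨0, hn⟩
  have hM0 : 0 < Mh := by linarith
  obtain ⟨U, hU⟩ := hu.1.exists_local
  have heq := hu.stepEquations hf hU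
  rw [hA] at heq
  have hratio : ∀ m, m + 1 < P.M →
      P.step m ≤ κ * P.step (m + 1) ∧ P.step (m + 1) ≤ κ * P.step m := by
    intro m hm
    obtain ⟨h1, h2⟩ := hP.ratio m hm
    have hk := P.step_pos hm
    rw [div_le_iff₀ hk] at h2
    rw [le_div_iff₀ hk, inv_mul_le_iff₀ hκ] at h1
    exact ⟨h2, h1⟩
  have hest := hcore hev hres' (by linarith) hM P.step P.M (fun m hm => P.step_pos hm) hratio U
    (moment 𝒯 r q P f) heq
  rw [← hA] at hest
  set W : ℕ → ℝ := fun m => ∑ l ∈ Finset.range (m + 1), stepWeight P.step l m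
    * ∑ j, N (moment 𝒯 r q P f l j) with hW
  have hW0 : ∀ m < P.M, 0 ≤ W m := fun m hm => Finset.sum_nonneg fun l hl =>
    mul_nonneg (stepWeight_nonneg (fun p hp => P.step_pos (by omega))
      (by rw [Finset.mem_range] at hl; omega)) (Finset.sum_nonneg fun j _ => apply_nonneg N _)
  set L := Real.log (T / P.kmax) with hL
  have hL1 : 1 ≤ L := P.one_le_log hT hP
  set g : ℝ → ℝ := fun t => N (l2Projection 𝒯 r (f t)) with hg
  have hgm : AEMeasurable g (volume.restrict (Set.Ioc 0 T)) :=
    (integrable_seminorm_comp N (integrableOn_projection hf)).1.aemeasurable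
  set A₀ : ℝ := ((q : ℝ) + 1) * (((q : ℝ) + 1) * (C * Mh)) with hA₀
  have hA₀0 : 0 ≤ A₀ := by positivity
  set b : ℕ → ℝ≥0∞ := fun m => ENNReal.ofReal (A₀ * W m) with hb
  have hq1 : (1 : ℝ) ≤ (q : ℝ) + 1 := by
    have : (0 : ℝ) ≤ q := Nat.cast_nonneg q
    linarith
  have hsub : ∀ m < P.M, C * Mh * W m ≤ ((q : ℝ) + 1) * (C * Mh * W m) := fun m hm =>
    le_mul_of_one_le_left (mul_nonneg (by positivity) (hW0 m hm)) hq1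
  have b1 : timeNorm T N s (fun t => deriv u t) ≤ P.stepNorm s b := by
    refine P.eLpNorm_le_stepNorm hs fun m hm => ?_
    have hpos : 0 ≤ C * Mh * W m := mul_nonneg (by positivity) (hW0 m hm)
    filter_upwards [seminorm_deriv_le hU hm hpos fun i => (hest m hm i).2] with t ht
    rw [Real.enorm_of_nonneg (apply_nonneg N _)]
    refine ENNReal.ofReal_le_ofReal (ht.trans (le_of_eq ?_))
    rw [hA₀]; ring
  have b2 : timeNorm T N s (fun t => discreteLaplacian 𝒯 r (u t)) ≤ P.stepNorm s b := by
    refine P.eLpNorm_le_stepNorm hs fun m hm => ?_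
    filter_upwards [ae_restrict_mem (P.measurableSet_interval m)] with t ht
    rw [Real.enorm_of_nonneg (apply_nonneg N _)]
    refine ENNReal.ofReal_le_ofReal
      ((seminorm_discreteLaplacian_le hU hm (fun i => (hest m hm i).1) ht).trans ?_)
    calc _ ≤ ((q : ℝ) + 1) * (((q : ℝ) + 1) * (C * Mh * W m)) :=
          mul_le_mul_of_nonneg_left (hsub m hm) (by positivity)
      _ = _ := by rw [hA₀]; ring
  have b3 : jumpNorm 𝒯 r P N s u ≤ P.stepNorm s b := by
    rw [jumpNorm_eq_stepNorm]
    refine P.stepNorm_mono fun m hm => ENNReal.ofReal_le_ofReal ?_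
    have hk := P.step_pos hm
    rw [jump_eq hU hm, map_smul_eq_mul, Complex.norm_real, Real.norm_of_nonneg (by positivity)]
    have h1 := (hest m hm 0).2
    rw [inv_mul_le_iff₀ hk]
    refine h1.trans (mul_le_mul_of_nonneg_left ?_ hk.le)
    calc _ ≤ ((q : ℝ) + 1) * (C * Mh * W m) := hsub m hm
      _ ≤ ((q : ℝ) + 1) * (((q : ℝ) + 1) * (C * Mh * W m)) :=
          mul_le_mul_of_nonneg_left (hsub m hm) (by positivity)
      _ = _ := by rw [hA₀]; ring
  have b4 : P.stepNorm s b ≤ ENNReal.ofReal (A₀ * (q + 1) * (CL * L)) * eLpNorm g s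
      (volume.restrict (Set.Ioc 0 T)) := by
    have h1 : P.stepNorm s b ≤ P.stepNorm s fun m => ENNReal.ofReal (A₀ * (q + 1)) *
        ∫⁻ t in Set.Ioc 0 T, P.kernel m t * ‖g t‖ₑ := by
      refine P.stepNorm_mono fun m hm => ?_
      simp only [hb]
      rw [ENNReal.ofReal_mul hA₀0, ENNReal.ofReal_mul hA₀0, mul_assoc]
      gcongr
      exact weighted_sum_le hf hm
    rw [P.stepNorm_const_mul hs] at h1
    have h2 := P.stepNorm_kernel_le hs
      (fun l hl => ENNReal.ofReal_le_ofReal (hlog P hP l hl)) hgm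
    have hAq : 0 ≤ A₀ * ((q : ℝ) + 1) := by positivity
    calc _ ≤ _ := h1
      _ ≤ ENNReal.ofReal (A₀ * (q + 1)) * (ENNReal.ofReal (CL * L) * eLpNorm g s
          (volume.restrict (Set.Ioc 0 T))) := by gcongr
      _ = _ := by rw [← mul_assoc, ← ENNReal.ofReal_mul hAq]
  calc _ ≤ P.stepNorm s b + P.stepNorm s b + P.stepNorm s b := add_le_add (add_le_add b1 b2) b3
    _ = 3 * P.stepNorm s b := by ring
    _ ≤ 3 * (ENNReal.ofReal (A₀ * (q + 1) * (CL * L)) * eLpNorm g s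
      (volume.restrict (Set.Ioc 0 T))) := by gcongr
    _ = _ := by
      have h3 : (3 : ℝ≥0∞) = ENNReal.ofReal 3 := by simp
      rw [h3, ← mul_assoc, ← ENNReal.ofReal_mul (by norm_num)]
      congr 2
      rw [hA₀]; ring
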